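/- **Setting.** Let $n\ge 1$, $L_0>0$, let $X\subseteq\mathbb R^n$ be convex and bounded with diameter $D_X=\sup_{x,x'\in X}\|x-x'\|$ (Euclidean norm). Let $Q$ be the law of a random sample $\boldsymbol\xi$, let $G(x,\xi)$ be a jointly measurable random integrand and $f:\mathbb R^n\to\mathbb R$ an objective, given by one of the following. (a) *Standard setting.* $G=F$, where $F(\bullet,\xi)$ is convex on $\mathbb R^n$ for every $\xi$, $F(x,\boldsymbol\xi)$ is integrable for every $x$, $f(x)=\mathbb E_{\boldsymbol\xi\sim Q}[F(x,\boldsymbol\xi)]$, and $\|F(x,\bullet)-F(y,\bullet)\|_{L^2(Q)}\le L_0\|x-y\|$ for all $x,y\in\mathbb R^n$. (b1) *Decision-dependent setting, known densities.* For each $x$, $p(\bullet\mid x)$ is a probability density that is positive on $\Xi(x)$ and vanishes off $\Xi(x)$; $\tilde p>0$ is a probability density, $Q$ has density $\tilde p$, $G(x,\xi)=\hat F(x,\xi)\,p(\xi\mid x)/\tilde p(\xi)$, and $f(x)=\int_{\Xi(x)}\hat F(x,\xi)p(\xi\mid x)\,d\xi$ is convex on $\mathbb R^n$. For all $x,y\in\mathbb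 R^n$: $D_{\rm KL}(p(\bullet|x)\|p(\bullet|y))+D_{\rm KL}(p(\bullet|y)\|p(\bullet|x))\le L_\xi^2\|x-y\|^2$; $p(\xi\mid x)/\tilde p(\xi)\le M$ on $\Xi(x)$; $\|\hat F(x,\bullet)-\hat F(y,\bullet)\|_{L^2(\tilde p)}\le\hat L_f\|x-y\|$; $|\hat F(x,\xi)|\le M_f$ for almost every $\xi\in\Xi(x)$; and $L_0=\sqrt{2(M^2\hat L_f^2+MM_f^2L_\xi^2)}$. (b2) *Decision-dependent setting, unknown distributions.* A sample is a realization of a random field $\boldsymbol\xi=(\boldsymbol\xi_x)_{x\in\mathbb R^n}$ with $\boldsymbol\xi_x\sim\mathcal D(x)$, $G(x,\boldsymbol\xi)=\hat F(x,\boldsymbol\xi_x)$ is integrable for every $x$, $f(x)=\mathbb E[\hat F(x,\boldsymbol\xi_x)]$ is convex on $\mathbb R^n$, and $\|\hat F(x,\boldsymbol\xi_x)-\hat F(y,\boldsymbol\xi_y)\|_{L^2}\le L_0\|x-y\|$ for all $x,y\in\mathbb R^n$. **Scheme.** Let $\gamma_k,\eta_k>0$, $x_0\in X$ (possibly random), and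 let $x_{k+1}$ be the Euclidean projection onto $X$ of $x_k-\gamma_k\tilde g_{\eta_k}(x_k,V_k,Z_k,\boldsymbol\xi_k)$ (assumed to exist, as it does when $X$ is closed), where $$\tilde g_\eta^i(x,v,z,\xi)=\frac{G(x_i+\eta\sqrt{2v},\,x^{-i}-z^{-i},\,\xi)-G(x_i-\eta\sqrt{2v},\,x^{-i}-z^{-i},\,\xi)}{\eta\sqrt{2\pi}},\qquad i=1,\dots,n,$$ and $V_k\sim\mathrm{Exp}(1)$, $Z_k\sim\mathcal N_n(0,\eta_k^2I)$, $\boldsymbol\xi_k\sim Q$ are independent of one another, over all $k$, and of $x_0$. Let $x^*\in X$ minimize $f$ over $X$, and for $K\ge1$ let $\bar x_K=\sum_{k=0}^{K-1}\gamma_kx_k\big/\sum_{k=0}^{K-1}\gamma_k$. Put $$c_K=\sum_{k=0}^{K-1}\gamma_k^2,\quad c_n=\frac{4nL_0^2}{\pi},\quad c_L=8D_X^2L_0^2,\quad I_{A_K}=\sqrt{8\Big(1+\frac{4n}{\pi}\Big)D_X^2L_0^2c_K},\quad I_{B_K}=c_nc_K.$$ **(i)** In each of the settings (a), (b1), (b2),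 for all $K\ge1$ and $\lambda>0$, $$\mathbb P\left(f(\bar x_K)-f(x^*)\ge\frac{D_X^2+\sum_{k=0}^{K-1}2L_0\sqrt{n+1}\,\gamma_k\eta_k+\lambda(I_{A_K}+I_{B_K})}{2\sum_{k=0}^{K-1}\gamma_k}\right)\le\frac1\lambda+\frac1{\lambda^2}.$$ For (ii)-(iv) suppose in addition that $\mathbb E\big[\exp(|G(x,\boldsymbol\xi)-G(y,\boldsymbol\xi)|^2)\big]\le\exp(L_0^2\|x-y\|^2)$ for all $x,y\in\mathbb R^n$. There is a constant $\alpha\in(0,1)$ depending only on $n$ such that (ii) and (iv) hold. **(ii)** In the settings (a) and (b1), for all $K\ge1$ and all $\varepsilon>0$ with $\varepsilon\ge c_nc_K$, $$\mathbb P\left(f(\bar x_K)-f(x^*)\ge\frac{c_{D,K,n}+\varepsilon+\sqrt{\frac{2nc_Lc_K}{\alpha}\varepsilon}}{2\sum_{k=0}^{K-1}\gamma_k}\right)\le e^{-\varepsilon/3}+\Big(\frac{\varepsilon}{c_nc_K}\Big)^{c_K}e^{c_K-\varepsilon/c_n},$$ where $c_{D,K,n}=D_X^2+\sum_{k=0}^{K-1}2L_0\sqrt{n+1}\,\gamma_k\eta_k+\sqrt{2nc_Lc_K/\alpha}$.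 **(iii)** In each of the three settings, if $\gamma_k=\eta_k=(k+1)^{-1/2}$ for all $k$, then for every integer $K\ge1$ $$\mathbb P\left(f(\bar x_K)-f(x^*)\ge\frac{C\,n\ln K}{\sqrt K}\right)\le K^{-4/3}+K^{\ln4-3},$$ where $C>0$ depends only on $L_0$ and $D_X$ (not on $n$ or $K$). **(iv)** In each of the three settings, if $\gamma_k=\eta_k=(k+1)^{-1/2}$ for all $k$, $K\ge1$, and $\varepsilon>0$ satisfies $c_K=\frac{\varepsilon}{2c_n}$, then $$\mathbb P\left(f(\bar x_K)-f(x^*)\ge\frac{\varepsilon}{4c_n}\left(D_X^2+\sqrt{\frac{c_Ln\varepsilon}{\alpha c_n}}+\varepsilon\Big(2L_0\sqrt{n+1}+1+\sqrt{\frac{2nc_L}{2\alpha c_n}}\Big)\right)\right)\le e^{-\varepsilon/3}+\Big(\frac e2\Big)^{-\frac{\varepsilon}{2c_n}}.$$ -/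

import Mathlib

open MeasureTheory ProbabilityTheory Set
open scoped ENNReal

universe u v w

noncomputable section

namespace EsGs

/-- The space `ℝⁿ` with the Euclidean norm. -/
abbrev E (n : ℕ) : Type := EuclideanSpace ℝ (Fin n)

/-! ### The optimization problem

All settings provide a probability measure `Q` on a sample space `Θ`, a random integrand
`G : ℝⁿ → Θ → ℝ` that can be queried at several points for one sample `θ ∼ Q`, and an
objective function `f`. -/

/-- The standard (non-decision-dependent) convex setting: `f x = 𝔼_{θ ∼ Q} [G x θ]`, where `G`
is convex in `x` for every sample and `L₀`-Lipschitz in the `L²` norm of the sample. -/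
structure StandardSetting {n : ℕ} {Θ : Type u} [MeasurableSpace Θ] (L₀ : ℝ) (Q : Measure Θ)
    (G : E n → Θ → ℝ) (f : E n → ℝ) : Prop where
  measurable : Measurable (Function.uncurry G)
  integrable : ∀ x, Integrable (G x) Q
  objective : ∀ x, f x = ∫ θ, G x θ ∂Q
  lipschitz : ∀ x y, eLpNorm (fun θ => G x θ - G y θ) 2 Q ≤ ENNReal.ofReal (L₀ * ‖x - y‖)
  convex : ∀ θ, ConvexOn ℝ univ (fun x => G x θ)

/-- Data of the decision-dependent setting with known densities. The random variable takes values
in `Θ`, and `p x` is its density, for the decision `x`, with respect to the reference measure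
`ν`; it is carried by `supp x`. Samples are drawn from the density `pt`. -/
structure KnownDensityData {n : ℕ} {Θ : Type u} [MeasurableSpace Θ] (ν : Measure Θ)
    (Fhat p : E n → Θ → ℝ) (pt : Θ → ℝ) (supp : E n → Set Θ) (M Mf Lf Lξ : ℝ) : Prop where
  measurable_Fhat : Measurable (Function.uncurry Fhat)
  measurable_p : Measurable (Function.uncurry p)
  measurable_pt : Measurable pt
  measurable_supp : ∀ x, MeasurableSet (supp x)
  pt_pos : ∀ ξ, 0 < pt ξ
  pt_prob : IsProbabilityMeasure (ν.withDensity fun ξ => ENNReal.ofReal (pt ξ))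
  p_prob : ∀ x, IsProbabilityMeasure (ν.withDensity fun ξ => ENNReal.ofReal (p x ξ))
  p_pos : ∀ x, ∀ ξ ∈ supp x, 0 < p x ξ
  p_zero : ∀ x, ∀ ξ ∉ supp x, p x ξ = 0
  const_nonneg : 0 ≤ M ∧ 0 ≤ Mf ∧ 0 ≤ Lf ∧ 0 ≤ Lξ
  /-- The symmetric Kullback-Leibler divergence is at most `Lξ² ‖x - y‖²`. -/
  kl_le : ∀ x y,
    InformationTheory.klDiv (ν.withDensity fun ξ => ENNReal.ofReal (p x ξ))
        (ν.withDensity fun ξ => ENNReal.ofReal (p y ξ)) +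
      InformationTheory.klDiv (ν.withDensity fun ξ => ENNReal.ofReal (p y ξ))
        (ν.withDensity fun ξ => ENNReal.ofReal (p x ξ)) ≤
    ENNReal.ofReal (Lξ ^ 2 * ‖x - y‖ ^ 2)
  ratio_le : ∀ x, ∀ ξ ∈ supp x, p x ξ / pt ξ ≤ M
  lipschitz : ∀ x y,
    eLpNorm (fun ξ => Fhat x ξ - Fhat y ξ) 2 (ν.withDensity fun ξ => ENNReal.ofReal (pt ξ)) ≤
      ENNReal.ofReal (Lf * ‖x - y‖)
  bounded : ∀ x, ∀ᵐ ξ ∂(ν.restrict (supp x)), |Fhat x ξ| ≤ Mf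

/-- The decision-dependent setting with known densities and a convex objective
`f x = ∫_{supp x} Fhat x ξ p(ξ | x) dν(ξ)`. Samples are drawn from `pt`, the integrand that is
queried is `Fhat x ξ * p(ξ | x) / pt ξ`, and `L₀ = √(2 (M² Lf² + M Mf² Lξ²))`. -/
def KnownDensitySetting {n : ℕ} {Θ : Type u} [MeasurableSpace Θ] (L₀ : ℝ) (Q : Measure Θ)
    (G : E n → Θ → ℝ) (f : E n → ℝ) : Prop :=
  ∃ (ν : Measure Θ) (Fhat p : E n → Θ → ℝ) (pt : Θ → ℝ) (supp : E n → Set Θ)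
    (M Mf Lf Lξ : ℝ),
    SigmaFinite ν ∧
    KnownDensityData ν Fhat p pt supp M Mf Lf Lξ ∧
    L₀ = √(2 * (M ^ 2 * Lf ^ 2 + M * Mf ^ 2 * Lξ ^ 2)) ∧
    Q = ν.withDensity (fun ξ => ENNReal.ofReal (pt ξ)) ∧
    (∀ x ξ, G x ξ = Fhat x ξ * p x ξ / pt ξ) ∧
    (∀ x, f x = ∫ ξ in supp x, Fhat x ξ * p x ξ ∂ν) ∧
    ConvexOn ℝ univ f

/-- The decision-dependent setting with unknown distributions `D x` and a convex objective
`f x = 𝔼_{ζ ∼ D x} [Fhat x ζ]`. One sample `θ ∼ Q` determines a realization `x ↦ ξ x θ` of a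
random field with marginals `D x`; the integrand that is queried is `Fhat x (ξ x θ)`, and it is
`L₀`-Lipschitz in the `L²` norm of the field. -/
def RandomFieldSetting {n : ℕ} {Θ : Type u} [MeasurableSpace Θ] (L₀ : ℝ) (Q : Measure Θ)
    (G : E n → Θ → ℝ) (f : E n → ℝ) : Prop :=
  ∃ (Ξ : Type v) (_ : MeasurableSpace Ξ) (D : E n → Measure Ξ) (ξ : E n → Θ → Ξ)
    (Fhat : E n → Ξ → ℝ),
    (∀ x, Measurable (ξ x)) ∧
    (∀ x, Q.map (ξ x) = D x) ∧
    (∀ x, Measurable (Fhat x)) ∧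
    (∀ x, Integrable (Fhat x) (D x)) ∧
    (∀ x θ, G x θ = Fhat x (ξ x θ)) ∧
    Measurable (Function.uncurry G) ∧
    (∀ x, f x = ∫ ζ, Fhat x ζ ∂(D x)) ∧
    (∀ x y, eLpNorm (fun θ => Fhat x (ξ x θ) - Fhat y (ξ y θ)) 2 Q ≤
      ENNReal.ofReal (L₀ * ‖x - y‖)) ∧
    ConvexOn ℝ univ f

/-- The sub-Gaussian property of the random integrand. -/
def SubGaussianIncrements {n : ℕ} {Θ : Type u} [MeasurableSpace Θ] (L₀ : ℝ) (Q : Measure Θ)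
    (G : E n → Θ → ℝ) : Prop :=
  ∀ x y, ∫⁻ θ, ENNReal.ofReal (Real.exp ((G x θ - G y θ) ^ 2)) ∂Q ≤
    ENNReal.ofReal (Real.exp (L₀ ^ 2 * ‖x - y‖ ^ 2))

/-! ### The exponentially-shifted Gaussian smoothing (esGs) scheme -/

/-- The point `(xᵢ + a, x⁻ⁱ - z⁻ⁱ)`. -/
def shift {n : ℕ} (x : E n) (i : Fin n) (a : ℝ) (z : E n) : E n :=
  WithLp.toLp 2 fun j => if j = i then x j + a else x j - z j

/-- The esGs gradient estimator, with `i`-th component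
`(G (xᵢ + η√(2v), x⁻ⁱ - z⁻ⁱ) θ - G (xᵢ - η√(2v), x⁻ⁱ - z⁻ⁱ) θ) / (η √(2π))`. -/
def gradEst {n : ℕ} {Θ : Type u} (G : E n → Θ → ℝ) (η : ℝ) (x : E n) (v : ℝ) (z : E n) (θ : Θ) :
    E n :=
  WithLp.toLp 2 fun i =>
    (G (shift x i (η * √(2 * v)) z) θ - G (shift x i (-(η * √(2 * v))) z) θ) /
      (η * √(2 * Real.pi))

/-- `p` is a Euclidean projection of `y` onto `X`. -/
def IsProj {n : ℕ} (X : Set (E n)) (y p : E n) : Prop :=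
  p ∈ X ∧ ∀ q ∈ X, ‖y - p‖ ≤ ‖y - q‖

/-- The law `Exp(1) ⊗ N(0, η² I) ⊗ Q` of the variates used in one iteration. -/
def sampleLaw (n : ℕ) {Θ : Type u} [MeasurableSpace Θ] (η : ℝ) (Q : Measure Θ) :
    Measure (ℝ × E n × Θ) :=
  (expMeasure 1).prod
    ((multivariateGaussian (0 : E n) ((η ^ 2) • (1 : Matrix (Fin n) (Fin n) ℝ))).prod Q)

/-- A run of the scheme `x_{k+1} = Π_X [x_k - γ_k g̃_{η_k}(x_k, V_k, Z_k, ξ_k)]` for the problem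
`min_{x ∈ X} f x`, where the triples `(V_k, Z_k, ξ_k)` are independent of one another and of the
initial point, `V_k ∼ Exp(1)`, `Z_k ∼ N(0, η_k² I)` and `ξ_k ∼ Q` being independent. -/
structure Run (n : ℕ) : Type (max (u + 1) (w + 1)) where
  /-- Sample space of the stochastic oracle. -/
  Θ : Type u
  [mΘ : MeasurableSpace Θ]
  Q : Measure Θ
  [probQ : IsProbabilityMeasure Q]
  /-- The random integrand. -/
  G : E n → Θ → ℝ
  /-- The objective. -/
  f : E n → ℝ
  /-- The feasible set. -/
  X : Set (E n)
  convex_X : Convex ℝ X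
  bounded_X : Bornology.IsBounded X
  /-- An optimal solution. -/
  xstar : E n
  xstar_mem : xstar ∈ X
  xstar_min : ∀ y ∈ X, f xstar ≤ f y
  /-- Step lengths. -/
  γ : ℕ → ℝ
  γ_pos : ∀ k, 0 < γ k
  /-- Smoothing parameters. -/
  η : ℕ → ℝ
  η_pos : ∀ k, 0 < η k
  /-- The underlying probability space. -/
  Ω : Type w
  [mΩ : MeasurableSpace Ω]
  P : Measure Ω
  [probΩ : IsProbabilityMeasure P]
  V : ℕ → Ω → ℝ
  Z : ℕ → Ω → E n
  ξ : ℕ → Ω → Θ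
  /-- The iterates. -/
  x : ℕ → Ω → E n
  measurable_V : ∀ k, Measurable (V k)
  measurable_Z : ∀ k, Measurable (Z k)
  measurable_ξ : ∀ k, Measurable (ξ k)
  law : ∀ k, P.map (fun ω => (V k ω, Z k ω, ξ k ω)) = sampleLaw n (η k) Q
  indep : iIndepFun (fun k ω => (V k ω, Z k ω, ξ k ω)) P
  measurable_x0 : Measurable (x 0)
  x0_mem : ∀ ω, x 0 ω ∈ X
  indep_x0 : IndepFun (x 0) (fun ω k => (V k ω, Z k ω, ξ k ω)) P
  step : ∀ k ω, IsProj X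
    (x k ω - γ k • gradEst G (η k) (x k ω) (V k ω) (Z k ω) (ξ k ω)) (x (k + 1) ω)

attribute [instance] Run.mΘ Run.probQ Run.mΩ Run.probΩ

namespace Run

variable {n : ℕ} (R : Run.{u, w} n)

/-- The problem belongs to the standard convex setting. -/
def Standard (L₀ : ℝ) : Prop := StandardSetting L₀ R.Q R.G R.f

/-- The problem belongs to the decision-dependent convex setting with known densities. -/
def KnownDensity (L₀ : ℝ) : Prop := KnownDensitySetting L₀ R.Q R.G R.f

/-- The problem belongs to the decision-dependent convex setting with unknown distributions. -/
def RandomField (L₀ : ℝ) : Prop := RandomFieldSetting.{u, v} L₀ R.Q R.G R.f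

/-- The problem belongs to one of the three settings. -/
def Admissible (L₀ : ℝ) : Prop :=
  R.Standard L₀ ∨ R.KnownDensity L₀ ∨ RandomField.{u, v, w} R L₀

/-- The random integrand has the sub-Gaussian property. -/
def SubGaussian (L₀ : ℝ) : Prop := SubGaussianIncrements L₀ R.Q R.G

/-- The averaged iterate `(∑_{k<K} γ_k x_k) / ∑_{k<K} γ_k`. -/
def avg (K : ℕ) (ω : R.Ω) : E n :=
  (∑ k ∈ Finset.range K, R.γ k)⁻¹ • ∑ k ∈ Finset.range K, R.γ k • R.x k ω

/-- The probability that `f (x̄_K) - f (x*) ≥ t`. -/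
def tail (K : ℕ) (t : ℝ) : ℝ := R.P.real {ω | t ≤ R.f (R.avg K ω) - R.f R.xstar}

/-- The diameter `D_X` of the feasible set. -/
def DX : ℝ := Metric.diam R.X

/-- `∑_{k<K} γ_k`. -/
def sumγ (K : ℕ) : ℝ := ∑ k ∈ Finset.range K, R.γ k

/-- `c_K = ∑_{k<K} γ_k²`. -/
def cK (K : ℕ) : ℝ := ∑ k ∈ Finset.range K, R.γ k ^ 2

/-- `∑_{k<K} 2 L₀ √(n+1) γ_k η_k`. -/
def bias (L₀ : ℝ) (K : ℕ) : ℝ :=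
  ∑ k ∈ Finset.range K, 2 * L₀ * √((n : ℝ) + 1) * R.γ k * R.η k

/-- `I_{A_K} = √(8 (1 + 4n/π) D_X² L₀² ∑_{k<K} γ_k²)`. -/
def IA (L₀ : ℝ) (K : ℕ) : ℝ :=
  √(8 * (1 + 4 * (n : ℝ) / Real.pi) * R.DX ^ 2 * L₀ ^ 2 * ∑ k ∈ Finset.range K, R.γ k ^ 2)

/-- `I_{B_K} = (4 n L₀² / π) ∑_{k<K} γ_k²`. -/
def IB (L₀ : ℝ) (K : ℕ) : ℝ :=
  4 * (n : ℝ) * L₀ ^ 2 / Real.pi * ∑ k ∈ Finset.range K, R.γ k ^ 2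

/-- `c_L = 8 D_X² L₀²`. -/
def cL (L₀ : ℝ) : ℝ := 8 * R.DX ^ 2 * L₀ ^ 2

/-- `c_{D,K,n} = D_X² + ∑_{k<K} 2 L₀ √(n+1) γ_k η_k + √(2 n c_L c_K / α)`. -/
def cD (L₀ α : ℝ) (K : ℕ) : ℝ :=
  R.DX ^ 2 + R.bias L₀ K + √(2 * (n : ℝ) * R.cL L₀ * R.cK K / α)

end Run

/-- `c_n = 4 n L₀² / π`. -/
def cn (n : ℕ) (L₀ : ℝ) : ℝ := 4 * (n : ℝ) * L₀ ^ 2 / Real.pi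

end EsGs

end

noncomputable section

namespace EsGs

/-! ### One-dimensional Gaussian and exponential integrals -/

section OneDim

/-! The estimator is unbiased for a subgradient of the Gaussian smoothing `f_η(x) = 𝔼 f(x + Z)`, `Z
∼ N(0, η² I)`. For `V ∼ Exp(1)`, the variable `√(2V)` with a random sign is standard normal, and in
the substitution `w = ±√(2v)` the Gaussian weight `w` becomes exactly the two-point difference.
Averaging over the sample, `V` and `Z` therefore gives Stein's vector `η⁻² 𝔼[f(x + Z) Z]`
(`ConvexOracle.meanGrad_apply`). For convex `f` it is a subgradient of `f_η`
(`smoothing_subgradient`), and since `f ≤ f_η ≤ f + L₀ η √n` it is an approximate subgradient of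
`f`.

The projection inequality, telescoping and convexity of `f` then give `2 ∑ γ_k (f(x̄_K) - f(x*)) ≤
D_X² + bias + A + C` (`Run.two_sumγ_mul_gap_le`), with `A` a sum of martingale differences and `C` a
sum of squared steps, truncated because `X` is bounded. What remains is to bound `A + C`, by
induction on `K`, using that the current state is independent of the future noise.

(i) is Chebyshev for `A` and Markov for the squared steps. (iii) is Chernoff for both, via
exponential moments of the squared estimator. In (ii), in the standard setting, the sub-Gaussian
bound holds for all pairs of points; combined with convexity along rays it forces the integrand to
be almost surely `L₀`-Lipschitz. Hence the squared norm of the estimator is at most `c_n V`, the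
centered part of `A + C` is sub-Gaussian, and `exp(-ε/3)` alone bounds the tail. In (iv), apart from
the known-density case, the threshold exceeds `L₀ D_X`, which bounds the gap, so the tail vanishes.

With known densities, `f` is convex on `ℝⁿ` and bounded, hence constant, and every positive
threshold has tail zero (`KnownDensitySetting.objective_eq`). -/

lemma integrable_id_gaussian : Integrable (fun w : ℝ => w) (gaussianReal 0 1) :=
  (memLp_id_gaussianReal (μ := 0) (v := 1) 1).integrable (by norm_num)

lemma integrable_sq_gaussian : Integrable (fun w : ℝ => w ^ 2) (gaussianReal 0 1) :=
  (memLp_id_gaussianReal (μ := 0) (v := 1) 2).integrable_sq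

lemma integral_sq_gaussian : ∫ w, w ^ 2 ∂(gaussianReal 0 1) = 1 := by
  have h := variance_fun_id_gaussianReal (μ := 0) (v := 1)
  rw [variance_eq_integral (by fun_prop)] at h
  simpa using h

lemma integral_gaussian_id : ∫ w, w ∂(gaussianReal 0 1) = 0 := integral_id_gaussianReal

variable {φ : ℝ → ℝ} {K : ℝ}

lemma continuous_of_abs_sub_le (hL : ∀ x y, |φ x - φ y| ≤ K * |x - y|) : Continuous φ := by
  have : LipschitzWith K.toNNReal φ := by
    refine LipschitzWith.of_dist_le_mul fun x y => ?_
    rw [Real.dist_eq, Real.dist_eq]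
    refine (hL x y).trans ?_
    gcongr
    exact Real.le_coe_toNNReal K
  exact this.continuous

lemma abs_le_of_abs_sub_le (hL : ∀ x y, |φ x - φ y| ≤ K * |x - y|) (w : ℝ) :
    |φ w| ≤ |φ 0| + K * |w| := by
  have := hL w 0
  have h2 := abs_add_le (φ w - φ 0) (φ 0)
  simp at this h2
  linarith

lemma integrable_gaussian_of_lipschitz (hL : ∀ x y, |φ x - φ y| ≤ K * |x - y|) :
    Integrable φ (gaussianReal 0 1) := by
  refine Integrable.mono' (g := fun w => |φ 0| + K * |w|) ?_
    (continuous_of_abs_sub_le hL).aestronglyMeasurable (ae_of_all _ (abs_le_of_abs_sub_le hL))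
  exact (integrable_const _).add (integrable_id_gaussian.abs.const_mul K)

lemma integrable_mul_gaussian_of_lipschitz (hL : ∀ x y, |φ x - φ y| ≤ K * |x - y|) :
    Integrable (fun w => φ w * w) (gaussianReal 0 1) := by
  refine Integrable.mono' (g := fun w => |φ 0| * |w| + K * w ^ 2) ?_
    ((continuous_of_abs_sub_le hL).mul continuous_id).aestronglyMeasurable
    (ae_of_all _ fun w => ?_)
  · exact (integrable_id_gaussian.abs.const_mul _).add (integrable_sq_gaussian.const_mul K)
  · rw [Real.norm_eq_abs, abs_mul, ← sq_abs w]
    nlinarith [abs_le_of_abs_sub_le hL w, abs_nonneg w]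

lemma lipschitz_shift (hL : ∀ x y, |φ x - φ y| ≤ K * |x - y|) (a : ℝ) :
    ∀ x y, |φ (x + a) - φ (y + a)| ≤ K * |x - y| := fun x y => by
  simpa using hL (x + a) (y + a)

lemma gaussianPDFReal_eq_tilt (a x : ℝ) :
    gaussianPDFReal a 1 x = gaussianPDFReal 0 1 x * Real.exp (a * x - a ^ 2 / 2) := by
  simp only [gaussianPDFReal, NNReal.coe_one, mul_one, mul_assoc, ← Real.exp_add]
  congr 3
  ring

lemma integral_gaussian_shift (a : ℝ) (ψ : ℝ → ℝ) (hψ : Measurable ψ) :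
    ∫ w, ψ (w + a) ∂(gaussianReal 0 1) = ∫ w, ψ w ∂(gaussianReal a 1) := by
  have := gaussianReal_map_add_const (μ := 0) (v := 1) a
  rw [zero_add] at this
  rw [← this, integral_map (by fun_prop) hψ.aestronglyMeasurable]

lemma integrable_gaussian_iff (a : ℝ) (ψ : ℝ → ℝ) :
    Integrable ψ (gaussianReal a 1) ↔ Integrable (fun x => gaussianPDFReal a 1 x * ψ x) := by
  rw [gaussianReal_of_var_ne_zero a one_ne_zero,
    integrable_withDensity_iff_integrable_smul' (measurable_gaussianPDF a 1)
      (ae_of_all _ fun _ => gaussianPDF_lt_top)]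
  simp [toReal_gaussianPDF]

/-- A lower bound for the Gaussian mean of a shifted nonnegative function. -/
lemma gaussian_shift_lower (hL : ∀ x y, |φ x - φ y| ≤ K * |x - y|) (h0 : ∀ x, 0 ≤ φ x) (a : ℝ) :
    ∫ w, φ w ∂(gaussianReal 0 1) + a * ∫ w, φ w * w ∂(gaussianReal 0 1) -
      a ^ 2 / 2 * ∫ w, φ w ∂(gaussianReal 0 1) ≤ ∫ w, φ (w + a) ∂(gaussianReal 0 1) := by
  have hc := continuous_of_abs_sub_le hL
  have i1 := integrable_gaussian_of_lipschitz hL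
  have i2 := integrable_mul_gaussian_of_lipschitz hL
  have i3 : Integrable φ (gaussianReal a 1) := by
    have := gaussianReal_map_add_const (μ := 0) (v := 1) a
    rw [zero_add] at this
    rw [← this, integrable_map_measure hc.aestronglyMeasurable (by fun_prop)]
    exact integrable_gaussian_of_lipschitz (lipschitz_shift hL a)
  have i12 : Integrable (fun w => φ w + a * (φ w * w)) (gaussianReal 0 1) :=
    i1.add (i2.const_mul a)
  rw [integral_gaussian_shift a φ hc.measurable,
    integral_gaussianReal_eq_integral_smul (μ := a) one_ne_zero, ← integral_const_mul,
    ← integral_const_mul, ← integral_add i1 (i2.const_mul a),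
    ← integral_sub i12 (i1.const_mul _),
    integral_gaussianReal_eq_integral_smul (μ := 0) one_ne_zero]
  have j0 : Integrable (fun w => φ w + a * (φ w * w) - a ^ 2 / 2 * φ w) (gaussianReal 0 1) :=
    (i1.add (i2.const_mul a)).sub (i1.const_mul _)
  refine integral_mono ((integrable_gaussian_iff 0 _).1 j0)
    ((integrable_gaussian_iff a _).1 i3) fun x => ?_
  simp only [smul_eq_mul]
  rw [gaussianPDFReal_eq_tilt a x, mul_assoc]
  refine mul_le_mul_of_nonneg_left ?_ (gaussianPDFReal_nonneg _ _ _)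
  -- The density ratio of `N(a, 1)` to `N(0, 1)` is at least `1 + a x - a² / 2`; nonnegativity of
  -- `φ` allows multiplying by it.
  have := Real.add_one_le_exp (a * x - a ^ 2 / 2)
  nlinarith [h0 x]

/-- A derivative at zero taken without differentiating under the integral: shift by `s t`, bound the
mean below by the tilt inequality and above by convexity, divide by `s` and let `s → 0`. The error
is of order `s`. -/
lemma gaussian_convex_shift_of_nonneg (hL : ∀ x y, |φ x - φ y| ≤ K * |x - y|)
    (h0 : ∀ x, 0 ≤ φ x) (hφ : ConvexOn ℝ univ φ) (t : ℝ) :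
    t * ∫ w, φ w * w ∂(gaussianReal 0 1) ≤
      ∫ w, φ (w + t) ∂(gaussianReal 0 1) - ∫ w, φ w ∂(gaussianReal 0 1) := by
  have i1 := integrable_gaussian_of_lipschitz hL
  have it := integrable_gaussian_of_lipschitz (lipschitz_shift hL t)
  set I := ∫ w, φ w ∂(gaussianReal 0 1)
  set J := ∫ w, φ w * w ∂(gaussianReal 0 1)
  have key : ∀ s : ℝ, 0 < s → s ≤ 1 →
      t * J ≤ (∫ w, φ (w + t) ∂(gaussianReal 0 1) - I) + s * (t ^ 2 / 2 * I) := by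
    intro s hs hs1
    have h1 := gaussian_shift_lower hL h0 (s * t)
    have h2 : ∫ w, φ (w + s * t) ∂(gaussianReal 0 1) ≤
        (1 - s) * I + s * ∫ w, φ (w + t) ∂(gaussianReal 0 1) := by
      rw [← integral_const_mul, ← integral_const_mul,
        ← integral_add (i1.const_mul _) (it.const_mul _)]
      refine integral_mono (integrable_gaussian_of_lipschitz (lipschitz_shift hL (s * t)))
        ((i1.const_mul _).add (it.const_mul _)) fun w => ?_
      have := hφ.2 (mem_univ w) (mem_univ (w + t)) (by linarith : 0 ≤ 1 - s) hs.le (by ring)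
      simp only [smul_eq_mul] at this
      have e : (1 - s) * w + s * (w + t) = w + s * t := by ring
      rwa [e] at this
    have h3 : s * (t * J) ≤ s * ((∫ w, φ (w + t) ∂(gaussianReal 0 1) - I) +
        s * (t ^ 2 / 2 * I)) := by
      nlinarith
    exact le_of_mul_le_mul_left h3 hs
  refine le_of_forall_pos_le_add fun ε hε => ?_
  have hI : 0 ≤ t ^ 2 / 2 * I := mul_nonneg (by positivity) (integral_nonneg h0)
  have hpos : 0 < t ^ 2 / 2 * I + 1 := by linarith
  refine (key (min 1 (ε / (t ^ 2 / 2 * I + 1))) (by positivity) (min_le_left _ _)).trans ?_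
  gcongr
  calc min 1 (ε / (t ^ 2 / 2 * I + 1)) * (t ^ 2 / 2 * I)
      ≤ ε / (t ^ 2 / 2 * I + 1) * (t ^ 2 / 2 * I + 1) := by
        gcongr
        · exact min_le_right _ _
        · linarith
    _ = ε := div_mul_cancel₀ _ hpos.ne'

lemma exists_affine_minorant (hφ : ConvexOn ℝ univ φ) : ∃ p : ℝ, ∀ x, φ 0 + p * x ≤ φ x := by
  have h0 : (0 : ℝ) ∈ interior (univ : Set ℝ) := by simp
  refine ⟨derivWithin φ (Ioi 0) 0, fun x => ?_⟩
  rcases lt_trichotomy x 0 with hx | rfl | hx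
  · have h1 := hφ.slope_le_leftDeriv_of_mem_interior (mem_univ x) h0 hx
    have h2 := hφ.leftDeriv_le_rightDeriv_of_mem_interior h0
    have h3 := h1.trans h2
    rw [slope_def_field, div_le_iff₀ (by linarith)] at h3
    linarith
  · simp
  · have h1 := hφ.rightDeriv_le_slope_of_mem_interior h0 (mem_univ x) hx
    rw [slope_def_field, le_div_iff₀ (by linarith)] at h1
    linarith

/-- The Gaussian smoothing of a convex function lies above its tangents, whose slope is given by
Stein's identity. -/
lemma gaussian_convex_shift (hL : ∀ x y, |φ x - φ y| ≤ K * |x - y|)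
    (hφ : ConvexOn ℝ univ φ) (t : ℝ) :
    t * ∫ w, φ w * w ∂(gaussianReal 0 1) ≤
      ∫ w, φ (w + t) ∂(gaussianReal 0 1) - ∫ w, φ w ∂(gaussianReal 0 1) := by
  -- For affine functions both sides equal `p * t`, so an affine minorant can be subtracted to reach
  -- the nonnegative case.
  obtain ⟨p, hp⟩ := exists_affine_minorant hφ
  set g : ℝ → ℝ := fun x => φ x - (φ 0 + p * x) with hg
  have hgL : ∀ x y, |g x - g y| ≤ (K + |p|) * |x - y| := by
    intro x y
    have : g x - g y = (φ x - φ y) - p * (x - y) := by simp only [hg]; ring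
    rw [this, add_mul, ← abs_mul]
    exact (abs_sub _ _).trans (add_le_add (hL x y) le_rfl)
  have hgc : ConvexOn ℝ univ g := by
    refine ⟨convex_univ, fun x _ y _ a b ha hb hab => ?_⟩
    have := hφ.2 (mem_univ x) (mem_univ y) ha hb hab
    simp only [smul_eq_mul, hg] at this ⊢
    obtain rfl : a = 1 - b := by linarith
    linarith
  have h := gaussian_convex_shift_of_nonneg hgL (fun x => by simp only [hg]; linarith [hp x]) hgc t
  have i1 := integrable_gaussian_of_lipschitz hgL
  have it := integrable_gaussian_of_lipschitz (lipschitz_shift hgL t)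
  have i2 := integrable_mul_gaussian_of_lipschitz hgL
  have iw := integrable_id_gaussian
  have ia : ∀ c : ℝ, Integrable (fun w => c + p * w) (gaussianReal 0 1) := fun c =>
    (integrable_const _).add (iw.const_mul p)
  have e1 : ∫ w, φ w ∂(gaussianReal 0 1) = ∫ w, g w ∂(gaussianReal 0 1) + φ 0 := by
    have : φ = fun w => g w + (φ 0 + p * w) := by ext; simp [hg]
    rw [this, integral_add i1 (ia _), integral_add (integrable_const _) (iw.const_mul p),
      integral_const_mul, integral_gaussian_id]
    simp [hg]
  have e2 : ∫ w, φ (w + t) ∂(gaussianReal 0 1) =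
      ∫ w, g (w + t) ∂(gaussianReal 0 1) + (φ 0 + p * t) := by
    have : (fun w => φ (w + t)) = fun w => g (w + t) + ((φ 0 + p * t) + p * w) := by
      ext; simp only [hg]; ring
    rw [this, integral_add it (ia _), integral_add (integrable_const _) (iw.const_mul p),
      integral_const_mul, integral_gaussian_id]
    simp
  have e3 : ∫ w, φ w * w ∂(gaussianReal 0 1) = ∫ w, g w * w ∂(gaussianReal 0 1) + p := by
    have : (fun w => φ w * w) = fun w => g w * w + (φ 0 * w + p * w ^ 2) := by
      ext; simp only [hg]; ring
    have i3 : Integrable (fun w => φ 0 * w + p * w ^ 2) (gaussianReal 0 1) :=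
      (iw.const_mul _).add (integrable_sq_gaussian.const_mul p)
    rw [this, integral_add i2 i3,
      integral_add (iw.const_mul _) (integrable_sq_gaussian.const_mul p),
      integral_const_mul, integral_const_mul, integral_gaussian_id, integral_sq_gaussian]
    simp
  rw [e1, e2, e3]
  linarith

/-! The exponential law. -/

instance isProbabilityMeasure_exp_one : IsProbabilityMeasure (expMeasure 1) :=
  isProbabilityMeasure_expMeasure one_pos

lemma lintegral_exp_one {ψ : ℝ → ℝ≥0∞} :
    ∫⁻ v, ψ v ∂(expMeasure 1) = ∫⁻ v in Ioi 0, ENNReal.ofReal (Real.exp (-v)) * ψ v := by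
  have hm : Measurable (gammaPDF 1 1) := (measurable_gammaPDFReal 1 1).ennreal_ofReal
  rw [expMeasure, gammaMeasure, lintegral_withDensity_eq_lintegral_mul_non_measurable _ hm
    (ae_of_all _ fun _ => ENNReal.ofReal_lt_top), ← setLIntegral_univ,
    ← lintegral_indicator MeasurableSet.univ, ← lintegral_indicator measurableSet_Ioi]
  refine lintegral_congr_ae ?_
  filter_upwards [Measure.ae_ne volume 0] with x hx
  rcases lt_or_gt_of_ne hx with h | h
  · simp [gammaPDF_of_neg h, h.le]
  · simp [gammaPDF_of_nonneg h.le, h]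

lemma ae_exp_one_pos : ∀ᵐ v ∂(expMeasure 1), 0 < v := by
  rw [ae_iff, ← lintegral_indicator_one (by simp only [not_lt]; exact measurableSet_Iic),
    lintegral_exp_one]
  rw [setLIntegral_congr_fun (g := fun _ => 0) measurableSet_Ioi]
  · simp
  · intro x hx
    have : 0 < x := hx
    simp [this]

lemma integral_exp_one (ψ : ℝ → ℝ) :
    ∫ v, ψ v ∂(expMeasure 1) = ∫ v in Ioi 0, Real.exp (-v) * ψ v := by
  have hm : Measurable (gammaPDF 1 1) := (measurable_gammaPDFReal 1 1).ennreal_ofReal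
  rw [expMeasure, gammaMeasure, integral_withDensity_eq_integral_toReal_smul hm
    (ae_of_all _ fun _ => ENNReal.ofReal_lt_top), ← integral_indicator measurableSet_Ioi]
  refine integral_congr_ae ?_
  filter_upwards [Measure.ae_ne volume 0] with x hx
  rcases lt_or_gt_of_ne hx with h | h
  · simp [gammaPDF_of_neg h, h.le]
  · simp [gammaPDF_of_nonneg h.le, h, (Real.exp_pos _).le]

/-- The moment generating function of `Exp(1)`. -/
lemma lintegral_exp_mul_exp_one {c : ℝ} (hc : c < 1) :
    ∫⁻ v, ENNReal.ofReal (Real.exp (c * v)) ∂(expMeasure 1) = ENNReal.ofReal (1 / (1 - c)) := by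
  rw [lintegral_exp_one]
  have h1 : ∀ v : ℝ, ENNReal.ofReal (Real.exp (-v)) * ENNReal.ofReal (Real.exp (c * v)) =
      ENNReal.ofReal (Real.exp ((c - 1) * v)) := fun v => by
    rw [← ENNReal.ofReal_mul (Real.exp_pos _).le, ← Real.exp_add]
    congr 2
    ring
  simp_rw [h1]
  have hi : IntegrableOn (fun v : ℝ => Real.exp ((c - 1) * v)) (Ioi 0) :=
    integrableOn_exp_mul_Ioi (by linarith) 0
  rw [← ofReal_integral_eq_lintegral_ofReal hi (ae_of_all _ fun _ => (Real.exp_pos _).le),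
    integral_exp_mul_Ioi (by linarith)]
  congr 1
  have : c - 1 ≠ 0 := by linarith
  have : 1 - c ≠ 0 := by linarith
  simp only [mul_zero, Real.exp_zero]
  grind

lemma lintegral_id_exp_one :
    ∫⁻ v, ENNReal.ofReal v ∂(expMeasure 1) = 1 := by
  rw [lintegral_exp_one]
  have h2 : ∫ v in Ioi (0 : ℝ), Real.exp (-v) * v = 1 := by
    have := Real.Gamma_eq_integral (s := 2) (by norm_num)
    have g2 : Real.Gamma 2 = 1 := Real.Gamma_two
    rw [g2] at this
    rw [this]
    norm_num
  -- A non-integrable function would have integral `0`, whereas the Gamma value is `1`.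
  have hi : IntegrableOn (fun v : ℝ => Real.exp (-v) * v) (Ioi 0) := by
    by_contra h
    rw [integral_undef h] at h2
    norm_num at h2
  have h1 : ∀ v : ℝ, ENNReal.ofReal (Real.exp (-v)) * ENNReal.ofReal v =
      ENNReal.ofReal (Real.exp (-v) * v) := fun v => by
    rw [← ENNReal.ofReal_mul (Real.exp_pos _).le]
  simp_rw [h1]
  rw [← ofReal_integral_eq_lintegral_ofReal hi, h2, ENNReal.ofReal_one]
  filter_upwards [ae_restrict_mem measurableSet_Ioi] with v hv
  exact mul_nonneg (Real.exp_pos _).le (le_of_lt hv)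

/-- A standard normal variable is a signed Rayleigh variable `±√(2V)` with `V ∼ Exp(1)`. -/
lemma integral_mul_gaussian_eq_exp (hi : Integrable (fun w => φ w * w) (gaussianReal 0 1)) :
    ∫ w, φ w * w ∂(gaussianReal 0 1) =
      (√(2 * Real.pi))⁻¹ * ∫ v, (φ (√(2 * v)) - φ (-√(2 * v))) ∂(expMeasure 1) := by
  have hI := (integrable_gaussian_iff 0 _).1 hi
  rw [integral_gaussianReal_eq_integral_smul one_ne_zero, integral_exp_one, ← integral_const_mul]
  simp only [smul_eq_mul]
  rw [← intervalIntegral.integral_Iic_add_Ioi (b := 0) hI.integrableOn hI.integrableOn]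
  have hneg : ∫ x in Iic (0 : ℝ), gaussianPDFReal 0 1 x * (φ x * x) =
      ∫ x in Ioi (0 : ℝ), gaussianPDFReal 0 1 (-x) * (φ (-x) * (-x)) := by
    rw [integral_comp_neg_Ioi (f := fun x => gaussianPDFReal 0 1 x * (φ x * x)), neg_zero]
  have hIneg : Integrable (fun x => gaussianPDFReal 0 1 (-x) * (φ (-x) * (-x))) := hI.comp_neg
  rw [hneg, ← integral_add hIneg.integrableOn hI.integrableOn]
  -- After folding the negative half-line onto the positive one, substitute `r = √(2v)`: `r
  -- exp(-r²/2) dr = exp(-v) dv`.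
  have himg : (fun v : ℝ => √(2 * v)) '' Ioi 0 = Ioi 0 := by
    ext r
    constructor
    · rintro ⟨v, hv, rfl⟩
      have : 0 < v := hv
      exact Real.sqrt_pos.2 (by linarith)
    · intro hr
      have hr : 0 < r := hr
      refine ⟨r ^ 2 / 2, by simp only [mem_Ioi]; positivity, ?_⟩
      simp only
      rw [mul_div_cancel₀ _ two_ne_zero, Real.sqrt_sq hr.le]
  have hder : ∀ v ∈ Ioi (0 : ℝ), HasDerivWithinAt (fun v : ℝ => √(2 * v)) (1 / √(2 * v))
      (Ioi 0) v := by
    intro v hv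
    have hv : 0 < v := hv
    have h := ((hasDerivAt_id v).const_mul 2).sqrt (by simp; exact hv.ne')
    simp only [id, mul_one] at h
    have e : 2 / (2 * √(2 * v)) = 1 / √(2 * v) := by
      rw [← mul_div_mul_left 1 (√(2 * v)) two_ne_zero, mul_one]
    rw [e] at h
    exact h.hasDerivWithinAt
  have hinj : InjOn (fun v : ℝ => √(2 * v)) (Ioi 0) := by
    intro a ha b hb hab
    have ha : 0 < a := ha
    have hb : 0 < b := hb
    have := (Real.sqrt_inj (by linarith) (by linarith)).1 hab
    linarith
  rw [← himg, integral_image_eq_integral_abs_deriv_smul measurableSet_Ioi hder hinj, himg]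
  refine setIntegral_congr_fun measurableSet_Ioi fun v hv => ?_
  have hv : 0 < v := hv
  have hs : 0 < √(2 * v) := Real.sqrt_pos.2 (by linarith)
  simp only [smul_eq_mul, gaussianPDFReal, NNReal.coe_one, mul_one, sub_zero, neg_sq]
  rw [Real.sq_sqrt (by linarith), abs_of_pos (by positivity)]
  have : -(2 * v) / 2 = -v := by ring
  rw [this]
  field_simp
  ring

end OneDim

/-! ### Gaussian smoothing of a convex function on `ℝⁿ` -/

section Smoothing

variable {n : ℕ}

/-- The law `N(0, η² I)`. -/
abbrev gaussianLaw (n : ℕ) (η : ℝ) : Measure (E n) :=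
  multivariateGaussian (0 : E n) ((η ^ 2) • (1 : Matrix (Fin n) (Fin n) ℝ))

lemma posSemidef_smul_one (n : ℕ) (η : ℝ) :
    ((η ^ 2) • (1 : Matrix (Fin n) (Fin n) ℝ)).PosSemidef :=
  Matrix.PosSemidef.one.smul (sq_nonneg η)

lemma charFun_gaussianLaw (η : ℝ) (t : E n) :
    charFun (gaussianLaw n η) t = Complex.exp (-(η ^ 2 * ‖t‖ ^ 2 / 2 : ℝ)) := by
  rw [charFun_multivariateGaussian (posSemidef_smul_one n η)]
  congr 1
  have : t.ofLp ⬝ᵥ ((η ^ 2) • (1 : Matrix (Fin n) (Fin n) ℝ)).mulVec t.ofLp = η ^ 2 * ‖t‖ ^ 2 := by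
    rw [Matrix.smul_mulVec, Matrix.one_mulVec, dotProduct_smul, smul_eq_mul,
      EuclideanSpace.real_norm_sq_eq]
    simp [dotProduct, sq]
  rw [this]
  simp

/-- The Gaussian vector `z`, reflected and with its component along `e` replaced by `η w`. -/
def resample (η : ℝ) (e : E n) (q : E n × ℝ) : E n := -q.1 + (inner ℝ q.1 e + η * q.2) • e

lemma measurable_resample (η : ℝ) (e : E n) : Measurable (resample η e) := by
  unfold resample; fun_prop

/-- Compare characteristic functions: pairing with `t` splits into `⟨z, s⟩` with `s = -t + ⟨e, t⟩
e`, plus `η w ⟨e, t⟩`, and Pythagoras gives `‖s‖² + ⟨e, t⟩² = ‖t‖²`. This identifies the query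
points of the estimator with samples of the smoothing distribution once `√(2V)` is replaced by a
normal `w`. -/
lemma map_resample (η : ℝ) {e : E n} (he : ‖e‖ = 1) :
    ((gaussianLaw n η).prod (gaussianReal 0 1)).map (resample η e) = gaussianLaw n η := by
  have : IsProbabilityMeasure (((gaussianLaw n η).prod (gaussianReal 0 1)).map (resample η e)) :=
    Measure.isProbabilityMeasure_map (measurable_resample η e).aemeasurable
  refine Measure.ext_of_charFun (funext fun t => ?_)
  set s : E n := -t + (inner ℝ e t : ℝ) • e with hs
  have hc := charFun_gaussianLaw η s
  have hg := charFun_gaussianReal (μ := 0) (v := 1) (η * inner ℝ e t)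
  rw [charFun_apply] at hc hg
  rw [charFun_gaussianLaw, charFun_apply,
    integral_map (measurable_resample η e).aemeasurable (by fun_prop)]
  have h1 : ∀ q : E n × ℝ, Complex.exp ((inner ℝ (resample η e q) t : ℝ) * Complex.I) =
      Complex.exp ((inner ℝ q.1 s : ℝ) * Complex.I) *
        Complex.exp ((inner ℝ q.2 (η * inner ℝ e t) : ℝ) * Complex.I) := by
    intro q
    rw [← Complex.exp_add, ← add_mul, ← Complex.ofReal_add]
    congr 3
    simp only [resample, hs, inner_add_left, inner_neg_left, inner_smul_left, inner_add_right,
      inner_neg_right, inner_smul_right, RCLike.inner_apply, conj_trivial]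
    ring
  simp_rw [h1]
  rw [integral_prod_mul (f := fun z : E n => Complex.exp ((inner ℝ z s : ℝ) * Complex.I))
    (g := fun w : ℝ => Complex.exp ((inner ℝ w (η * inner ℝ e t) : ℝ) * Complex.I)), hc, hg,
    ← Complex.exp_add]
  have hn : ‖s‖ ^ 2 = ‖t‖ ^ 2 - (inner ℝ e t : ℝ) ^ 2 := by
    rw [hs, ← real_inner_self_eq_norm_sq, inner_add_left, inner_add_right, inner_add_right,
      inner_neg_neg, inner_smul_left, inner_smul_right, inner_neg_left, inner_neg_right,
      inner_smul_left, inner_smul_right, real_inner_self_eq_norm_sq, real_inner_self_eq_norm_sq,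
      he, real_inner_comm e t]
    simp
    ring
  rw [hn]
  congr 1
  push_cast
  ring

variable {f : E n → ℝ} {K : ℝ}

lemma continuous_of_lipschitz (hL : ∀ x y, |f x - f y| ≤ K * ‖x - y‖) : Continuous f := by
  have : LipschitzWith K.toNNReal f := by
    refine LipschitzWith.of_dist_le_mul fun x y => ?_
    rw [Real.dist_eq, dist_eq_norm]
    refine (hL x y).trans ?_
    gcongr
    exact Real.le_coe_toNNReal K
  exact this.continuous

lemma integrable_norm_gaussianLaw (η : ℝ) : Integrable (fun z : E n => ‖z‖) (gaussianLaw n η) :=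
  (IsGaussian.integrable_id (μ := gaussianLaw n η)).norm

lemma integrable_normSq_gaussianLaw (η : ℝ) :
    Integrable (fun z : E n => ‖z‖ ^ 2) (gaussianLaw n η) :=
  (IsGaussian.memLp_two_id (μ := gaussianLaw n η)).norm.integrable_sq

lemma integral_normSq_gaussianLaw (η : ℝ) :
    ∫ z, ‖z‖ ^ 2 ∂(gaussianLaw n η) = n * η ^ 2 := by
  have hm := fun i : Fin n => measurePreserving_eval_multivariateGaussian
    (μ := (0 : E n)) (posSemidef_smul_one n η) (i := i)
  have hi : ∀ i : Fin n, ∫ z, (z i) ^ 2 ∂(gaussianLaw n η) = η ^ 2 := by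
    intro i
    have h2 := (hm i).map_eq
    have h3 := variance_fun_id_gaussianReal (μ := 0) (v := (η ^ 2).toNNReal)
    rw [variance_eq_integral (by fun_prop)] at h3
    simp only [integral_id_gaussianReal, sub_zero] at h3
    rw [Real.coe_toNNReal _ (sq_nonneg η)] at h3
    rw [← h3]
    simp only [PiLp.zero_apply, Matrix.smul_apply, Matrix.one_apply_eq, smul_eq_mul, mul_one] at h2
    rw [← h2, integral_map (hm i).measurable.aemeasurable (by fun_prop)]
  simp_rw [EuclideanSpace.real_norm_sq_eq]
  rw [integral_finsetSum]
  · simp [hi]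
  · intro i _
    refine Integrable.mono' (integrable_normSq_gaussianLaw η)
      (by fun_prop) (ae_of_all _ fun z => ?_)
    rw [Real.norm_eq_abs, abs_of_nonneg (sq_nonneg _), EuclideanSpace.real_norm_sq_eq]
    exact Finset.single_le_sum (f := fun i => z i ^ 2) (fun _ _ => sq_nonneg _) (Finset.mem_univ i)

lemma integral_norm_gaussianLaw_le {η : ℝ} (hη : 0 ≤ η) :
    ∫ z, ‖z‖ ∂(gaussianLaw n η) ≤ η * √n := by
  have h1 : (∫ z, ‖z‖ ∂(gaussianLaw n η)) ^ 2 ≤ n * η ^ 2 := by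
    rw [← integral_normSq_gaussianLaw]
    exact (convexOn_pow 2 |>.subset (Ici_subset_Ici.2 le_rfl) (convex_Ici 0)).map_integral_le
      (continuous_pow 2).continuousOn isClosed_Ici (ae_of_all _ fun z => norm_nonneg z)
      (integrable_norm_gaussianLaw η) (integrable_normSq_gaussianLaw η)
  rw [← Real.sqrt_sq (integral_nonneg fun z => norm_nonneg z)]
  refine (Real.sqrt_le_sqrt h1).trans ?_
  rw [Real.sqrt_mul (by positivity), Real.sqrt_sq hη, mul_comm]

lemma abs_le_of_lipschitz (hL : ∀ x y, |f x - f y| ≤ K * ‖x - y‖) (x z : E n) :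
    |f (x + z)| ≤ |f x| + K * ‖z‖ := by
  have := hL (x + z) x
  have h2 := abs_add_le (f (x + z) - f x) (f x)
  simp at this h2
  linarith

lemma integrable_smoothing (hL : ∀ x y, |f x - f y| ≤ K * ‖x - y‖) (η : ℝ) (x : E n) :
    Integrable (fun z => f (x + z)) (gaussianLaw n η) := by
  have hc := continuous_of_lipschitz hL
  exact Integrable.mono' ((integrable_const |f x|).add ((integrable_norm_gaussianLaw η).const_mul K))
    (by fun_prop) (ae_of_all _ (abs_le_of_lipschitz hL x))

lemma integrable_smoothing_mul_inner (hL : ∀ x y, |f x - f y| ≤ K * ‖x - y‖) (η : ℝ) (x e : E n) :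
    Integrable (fun z => f (x + z) * inner ℝ z e) (gaussianLaw n η) := by
  have hc := continuous_of_lipschitz hL
  refine Integrable.mono' (g := fun z => ‖e‖ * (|f x| * ‖z‖ + K * ‖z‖ ^ 2))
    ((((integrable_norm_gaussianLaw η).const_mul _).add
      ((integrable_normSq_gaussianLaw η).const_mul K)).const_mul _)
    (by fun_prop) (ae_of_all _ fun z => ?_)
  rw [Real.norm_eq_abs, abs_mul]
  have h1 := abs_le_of_lipschitz hL x z
  have h2 := abs_real_inner_le_norm z e
  calc |f (x + z)| * |inner ℝ z e| ≤ (|f x| + K * ‖z‖) * (‖z‖ * ‖e‖) := by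
        apply mul_le_mul h1 h2 (abs_nonneg _) ((abs_nonneg _).trans h1)
    _ = _ := by ring

/-- Smoothing does not decrease a convex function. -/
lemma le_smoothing (hL : ∀ x y, |f x - f y| ≤ K * ‖x - y‖) (hf : ConvexOn ℝ univ f) (η : ℝ)
    (x : E n) : f x ≤ ∫ z, f (x + z) ∂(gaussianLaw n η) := by
  have hi : Integrable (fun z : E n => x + z) (gaussianLaw n η) :=
    (integrable_const x).add IsGaussian.integrable_id
  have := hf.map_integral_le (continuous_of_lipschitz hL).continuousOn isClosed_univ
    (ae_of_all (gaussianLaw n η) fun z => mem_univ (x + z)) hi (integrable_smoothing hL η x)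
  rwa [integral_add (integrable_const x) IsGaussian.integrable_fun_id,
    integral_id_multivariateGaussian, integral_const, probReal_univ, one_smul, add_zero] at this

lemma smoothing_le (hL : ∀ x y, |f x - f y| ≤ K * ‖x - y‖) (hK : 0 ≤ K) {η : ℝ} (hη : 0 ≤ η)
    (x : E n) : ∫ z, f (x + z) ∂(gaussianLaw n η) ≤ f x + K * (η * √n) := by
  calc ∫ z, f (x + z) ∂(gaussianLaw n η) ≤ ∫ z, (f x + K * ‖z‖) ∂(gaussianLaw n η) := by
        refine integral_mono (integrable_smoothing hL η x)
          ((integrable_const _).add ((integrable_norm_gaussianLaw η).const_mul K)) fun z => ?_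
        have := (abs_le.1 (hL (x + z) x)).2
        simp at this
        simp only
        linarith
    _ = f x + K * ∫ z, ‖z‖ ∂(gaussianLaw n η) := by
        rw [integral_add (integrable_const _) ((integrable_norm_gaussianLaw η).const_mul K),
          integral_const_mul]
        simp
    _ ≤ _ := by
        gcongr
        exact integral_norm_gaussianLaw_le hη

lemma inner_resample (η : ℝ) {e : E n} (he : ‖e‖ = 1) (q : E n × ℝ) :
    inner ℝ (resample η e q) e = η * q.2 := by
  simp only [resample, inner_add_left, inner_neg_left, inner_smul_left,
    real_inner_self_eq_norm_sq, he, conj_trivial]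
  ring

/-- The restriction of `f` to the line through `x - z` in direction `e`, recentered. -/
def lineFun (f : E n → ℝ) (η : ℝ) (x e z : E n) (w : ℝ) : ℝ := f (x + resample η e (z, w))

lemma lineFun_lipschitz (hL : ∀ x y, |f x - f y| ≤ K * ‖x - y‖) {η : ℝ} (hη : 0 ≤ η) {e : E n}
    (he : ‖e‖ = 1) (x z : E n) (a b : ℝ) :
    |lineFun f η x e z a - lineFun f η x e z b| ≤ (K * η) * |a - b| := by
  refine (hL _ _).trans_eq ?_
  have : x + resample η e (z, a) - (x + resample η e (z, b)) = (η * (a - b)) • e := by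
    simp only [resample]; module
  rw [this, norm_smul, he, Real.norm_eq_abs, abs_mul, abs_of_nonneg hη]
  ring

lemma lineFun_convex (hf : ConvexOn ℝ univ f) (η : ℝ) (x e z : E n) :
    ConvexOn ℝ univ (lineFun f η x e z) := by
  refine ⟨convex_univ, fun a _ b _ s t hs ht hst => ?_⟩
  have := hf.2 (mem_univ (x + resample η e (z, a))) (mem_univ (x + resample η e (z, b))) hs ht hst
  have e1 : s • (x + resample η e (z, a)) + t • (x + resample η e (z, b)) =
      x + resample η e (z, s • a + t • b) := by
    obtain rfl : s = 1 - t := by linarith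
    simp only [resample, smul_eq_mul]; module
  rw [e1] at this
  exact this

lemma integral_resample (η : ℝ) {e : E n} (he : ‖e‖ = 1) {ψ : E n → ℝ} (hm : Measurable ψ)
    (hi : Integrable ψ (gaussianLaw n η)) :
    Integrable (fun q => ψ (resample η e q)) ((gaussianLaw n η).prod (gaussianReal 0 1)) ∧
    ∫ z, ψ z ∂(gaussianLaw n η) =
      ∫ z, ∫ w, ψ (resample η e (z, w)) ∂(gaussianReal 0 1) ∂(gaussianLaw n η) := by
  have h := map_resample η he
  have hi' : Integrable (fun q => ψ (resample η e q))
      ((gaussianLaw n η).prod (gaussianReal 0 1)) := by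
    rw [← h, integrable_map_measure hm.aestronglyMeasurable
      (measurable_resample η e).aemeasurable] at hi
    exact hi
  refine ⟨hi', ?_⟩
  rw [← integral_prod (fun q => ψ (resample η e q)) hi']
  nth_rw 1 [← h]
  rw [integral_map (measurable_resample η e).aemeasurable hm.aestronglyMeasurable]

/-- The Gaussian smoothing of a convex function lies above its tangent planes. -/
lemma smoothing_subgradient (hL : ∀ x y, |f x - f y| ≤ K * ‖x - y‖) (hf : ConvexOn ℝ univ f)
    {η : ℝ} (hη : 0 < η) (x u : E n) :
    (η ^ 2)⁻¹ * ∫ z, f (x + z) * inner ℝ z u ∂(gaussianLaw n η) ≤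
      ∫ z, f (x + u + z) ∂(gaussianLaw n η) - ∫ z, f (x + z) ∂(gaussianLaw n η) := by
  rcases eq_or_ne u 0 with rfl | hu
  · simp
  have hun : 0 < ‖u‖ := norm_pos_iff.2 hu
  set e : E n := ‖u‖⁻¹ • u with hedef
  have he : ‖e‖ = 1 := norm_smul_inv_norm hu
  have hue : u = ‖u‖ • e := by rw [hedef, smul_smul, mul_inv_cancel₀ hun.ne', one_smul]
  have hc := continuous_of_lipschitz hL
  obtain ⟨-, h0⟩ := integral_resample η he (ψ := fun z => f (x + z)) (by fun_prop)
    (integrable_smoothing hL η x)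
  obtain ⟨i1, h1⟩ := integral_resample η he (ψ := fun z => f (x + u + z)) (by fun_prop)
    (integrable_smoothing hL η (x + u))
  obtain ⟨i0, -⟩ := integral_resample η he (ψ := fun z => f (x + z)) (by fun_prop)
    (integrable_smoothing hL η x)
  obtain ⟨i2, h2⟩ := integral_resample η he (ψ := fun z => f (x + z) * inner ℝ z e)
    (by fun_prop) (integrable_smoothing_mul_inner hL η x e)
  have h3 : ∫ z, f (x + z) * inner ℝ z u ∂(gaussianLaw n η) =
      ‖u‖ * ∫ z, f (x + z) * inner ℝ z e ∂(gaussianLaw n η) := by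
    rw [← integral_const_mul]
    refine integral_congr_ae (ae_of_all _ fun z => ?_)
    simp only
    nth_rw 1 [hue]
    rw [inner_smul_right]
    ring
  rw [h3, h0, h1, h2, ← mul_assoc, ← integral_const_mul, ← integral_sub i1.integral_prod_left
    i0.integral_prod_left]
  refine integral_mono (i2.integral_prod_left.const_mul _)
    (i1.integral_prod_left.sub i0.integral_prod_left) fun z => ?_
  -- On each line in direction `e` the variable `w` is measured in units of `η`, so moving by `u` is
  -- the shift `‖u‖ / η`.
  have key := gaussian_convex_shift (lineFun_lipschitz hL hη.le he x z)
    (lineFun_convex hf η x e z) (‖u‖ / η)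
  have e1 : ∀ w, lineFun f η x e z (w + ‖u‖ / η) = f (x + u + resample η e (z, w)) := by
    intro w
    simp only [lineFun]
    congr 1
    nth_rw 2 [hue]
    simp only [resample]
    have : η * (w + ‖u‖ / η) = η * w + ‖u‖ := by field_simp
    rw [this]
    module
  simp_rw [e1] at key
  have e2 : ∫ w, f (x + resample η e (z, w)) * inner ℝ (resample η e (z, w)) e ∂(gaussianReal 0 1) =
      η * ∫ w, lineFun f η x e z w * w ∂(gaussianReal 0 1) := by
    rw [← integral_const_mul]
    refine integral_congr_ae (ae_of_all _ fun w => ?_)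
    simp only [inner_resample η he, lineFun]
    ring
  simp only
  rw [e2]
  refine le_trans (le_of_eq ?_) key
  field_simp

end Smoothing

/-! ### Stochastic oracles and the moments of the gradient estimator -/

/-- A stochastic oracle `G` for a convex function `f` that is `L₀`-Lipschitz in the `L²` norm. -/
structure ConvexOracle {n : ℕ} {Θ : Type u} [MeasurableSpace Θ] (L₀ : ℝ) (Q : Measure Θ)
    (G : E n → Θ → ℝ) (f : E n → ℝ) : Prop where
  measurable : Measurable (Function.uncurry G)
  integrable : ∀ x, Integrable (G x) Q
  objective : ∀ x, f x = ∫ θ, G x θ ∂Q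
  lipschitz : ∀ x y, eLpNorm (fun θ => G x θ - G y θ) 2 Q ≤ ENNReal.ofReal (L₀ * ‖x - y‖)
  convex : ConvexOn ℝ univ f

section Oracle

variable {n : ℕ} {Θ : Type u} [MeasurableSpace Θ] {L₀ : ℝ} {Q : Measure Θ} {G : E n → Θ → ℝ}
  {f : E n → ℝ}

lemma shift_eq_resample (η : ℝ) (x : E n) (i : Fin n) (w : ℝ) (z : E n) :
    shift x i (η * w) z = x + resample η (EuclideanSpace.single i 1) (z, w) := by
  ext j
  by_cases h : j = i
  · subst h
    simp [shift, resample, EuclideanSpace.inner_single_right]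
  · simp [shift, resample, h, sub_eq_add_neg]

lemma norm_shift_sub (x : E n) (i : Fin n) (a : ℝ) (z : E n) :
    ‖shift x i a z - shift x i (-a) z‖ = 2 * |a| := by
  have : shift x i a z - shift x i (-a) z = EuclideanSpace.single i (2 * a) := by
    ext j
    by_cases h : j = i
    · subst h
      simp [shift]; ring
    · simp [shift, h]
  rw [this, PiLp.norm_single, Real.norm_eq_abs, abs_mul]
  simp

lemma norm_sq_gradEst (G : E n → Θ → ℝ) (η : ℝ) (x : E n) (v : ℝ) (z : E n) (θ : Θ) :
    ‖gradEst G η x v z θ‖ ^ 2 = ∑ i, (G (shift x i (η * √(2 * v)) z) θ -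
      G (shift x i (-(η * √(2 * v))) z) θ) ^ 2 / (2 * Real.pi * η ^ 2) := by
  rw [EuclideanSpace.real_norm_sq_eq]
  refine Finset.sum_congr rfl fun i _ => ?_
  simp only [gradEst, div_pow, mul_pow]
  rw [Real.sq_sqrt (by positivity)]
  ring

@[fun_prop]
lemma measurable_shift (i : Fin n) :
    Measurable (fun p : E n × ℝ × E n => shift p.1 i p.2.1 p.2.2) := by
  unfold shift
  refine (WithLp.measurable_toLp 2 _).comp (measurable_pi_lambda _ fun j => ?_)
  by_cases h : j = i
  · simp only [h, if_true]; fun_prop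
  · simp only [h, if_false]; fun_prop

lemma measurable_query (hG : Measurable (Function.uncurry G)) (η c : ℝ) (i : Fin n) :
    Measurable (fun p : E n × (ℝ × E n × Θ) =>
      G (shift p.1 i (c * (η * √(2 * p.2.1))) p.2.2.1) p.2.2.2) := by
  have h1 : Measurable (fun p : E n × (ℝ × E n × Θ) =>
      shift p.1 i (c * (η * √(2 * p.2.1))) p.2.2.1) :=
    (measurable_shift i).comp (f := fun p : E n × (ℝ × E n × Θ) =>
      (p.1, c * (η * √(2 * p.2.1)), p.2.2.1)) (by fun_prop)
  exact hG.comp (h1.prodMk (by fun_prop))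

lemma measurable_gradEst (hG : Measurable (Function.uncurry G)) (η : ℝ) :
    Measurable (fun p : E n × (ℝ × E n × Θ) => gradEst G η p.1 p.2.1 p.2.2.1 p.2.2.2) := by
  unfold gradEst
  refine (WithLp.measurable_toLp 2 _).comp (measurable_pi_lambda _ fun i => ?_)
  have h1 := measurable_query hG η 1 i
  have h2 := measurable_query hG η (-1) i
  simp only [one_mul, neg_mul] at h1 h2
  exact (h1.sub h2).div_const _

instance isProbabilityMeasure_sampleLaw [IsProbabilityMeasure Q] (η : ℝ) :
    IsProbabilityMeasure (sampleLaw n η Q) := by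
  unfold sampleLaw; infer_instance

lemma lintegral_sampleLaw [IsProbabilityMeasure Q] (η : ℝ) {H : ℝ × E n × Θ → ℝ≥0∞}
    (hH : Measurable H) :
    ∫⁻ s, H s ∂(sampleLaw n η Q) =
      ∫⁻ v, ∫⁻ z, ∫⁻ θ, H (v, z, θ) ∂Q ∂(gaussianLaw n η) ∂(expMeasure 1) := by
  unfold sampleLaw
  rw [lintegral_prod _ hH.aemeasurable]
  refine lintegral_congr fun v => ?_
  rw [lintegral_prod _ (by fun_prop)]

/-- Bounds on the estimator depend on `v` only, through the distance `2 η √(2v)` of the two query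
points; every moment thus reduces to a moment of `Exp(1)`, and only `v > 0` matters. -/
lemma lintegral_sampleLaw_le [IsProbabilityMeasure Q] (η : ℝ) {H : ℝ × E n × Θ → ℝ≥0∞}
    (hH : Measurable H) {h : ℝ → ℝ≥0∞}
    (hle : ∀ v, 0 < v → ∀ z, ∫⁻ θ, H (v, z, θ) ∂Q ≤ h v) :
    ∫⁻ s, H s ∂(sampleLaw n η Q) ≤ ∫⁻ v, h v ∂(expMeasure 1) := by
  rw [lintegral_sampleLaw η hH]
  refine lintegral_mono_ae ?_
  filter_upwards [ae_exp_one_pos] with v hv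
  calc ∫⁻ z, ∫⁻ θ, H (v, z, θ) ∂Q ∂(gaussianLaw n η) ≤ ∫⁻ _, h v ∂(gaussianLaw n η) :=
        lintegral_mono fun z => hle v hv z
    _ = h v := by simp

/-- The mean of the gradient estimator. -/
def meanGrad (G : E n → Θ → ℝ) (Q : Measure Θ) (η : ℝ) (x : E n) : E n :=
  ∫ s, gradEst G η x s.1 s.2.1 s.2.2 ∂(sampleLaw n η Q)

/-! ### Mean and second moment of the gradient estimator -/

namespace ConvexOracle

variable (O : ConvexOracle L₀ Q G f)

include O

lemma measurable_apply (x : E n) : Measurable (G x) :=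
  O.measurable.comp (measurable_const.prodMk measurable_id)

lemma lintegral_sq_sub_le (hL₀ : 0 ≤ L₀) (x y : E n) :
    ∫⁻ θ, ENNReal.ofReal ((G x θ - G y θ) ^ 2) ∂Q ≤ ENNReal.ofReal (L₀ ^ 2 * ‖x - y‖ ^ 2) := by
  have h := eLpNorm_nnreal_pow_eq_lintegral (f := fun θ => G x θ - G y θ) (μ := Q)
    (p := 2) two_ne_zero
  have h2 : ∫⁻ θ, ENNReal.ofReal ((G x θ - G y θ) ^ 2) ∂Q =
      eLpNorm (fun θ => G x θ - G y θ) 2 Q ^ 2 := by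
    have e : ((2 : NNReal) : ℝ) = (2 : ℕ) := by norm_num
    rw [e, ENNReal.rpow_natCast] at h
    have e2 : ((2 : NNReal) : ℝ≥0∞) = 2 := by norm_num
    rw [e2] at h
    rw [h]
    refine lintegral_congr fun θ => ?_
    rw [ENNReal.rpow_natCast, Real.enorm_eq_ofReal_abs, ← ENNReal.ofReal_pow (abs_nonneg _), sq_abs]
  rw [h2, ← mul_pow, ENNReal.ofReal_pow (by positivity)]
  gcongr
  exact O.lipschitz x y

lemma lipschitz_objective [IsProbabilityMeasure Q] (hL₀ : 0 ≤ L₀) (x y : E n) :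
    |f x - f y| ≤ L₀ * ‖x - y‖ := by
  rw [O.objective x, O.objective y, ← integral_sub (O.integrable x) (O.integrable y)]
  have h := enorm_integral_le_lintegral_enorm (μ := Q) (fun θ => G x θ - G y θ)
  rw [← eLpNorm_one_eq_lintegral_enorm] at h
  have h1 := h.trans ((eLpNorm_le_eLpNorm_of_exponent_le (by norm_num : (1 : ℝ≥0∞) ≤ 2)
    ((O.measurable_apply x).sub (O.measurable_apply y)).aestronglyMeasurable).trans
    (O.lipschitz x y))
  rw [Real.enorm_eq_ofReal_abs] at h1
  exact (ENNReal.ofReal_le_ofReal_iff (by positivity)).1 h1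

lemma lintegral_query_le (hL₀ : 0 ≤ L₀) (η : ℝ) (x : E n) (i : Fin n) {v : ℝ} (hv : 0 ≤ v)
    (z : E n) :
    ∫⁻ θ, ENNReal.ofReal ((G (shift x i (η * √(2 * v)) z) θ -
      G (shift x i (-(η * √(2 * v))) z) θ) ^ 2) ∂Q ≤ ENNReal.ofReal (8 * L₀ ^ 2 * η ^ 2 * v) := by
  refine (O.lintegral_sq_sub_le hL₀ _ _).trans (le_of_eq ?_)
  rw [norm_shift_sub, mul_pow, sq_abs, mul_pow, Real.sq_sqrt (by positivity)]
  congr 1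
  ring

/-- The second moment of the gradient estimator is at most `4 n L₀² / π`. -/
lemma lintegral_norm_sq_gradEst_le [IsProbabilityMeasure Q] (hL₀ : 0 ≤ L₀) {η : ℝ} (hη : 0 < η)
    (x : E n) :
    ∫⁻ s, ENNReal.ofReal (‖gradEst G η x s.1 s.2.1 s.2.2‖ ^ 2) ∂(sampleLaw n η Q) ≤
      ENNReal.ofReal (cn n L₀) := by
  have hm : Measurable (fun s : ℝ × E n × Θ => gradEst G η x s.1 s.2.1 s.2.2) :=
    (measurable_gradEst O.measurable η).comp (measurable_const.prodMk measurable_id)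
  refine (lintegral_sampleLaw_le η (h := fun v => ENNReal.ofReal (cn n L₀) * ENNReal.ofReal v)
    (by fun_prop) fun v hv z => ?_).trans (le_of_eq ?_)
  · simp_rw [norm_sq_gradEst]
    have hpos : ∀ i θ, 0 ≤ (G (shift x i (η * √(2 * v)) z) θ -
        G (shift x i (-(η * √(2 * v))) z) θ) ^ 2 / (2 * Real.pi * η ^ 2) := fun i θ => by
      positivity
    simp_rw [ENNReal.ofReal_sum_of_nonneg fun i _ => hpos i _]
    have hmi : ∀ i, Measurable fun θ => ENNReal.ofReal ((G (shift x i (η * √(2 * v)) z) θ -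
        G (shift x i (-(η * √(2 * v))) z) θ) ^ 2 / (2 * Real.pi * η ^ 2)) := fun i =>
      (((((O.measurable_apply _).sub (O.measurable_apply _)).pow_const 2).div_const
        _).ennreal_ofReal)
    rw [lintegral_finsetSum _ fun i _ => hmi i]
    have h1 : ∀ i, ∫⁻ θ, ENNReal.ofReal ((G (shift x i (η * √(2 * v)) z) θ -
        G (shift x i (-(η * √(2 * v))) z) θ) ^ 2 / (2 * Real.pi * η ^ 2)) ∂Q ≤
        ENNReal.ofReal (4 * L₀ ^ 2 / Real.pi * v) := by
      intro i
      simp_rw [div_eq_mul_inv]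
      simp_rw [ENNReal.ofReal_mul (sq_nonneg _)]
      rw [lintegral_mul_const' _ _ ENNReal.ofReal_ne_top]
      refine (mul_le_mul_left (O.lintegral_query_le hL₀ η x i hv.le z) _).trans (le_of_eq ?_)
      rw [← ENNReal.ofReal_mul (by positivity)]
      congr 1
      field_simp
      ring
    refine (Finset.sum_le_sum fun i _ => h1 i).trans (le_of_eq ?_)
    rw [Finset.sum_const, Finset.card_univ, Fintype.card_fin, ← ENNReal.ofReal_mul
      (by unfold cn; positivity), nsmul_eq_mul, ← ENNReal.ofReal_natCast, ← ENNReal.ofReal_mul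
      (by positivity)]
    congr 1
    unfold cn
    ring
  · rw [lintegral_const_mul' _ _ ENNReal.ofReal_ne_top, lintegral_id_exp_one, mul_one]

lemma memLp_gradEst [IsProbabilityMeasure Q] (hL₀ : 0 ≤ L₀) {η : ℝ} (hη : 0 < η) (x : E n) :
    MemLp (fun s : ℝ × E n × Θ => gradEst G η x s.1 s.2.1 s.2.2) 2 (sampleLaw n η Q) := by
  have hm : Measurable (fun s : ℝ × E n × Θ => gradEst G η x s.1 s.2.1 s.2.2) :=
    (measurable_gradEst O.measurable η).comp (measurable_const.prodMk measurable_id)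
  rw [← memLp_norm_iff hm.aestronglyMeasurable, memLp_two_iff_integrable_sq (by fun_prop)]
  refine ⟨by fun_prop, ?_⟩
  rw [hasFiniteIntegral_iff_ofReal (ae_of_all _ fun _ => sq_nonneg _)]
  exact (O.lintegral_norm_sq_gradEst_le hL₀ hη x).trans_lt ENNReal.ofReal_lt_top

lemma integrable_gradEst [IsProbabilityMeasure Q] (hL₀ : 0 ≤ L₀) {η : ℝ} (hη : 0 < η) (x : E n) :
    Integrable (fun s : ℝ × E n × Θ => gradEst G η x s.1 s.2.1 s.2.2) (sampleLaw n η Q) :=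
  (O.memLp_gradEst hL₀ hη x).integrable (by norm_num)

lemma integral_norm_sq_gradEst_le [IsProbabilityMeasure Q] (hL₀ : 0 ≤ L₀) {η : ℝ} (hη : 0 < η)
    (x : E n) :
    ∫ s, ‖gradEst G η x s.1 s.2.1 s.2.2‖ ^ 2 ∂(sampleLaw n η Q) ≤ cn n L₀ := by
  have h := O.lintegral_norm_sq_gradEst_le hL₀ hη x
  have hi := (O.memLp_gradEst hL₀ hη x).norm.integrable_sq
  rw [← ofReal_integral_eq_lintegral_ofReal hi (ae_of_all _ fun _ => sq_nonneg _)] at h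
  exact (ENNReal.ofReal_le_ofReal_iff (by unfold cn; positivity)).1 h

lemma integral_norm_gradEst_le [IsProbabilityMeasure Q] (hL₀ : 0 ≤ L₀) {η : ℝ} (hη : 0 < η)
    (x : E n) :
    ∫ s, ‖gradEst G η x s.1 s.2.1 s.2.2‖ ∂(sampleLaw n η Q) ≤ √(cn n L₀) := by
  have h2 := (O.memLp_gradEst hL₀ hη x).norm
  have h1 : (∫ s, ‖gradEst G η x s.1 s.2.1 s.2.2‖ ∂(sampleLaw n η Q)) ^ 2 ≤ cn n L₀ := by
    refine le_trans ?_ (O.integral_norm_sq_gradEst_le hL₀ hη x)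
    exact (convexOn_pow 2 |>.subset (Ici_subset_Ici.2 le_rfl) (convex_Ici 0)).map_integral_le
      (continuous_pow 2).continuousOn isClosed_Ici (ae_of_all _ fun z => norm_nonneg _)
      (h2.integrable (by norm_num)) h2.integrable_sq
  rw [← Real.sqrt_sq (integral_nonneg fun z => norm_nonneg _)]
  exact Real.sqrt_le_sqrt h1

lemma norm_meanGrad_le [IsProbabilityMeasure Q] (hL₀ : 0 ≤ L₀) {η : ℝ} (hη : 0 < η) (x : E n) :
    ‖meanGrad G Q η x‖ ≤ √(cn n L₀) :=
  (norm_integral_le_integral_norm _).trans (O.integral_norm_gradEst_le hL₀ hη x)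

/-- Integrating over the sample replaces `G` by `f`; swapping `V` and `Z` (the difference is
dominated by a multiple of `√(2v)`) and integrating over `V` produces the Gaussian weight `w`;
`map_resample` then merges `z` and `w` into one Gaussian vector. -/
lemma meanGrad_apply [IsProbabilityMeasure Q] (hL₀ : 0 ≤ L₀) {η : ℝ} (hη : 0 < η) (x : E n)
    (i : Fin n) :
    meanGrad G Q η x i =
      (η ^ 2)⁻¹ * ∫ z, f (x + z) * inner ℝ z (EuclideanSpace.single i (1 : ℝ))
        ∂(gaussianLaw n η) := by
  have hL := O.lipschitz_objective hL₀
  have hc := continuous_of_lipschitz hL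
  have he : ‖(EuclideanSpace.single i (1 : ℝ) : E n)‖ = 1 := by simp
  have hi := O.integrable_gradEst hL₀ hη x
  have hi' : Integrable (fun s : ℝ × E n × Θ => gradEst G η x s.1 s.2.1 s.2.2 i)
      (sampleLaw n η Q) := (EuclideanSpace.proj (𝕜 := ℝ) i).integrable_comp hi
  have h1 : meanGrad G Q η x i =
      ∫ s, gradEst G η x s.1 s.2.1 s.2.2 i ∂(sampleLaw n η Q) := by
    unfold meanGrad
    exact ((EuclideanSpace.proj (𝕜 := ℝ) i).integral_comp_comm hi).symm
  unfold sampleLaw at hi' h1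
  rw [h1, integral_prod _ hi']
  have h2 : ∀ᵐ v ∂(expMeasure 1), ∫ q, gradEst G η x v q.1 q.2 i
      ∂((gaussianLaw n η).prod Q) = (η * √(2 * Real.pi))⁻¹ * ∫ z,
        (lineFun f η x (EuclideanSpace.single i 1) z (√(2 * v)) -
          lineFun f η x (EuclideanSpace.single i 1) z (-√(2 * v))) ∂(gaussianLaw n η) := by
    filter_upwards [hi'.prod_right_ae] with v hv
    rw [integral_prod _ hv, ← integral_const_mul]
    refine integral_congr_ae (ae_of_all _ fun z => ?_)
    simp only [gradEst, lineFun, ← shift_eq_resample]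
    rw [integral_div, integral_sub (O.integrable _) (O.integrable _), ← O.objective,
      ← O.objective, mul_neg]
    field_simp
  rw [integral_congr_ae h2, integral_const_mul]
  have hsub : ∀ v z, |lineFun f η x (EuclideanSpace.single i 1) z (√(2 * v)) -
          lineFun f η x (EuclideanSpace.single i 1) z (-√(2 * v))| ≤ L₀ * η * (2 * √(2 * v)) := by
    intro v z
    refine (lineFun_lipschitz hL hη.le he x z _ _).trans_eq ?_
    rw [sub_neg_eq_add, ← two_mul, abs_of_nonneg (by positivity)]
  have hsqrt : Integrable (fun v : ℝ => √(2 * v)) (expMeasure 1) := by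
    refine Integrable.mono' (g := fun v => 1 + 2 * v) ?_ (by fun_prop) ?_
    · refine (integrable_const _).add (Integrable.const_mul ⟨by fun_prop, ?_⟩ 2)
      rw [hasFiniteIntegral_iff_ofReal (ae_exp_one_pos.mono fun _ h => h.le), lintegral_id_exp_one]
      simp
    · filter_upwards [ae_exp_one_pos] with v hv
      rw [Real.norm_eq_abs, abs_of_nonneg (by positivity)]
      nlinarith [Real.sq_sqrt (by positivity : 0 ≤ 2 * v), Real.sqrt_nonneg (2 * v)]
  have hprod : Integrable (Function.uncurry fun v z =>
      lineFun f η x (EuclideanSpace.single i 1) z (√(2 * v)) -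
          lineFun f η x (EuclideanSpace.single i 1) z (-√(2 * v)))
      ((expMeasure 1).prod (gaussianLaw n η)) := by
    refine Integrable.mono' (g := fun q => L₀ * η * (2 * √(2 * q.1)))
      (((hsqrt.const_mul 2).const_mul (L₀ * η)).comp_fst _) ?_ (ae_of_all _ fun q => hsub q.1 q.2)
    apply Measurable.aestronglyMeasurable
    unfold lineFun resample
    simp only [Function.uncurry_def]
    fun_prop
  rw [integral_integral_swap hprod]
  have h3 : ∀ z, ∫ v, (lineFun f η x (EuclideanSpace.single i 1) z (√(2 * v)) -
          lineFun f η x (EuclideanSpace.single i 1) z (-√(2 * v))) ∂(expMeasure 1) =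
      √(2 * Real.pi) * (η⁻¹ * ∫ w, (fun u => f (x + u) * inner ℝ u (EuclideanSpace.single i (1 : ℝ)))
        (resample η (EuclideanSpace.single i 1) (z, w)) ∂(gaussianReal 0 1)) := by
    intro z
    have h4 : ∫ w, (fun u => f (x + u) * inner ℝ u (EuclideanSpace.single i (1 : ℝ)))
        (resample η (EuclideanSpace.single i 1) (z, w)) ∂(gaussianReal 0 1) =
        η * ∫ w, lineFun f η x (EuclideanSpace.single i 1) z w * w ∂(gaussianReal 0 1) := by
      rw [← integral_const_mul]
      refine integral_congr_ae (ae_of_all _ fun w => ?_)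
      simp only [inner_resample η he, lineFun]
      ring
    rw [h4, integral_mul_gaussian_eq_exp
      (integrable_mul_gaussian_of_lipschitz (lineFun_lipschitz hL hη.le he x z))]
    have : √(2 * Real.pi) ≠ 0 := by positivity
    field_simp
  simp_rw [h3]
  rw [integral_const_mul, integral_const_mul, ← (integral_resample η he
    (ψ := fun u => f (x + u) * inner ℝ u (EuclideanSpace.single i (1 : ℝ))) (by fun_prop)
    (integrable_smoothing_mul_inner hL η x _)).2]
  have : √(2 * Real.pi) ≠ 0 := by positivity
  field_simp

lemma inner_meanGrad [IsProbabilityMeasure Q] (hL₀ : 0 ≤ L₀) {η : ℝ} (hη : 0 < η) (x u : E n) :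
    inner ℝ (meanGrad G Q η x) u = (η ^ 2)⁻¹ * ∫ z, f (x + z) * inner ℝ z u ∂(gaussianLaw n η) := by
  have hL := O.lipschitz_objective hL₀
  have h1 : ∀ a b : E n, inner ℝ a b =
      ∑ i, b i * inner ℝ a (EuclideanSpace.single i (1 : ℝ)) := by
    intro a b
    rw [PiLp.inner_apply]
    refine Finset.sum_congr rfl fun i _ => ?_
    simp [EuclideanSpace.inner_single_right]
  rw [h1 (meanGrad G Q η x)]
  have h2 : ∀ z, f (x + z) * inner ℝ z u =
      ∑ i, u i * (f (x + z) * inner ℝ z (EuclideanSpace.single i (1 : ℝ))) := by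
    intro z
    rw [h1 z u, Finset.mul_sum]
    refine Finset.sum_congr rfl fun i _ => ?_
    ring
  simp_rw [h2]
  rw [integral_finsetSum _ fun i _ =>
    (integrable_smoothing_mul_inner hL η x _).const_mul _, Finset.mul_sum]
  refine Finset.sum_congr rfl fun i _ => ?_
  rw [integral_const_mul, EuclideanSpace.inner_single_right, O.meanGrad_apply hL₀ hη]
  simp
  ring

/-- The mean of the gradient estimator is an approximate subgradient. -/
lemma meanGrad_subgradient [IsProbabilityMeasure Q] (hL₀ : 0 ≤ L₀) {η : ℝ} (hη : 0 < η)
    (x y : E n) :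
    f x - f y - L₀ * (η * √n) ≤ inner ℝ (meanGrad G Q η x) (x - y) := by
  have hL := O.lipschitz_objective hL₀
  have h1 := smoothing_subgradient hL O.convex hη x (y - x)
  rw [← O.inner_meanGrad hL₀ hη, add_sub_cancel] at h1
  -- The smoothing error is paid only at `y`: at `x` Jensen's inequality has the favourable sign.
  have h2 := le_smoothing hL O.convex η x
  have h3 := smoothing_le hL hL₀ hη.le y
  have h4 : inner ℝ (meanGrad G Q η x) (x - y) = - inner ℝ (meanGrad G Q η x) (y - x) := by
    rw [← inner_neg_right, neg_sub]
  rw [h4]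
  linarith

end ConvexOracle

end Oracle

/-! ### Euclidean projections -/

section Projection

variable {n : ℕ} {X : Set (E n)} {y y' p p' : E n}

lemma IsProj.inner_le (hX : Convex ℝ X) (h : IsProj X y p) {q : E n} (hq : q ∈ X) :
    inner ℝ (y - p) (q - p) ≤ 0 := by
  refine (norm_eq_iInf_iff_real_inner_le_zero hX h.1).1 ?_ q hq
  have : Nonempty X := ⟨⟨p, h.1⟩⟩
  refine le_antisymm (le_ciInf fun w => h.2 w w.2) ?_
  exact ciInf_le (f := fun w : X => ‖y - w‖) ⟨0, by rintro _ ⟨_, rfl⟩; exact norm_nonneg _⟩ ⟨p, h.1⟩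

/-- `X` need not be closed. Projecting onto its closure is defined everywhere and nonexpansive, and
it agrees with the given projections; this is what makes the iterates measurable functions of the
past. -/
lemma IsProj.closure (h : IsProj X y p) : IsProj (closure X) y p := by
  refine ⟨subset_closure h.1, fun q hq => ?_⟩
  have hc : IsClosed {q : E n | ‖y - p‖ ≤ ‖y - q‖} :=
    isClosed_le continuous_const (by fun_prop)
  exact closure_minimal (fun q hq => h.2 q hq) hc hq

lemma IsProj.dist_le (hX : Convex ℝ X) (h : IsProj X y p) (h' : IsProj X y' p') :
    ‖p - p'‖ ≤ ‖y - y'‖ := by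
  have h1 := h.inner_le hX h'.1
  have h2 := h'.inner_le hX h.1
  have h3 : ‖p - p'‖ ^ 2 ≤ inner ℝ (y - y') (p - p') := by
    rw [← real_inner_self_eq_norm_sq]
    simp only [inner_sub_left, inner_sub_right] at h1 h2 ⊢
    have := real_inner_comm p p'
    linarith
  have h4 := h3.trans (real_inner_le_norm _ _)
  by_contra hlt
  push Not at hlt
  nlinarith [norm_nonneg (y - y')]

/-- Projections onto a convex set are the values of a continuous map. -/
lemma exists_continuous_proj (hX : Convex ℝ X) (hne : X.Nonempty) :
    ∃ π : E n → E n, Continuous π ∧ ∀ y p, IsProj X y p → p = π y := by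
  have hC : Convex ℝ (_root_.closure X) := hX.closure
  have hex := exists_norm_eq_iInf_of_complete_convex hne.closure
    (isClosed_closure (s := X)).isComplete hC
  choose π hπ hmin using hex
  have hproj : ∀ y, IsProj (_root_.closure X) y (π y) := fun y => by
    refine ⟨hπ y, fun q hq => ?_⟩
    rw [hmin y]
    exact ciInf_le (f := fun w : _root_.closure X => ‖y - w‖)
      ⟨0, by rintro _ ⟨_, rfl⟩; exact norm_nonneg _⟩ ⟨q, hq⟩
  refine ⟨π, ?_, fun y p hp => ?_⟩
  · refine (LipschitzWith.of_dist_le_mul (K := 1) fun a b => ?_).continuous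
    rw [dist_eq_norm, dist_eq_norm, NNReal.coe_one, one_mul]
    exact (hproj a).dist_le hC (hproj b)
  · have := hp.closure.dist_le hC (hproj y)
    simpa [sub_eq_zero] using this

end Projection

/-! ### Independence along a recursion -/

section Independence

variable {Ω : Type*} [MeasurableSpace Ω] {P : Measure Ω}
  {α β δ : Type*} [MeasurableSpace α] [MeasurableSpace β] [MeasurableSpace δ]

/-- Both sides become the triple product law after reassociation. It lets the state absorb one noise
variable and stay independent of the later ones. -/
lemma indepFun_prodMk_of_indepFun [IsProbabilityMeasure P] {A : Ω → α} {B : Ω → β} {C : Ω → δ} (hA : Measurable A)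
    (hB : Measurable B) (hC : Measurable C) (h : IndepFun A (fun ω => (B ω, C ω)) P)
    (hBC : IndepFun B C P) : IndepFun (fun ω => (A ω, B ω)) C P := by
  have hAB : IndepFun A B P := h.comp (φ := id) (ψ := Prod.fst) measurable_id measurable_fst
  rw [indepFun_iff_map_prod_eq_prod_map_map (by fun_prop) (by fun_prop)] at h hBC hAB ⊢
  have : IsProbabilityMeasure (P.map A) := Measure.isProbabilityMeasure_map hA.aemeasurable
  have : IsProbabilityMeasure (P.map B) := Measure.isProbabilityMeasure_map hB.aemeasurable
  have : IsProbabilityMeasure (P.map C) := Measure.isProbabilityMeasure_map hC.aemeasurable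
  apply MeasurableEquiv.prodAssoc.map_measurableEquiv_injective
  rw [hAB, Measure.prodAssoc_prod, ← hBC, ← h,
    Measure.map_map MeasurableEquiv.prodAssoc.measurable (by fun_prop)]
  rfl

lemma indepFun_tail {ζ : ℕ → Ω → α} (hm : ∀ k, Measurable (ζ k)) (h : iIndepFun ζ P) (k : ℕ) :
    IndepFun (ζ k) (fun ω j => ζ (k + 1 + j) ω) P := by
  have h1 := indep_iSup_of_disjoint (fun i => (hm i).comap_le) h.iIndep
    (S := {k}) (T := {j | k < j}) (by simp)
  refine indep_of_indep_of_le_left (indep_of_indep_of_le_right h1 ?_) ?_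
  · rw [← measurable_iff_comap_le]
    refine @measurable_pi_lambda _ _ _ (_) _ _ fun j => ?_
    rw [measurable_iff_comap_le]
    exact le_iSup₂_of_le (f := fun i (_ : i ∈ {j | k < j}) => MeasurableSpace.comap (ζ i) _)
      (k + 1 + j) (by simp; omega) le_rfl
  · exact le_iSup₂_of_le (f := fun i (_ : i ∈ ({k} : Set ℕ)) => MeasurableSpace.comap (ζ i) _)
      k rfl le_rfl

lemma lintegral_of_indepFun [IsProbabilityMeasure P] {S : Ω → α} {Z : Ω → β} (hS : Measurable S) (hZ : Measurable Z)
    (h : IndepFun S Z P) {Φ : α × β → ℝ≥0∞} (hΦ : Measurable Φ) :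
    ∫⁻ ω, Φ (S ω, Z ω) ∂P = ∫⁻ ω, ∫⁻ z, Φ (S ω, z) ∂(P.map Z) ∂P := by
  have : IsProbabilityMeasure (P.map Z) := Measure.isProbabilityMeasure_map hZ.aemeasurable
  rw [indepFun_iff_map_prod_eq_prod_map_map (by fun_prop) (by fun_prop)] at h
  have h1 : ∫⁻ ω, Φ (S ω, Z ω) ∂P = ∫⁻ q, Φ q ∂(P.map fun ω => (S ω, Z ω)) :=
    (lintegral_map hΦ (by fun_prop)).symm
  rw [h1, h, lintegral_prod _ hΦ.aemeasurable, lintegral_map hΦ.lintegral_prod_right' hS]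

lemma real_markov {h : Ω → ℝ} (hm : Measurable h) {C a : ℝ} (hC : 0 ≤ C) (ha : 0 < a)
    (hle : ∫⁻ ω, ENNReal.ofReal (h ω) ∂P ≤ ENNReal.ofReal C) : P.real {ω | a ≤ h ω} ≤ C / a := by
  have h1 := meas_ge_le_lintegral_div (μ := P) (f := fun ω => ENNReal.ofReal (h ω))
    (by fun_prop) (ε := ENNReal.ofReal a) (by simpa using ha) ENNReal.ofReal_ne_top
  have h2 : {ω | a ≤ h ω} ⊆ {ω | ENNReal.ofReal a ≤ ENNReal.ofReal (h ω)} :=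
    fun ω hω => ENNReal.ofReal_le_ofReal hω
  have h3 : P {ω | a ≤ h ω} ≤ ENNReal.ofReal (C / a) := by
    refine (measure_mono h2).trans (h1.trans ?_)
    rw [ENNReal.ofReal_div_of_pos ha]
    gcongr
  rw [Measure.real]
  exact ENNReal.toReal_le_of_le_ofReal (by positivity) h3

end Independence

/-! ### The run as a Markov chain -/

namespace Run

variable {n : ℕ} (R : Run.{u, w} n)

/-- The variates of iteration `k`. -/
def noise (k : ℕ) (ω : R.Ω) : ℝ × E n × R.Θ := (R.V k ω, R.Z k ω, R.ξ k ω)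

/-- The gradient estimator of iteration `k` at `x`. -/
def grad (k : ℕ) (x : E n) (s : ℝ × E n × R.Θ) : E n := gradEst R.G (R.η k) x s.1 s.2.1 s.2.2

/-- The partial sums of `y k (x_k, noise_k)`. -/
def psum (y : ℕ → E n → ℝ × E n × R.Θ → ℝ) (K : ℕ) (ω : R.Ω) : ℝ :=
  ∑ k ∈ Finset.range K, y k (R.x k ω) (R.noise k ω)

/-- The law of the variates of iteration `k`. -/
abbrev noiseLaw (k : ℕ) : Measure (ℝ × E n × R.Θ) := sampleLaw n (R.η k) R.Q

lemma measurable_noise (k : ℕ) : Measurable (R.noise k) :=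
  (R.measurable_V k).prodMk ((R.measurable_Z k).prodMk (R.measurable_ξ k))

lemma map_noise (k : ℕ) : R.P.map (R.noise k) = R.noiseLaw k := R.law k

lemma measurable_grad (hG : Measurable (Function.uncurry R.G)) (k : ℕ) :
    Measurable (fun p : E n × (ℝ × E n × R.Θ) => R.grad k p.1 p.2) :=
  measurable_gradEst hG _

lemma x_mem (k : ℕ) (ω : R.Ω) : R.x k ω ∈ R.X := by
  cases k with
  | zero => exact R.x0_mem ω
  | succ k => exact (R.step k ω).1

lemma exists_step (hG : Measurable (Function.uncurry R.G)) (k : ℕ) :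
    ∃ T : E n × (ℝ × E n × R.Θ) → E n, Measurable T ∧
      ∀ ω, R.x (k + 1) ω = T (R.x k ω, R.noise k ω) := by
  obtain ⟨π, hπ, h⟩ := exists_continuous_proj R.convex_X ⟨_, R.xstar_mem⟩
  refine ⟨fun p => π (p.1 - R.γ k • R.grad k p.1 p.2), ?_, fun ω => h _ _ (R.step k ω)⟩
  have hg := R.measurable_grad hG k
  have : Measurable fun p : E n × (ℝ × E n × R.Θ) => p.1 - R.γ k • R.grad k p.1 p.2 := by fun_prop
  exact hπ.measurable.comp this

lemma psum_succ (y : ℕ → E n → ℝ × E n × R.Θ → ℝ) (K : ℕ) (ω : R.Ω) :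
    R.psum y (K + 1) ω = R.psum y K ω + y K (R.x K ω) (R.noise K ω) :=
  Finset.sum_range_succ _ _

variable {R} {y : ℕ → E n → ℝ × E n × R.Θ → ℝ}

lemma measurable_x (hG : Measurable (Function.uncurry R.G)) (k : ℕ) : Measurable (R.x k) := by
  induction k with
  | zero => exact R.measurable_x0
  | succ k ih =>
    obtain ⟨T, hT, h⟩ := R.exists_step hG k
    rw [funext h]
    exact hT.comp (ih.prodMk (R.measurable_noise k))

lemma measurable_psum (hG : Measurable (Function.uncurry R.G))
    (hy : ∀ k, Measurable (fun p : E n × (ℝ × E n × R.Θ) => y k p.1 p.2)) (K : ℕ) :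
    Measurable (R.psum y K) := by
  unfold psum
  refine Finset.measurable_fun_sum _ fun k _ => ?_
  exact (hy k).comp ((measurable_x hG k).prodMk (R.measurable_noise k))

/-- The induction closes because independence is claimed from the whole future sequence, not only
from the next noise; the running sum is part of the state so that functions of it can be averaged
over the next noise. -/
lemma indepFun_state (hG : Measurable (Function.uncurry R.G))
    (hy : ∀ k, Measurable (fun p : E n × (ℝ × E n × R.Θ) => y k p.1 p.2)) (K : ℕ) :
    IndepFun (fun ω => (R.x K ω, R.psum y K ω)) (fun ω j => R.noise (K + j) ω) R.P := by
  induction K with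
  | zero =>
    have := R.indep_x0.comp (φ := fun x => (x, (0 : ℝ))) (ψ := id) (by fun_prop) measurable_id
    simpa [psum, Function.comp_def, noise] using this
  | succ K ih =>
    have hZ : ∀ k, Measurable (R.noise k) := R.measurable_noise
    have htail : Measurable fun ω j => R.noise (K + 1 + j) ω :=
      measurable_pi_lambda _ fun j => hZ _
    have hs : Measurable fun t : ℕ → ℝ × E n × R.Θ => (t 0, fun j => t (1 + j)) :=
      (measurable_pi_apply 0).prodMk (measurable_pi_lambda _ fun j => measurable_pi_apply (1 + j))
    have h1 : IndepFun (fun ω => (R.x K ω, R.psum y K ω))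
        (fun ω => (R.noise K ω, fun j => R.noise (K + 1 + j) ω)) R.P := by
      have := ih.comp (φ := id)
        (ψ := fun t : ℕ → ℝ × E n × R.Θ => (t 0, fun j => t (1 + j))) measurable_id hs
      simpa [Function.comp_def, add_assoc] using this
    have h2 := indepFun_prodMk_of_indepFun ((measurable_x hG K).prodMk (measurable_psum hG hy K))
      (hZ K) htail h1 (indepFun_tail hZ R.indep K)
    obtain ⟨T, hT, h⟩ := R.exists_step hG K
    have h3 := h2.comp (φ := fun p : (E n × ℝ) × (ℝ × E n × R.Θ) =>
        (T (p.1.1, p.2), p.1.2 + y K p.1.1 p.2)) (ψ := id)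
      ((hT.comp (by fun_prop)).prodMk (measurable_fst.snd.add
        ((hy K).comp (f := fun p : (E n × ℝ) × (ℝ × E n × R.Θ) => (p.1.1, p.2)) (by fun_prop))))
      measurable_id
    simpa [Function.comp_def, h, psum_succ] using h3

/-- One step of the chain: the expectation over the next variates is bounded pointwise. -/
lemma lintegral_psum_succ_le (hG : Measurable (Function.uncurry R.G))
    (hy : ∀ k, Measurable (fun p : E n × (ℝ × E n × R.Θ) => y k p.1 p.2)) (K : ℕ)
    {φ ψ : ℝ → ℝ≥0∞} (hφ : Measurable φ)
    (hle : ∀ x ∈ R.X, ∀ m, ∫⁻ s, φ (m + y K x s) ∂(R.noiseLaw K) ≤ ψ m) :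
    ∫⁻ ω, φ (R.psum y (K + 1) ω) ∂(R.P) ≤ ∫⁻ ω, ψ (R.psum y K ω) ∂(R.P) := by
  have hi : IndepFun (fun ω => (R.x K ω, R.psum y K ω)) (R.noise K) R.P :=
    (indepFun_state hG hy K).comp (φ := id) (ψ := fun t : ℕ → ℝ × E n × R.Θ => t 0)
      measurable_id (measurable_pi_apply 0)
  have h := lintegral_of_indepFun ((measurable_x hG K).prodMk (measurable_psum hG hy K))
    (R.measurable_noise K) hi
    (Φ := fun p : (E n × ℝ) × (ℝ × E n × R.Θ) => φ (p.1.2 + y K p.1.1 p.2))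
    (hφ.comp (measurable_fst.snd.add
        ((hy K).comp (f := fun p : (E n × ℝ) × (ℝ × E n × R.Θ) => (p.1.1, p.2)) (by fun_prop))))
  simp only at h
  simp_rw [psum_succ]
  rw [h, map_noise]
  exact lintegral_mono fun ω => hle _ (R.x_mem K ω) _

/-- Markov's inequality for a sum of nonnegative terms. -/
lemma real_psum_ge_le_of_nonneg (hG : Measurable (Function.uncurry R.G))
    (hy : ∀ k, Measurable (fun p : E n × (ℝ × E n × R.Θ) => y k p.1 p.2)) {c : ℕ → ℝ}
    (hc : ∀ k, 0 ≤ c k)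
    (hle : ∀ k, ∀ x ∈ R.X, ∫⁻ s, ENNReal.ofReal (y k x s) ∂(R.noiseLaw k) ≤ ENNReal.ofReal (c k))
    (K : ℕ) {t : ℝ} (ht : 0 < t) :
    R.P.real {ω | t ≤ R.psum y K ω} ≤ (∑ k ∈ Finset.range K, c k) / t := by
  refine real_markov (measurable_psum hG hy K) (Finset.sum_nonneg fun k _ => hc k) ht ?_
  induction K with
  | zero => simp [psum]
  | succ K ih =>
    refine (lintegral_psum_succ_le hG hy K (φ := ENNReal.ofReal)
      (ψ := fun m => ENNReal.ofReal m + ENNReal.ofReal (c K)) (by fun_prop) fun x hx m => ?_).trans ?_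
    · refine (lintegral_mono fun s => ENNReal.ofReal_add_le).trans ?_
      rw [lintegral_add_left (by fun_prop), lintegral_const, measure_univ, mul_one]
      gcongr
      exact hle K x hx
    · rw [lintegral_add_right _ (by fun_prop), lintegral_const, measure_univ, mul_one,
        Finset.sum_range_succ, ENNReal.ofReal_add (Finset.sum_nonneg fun k _ => hc k) (hc K)]
      gcongr

/-- Chebyshev's inequality for a martingale. -/
lemma real_psum_ge_le_of_centered (hG : Measurable (Function.uncurry R.G))
    (hy : ∀ k, Measurable (fun p : E n × (ℝ × E n × R.Θ) => y k p.1 p.2)) {c : ℕ → ℝ}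
    (hL : ∀ k, ∀ x ∈ R.X, MemLp (y k x) 2 (R.noiseLaw k))
    (h0 : ∀ k, ∀ x ∈ R.X, ∫ s, y k x s ∂(R.noiseLaw k) = 0)
    (hle : ∀ k, ∀ x ∈ R.X, ∫ s, y k x s ^ 2 ∂(R.noiseLaw k) ≤ c k)
    (K : ℕ) {t : ℝ} (ht : 0 < t) :
    R.P.real {ω | t ≤ R.psum y K ω} ≤ (∑ k ∈ Finset.range K, c k) / t ^ 2 := by
  have hc : ∀ k, 0 ≤ c k := fun k =>
    (integral_nonneg fun s => sq_nonneg _).trans (hle k _ R.xstar_mem)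
  have hsub : {ω | t ≤ R.psum y K ω} ⊆ {ω | t ^ 2 ≤ R.psum y K ω ^ 2} := fun ω hω =>
    pow_le_pow_left₀ ht.le hω 2
  refine (measureReal_mono hsub).trans (real_markov ((measurable_psum hG hy K).pow_const 2)
    (Finset.sum_nonneg fun k _ => hc k) (by positivity) ?_)
  clear hsub
  induction K with
  | zero => simp [psum]
  | succ K ih =>
    refine (lintegral_psum_succ_le hG hy K (φ := fun m => ENNReal.ofReal (m ^ 2))
      (ψ := fun m => ENNReal.ofReal (m ^ 2) + ENNReal.ofReal (c K)) (by fun_prop)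
      fun x hx m => ?_).trans ?_
    · have i1 := (hL K x hx).integrable (by norm_num : (1 : ℝ≥0∞) ≤ 2)
      have i2 := (hL K x hx).integrable_sq
      have i3 : Integrable (fun s => m ^ 2 + 2 * m * y K x s) (R.noiseLaw K) :=
        (integrable_const _).add (i1.const_mul _)
      have e : ∀ s, (m + y K x s) ^ 2 = (m ^ 2 + 2 * m * y K x s) + y K x s ^ 2 := fun s => by ring
      have i4 : Integrable (fun s => (m + y K x s) ^ 2) (R.noiseLaw K) := by
        simp_rw [e]; exact i3.add i2
      rw [← ofReal_integral_eq_lintegral_ofReal i4 (ae_of_all _ fun s => sq_nonneg _)]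
      simp_rw [e]
      rw [← ENNReal.ofReal_add (sq_nonneg _) (hc K), integral_add i3 i2,
        integral_add (integrable_const _) (i1.const_mul _), integral_const_mul, h0 K x hx]
      refine ENNReal.ofReal_le_ofReal ?_
      simpa using hle K x hx
    · rw [lintegral_add_right _ (by fun_prop), lintegral_const, measure_univ, mul_one,
        Finset.sum_range_succ, ENNReal.ofReal_add (Finset.sum_nonneg fun k _ => hc k) (hc K)]
      gcongr

/-- Chernoff's inequality. -/
lemma real_psum_ge_le_of_exp (hG : Measurable (Function.uncurry R.G))
    (hy : ∀ k, Measurable (fun p : E n × (ℝ × E n × R.Θ) => y k p.1 p.2)) {c : ℕ → ℝ} {r : ℝ}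
    (hr : 0 < r)
    (hle : ∀ k, ∀ x ∈ R.X, ∫⁻ s, ENNReal.ofReal (Real.exp (r * y k x s)) ∂(R.noiseLaw k) ≤
      ENNReal.ofReal (Real.exp (c k))) (K : ℕ) (t : ℝ) :
    R.P.real {ω | t ≤ R.psum y K ω} ≤ Real.exp (∑ k ∈ Finset.range K, c k - r * t) := by
  have hsub : {ω | t ≤ R.psum y K ω} ⊆
      {ω | Real.exp (r * t) ≤ Real.exp (r * R.psum y K ω)} := fun ω hω =>
    Real.exp_le_exp.2 (mul_le_mul_of_nonneg_left hω hr.le)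
  rw [Real.exp_sub]
  refine (measureReal_mono hsub).trans (real_markov
    ((measurable_psum hG hy K).const_mul r).exp (Real.exp_pos _).le (Real.exp_pos _) ?_)
  clear hsub
  induction K with
  | zero => simp [psum]
  | succ K ih =>
    refine (lintegral_psum_succ_le hG hy K (φ := fun m => ENNReal.ofReal (Real.exp (r * m)))
      (ψ := fun m => ENNReal.ofReal (Real.exp (r * m)) * ENNReal.ofReal (Real.exp (c K)))
      (by fun_prop) fun x hx m => ?_).trans ?_
    · simp_rw [mul_add, Real.exp_add, ENNReal.ofReal_mul (Real.exp_pos _).le]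
      rw [lintegral_const_mul' _ _ ENNReal.ofReal_ne_top]
      gcongr
      exact hle K x hx
    · rw [lintegral_mul_const' _ _ ENNReal.ofReal_ne_top,
        Finset.sum_range_succ, Real.exp_add, ENNReal.ofReal_mul (Real.exp_pos _).le]
      gcongr

end Run

/-! ### The optimality gap of the averaged iterate -/

/-- The variational inequality of the projection leaves `2γ‖g‖‖x - p‖ - ‖x - p‖²`. Completing the
square gives the first entry of the minimum and `‖x - p‖ ≤ D` the second, which is linear in `‖g‖`
as the sub-Gaussian estimate requires. -/
lemma IsProj.sq_dist_le {n : ℕ} {X : Set (E n)} (hX : Convex ℝ X) {x g p q : E n} {γ D : ℝ}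
    (hγ : 0 ≤ γ) (hp : IsProj X (x - γ • g) p) (hq : q ∈ X) (hD : ‖x - p‖ ≤ D) :
    ‖p - q‖ ^ 2 ≤ ‖x - q‖ ^ 2 - 2 * γ * inner ℝ g (x - q) +
      min (γ ^ 2 * ‖g‖ ^ 2) (2 * γ * D * ‖g‖) := by
  have h1 := hp.inner_le hX hq
  have h2 : ‖p - q‖ ^ 2 = ‖x - q‖ ^ 2 - 2 * γ * inner ℝ g (x - q) + 2 * γ * inner ℝ g (x - p)
      - ‖x - p‖ ^ 2 + 2 * inner ℝ (x - γ • g - p) (q - p) := by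
    simp only [← real_inner_self_eq_norm_sq, inner_sub_left, inner_sub_right, inner_smul_left,
      conj_trivial]
    rw [real_inner_comm x q, real_inner_comm x p, real_inner_comm p q]
    ring
  have h3 := real_inner_le_norm g (x - p)
  have h4 : 2 * γ * inner ℝ g (x - p) ≤ 2 * γ * (‖g‖ * ‖x - p‖) :=
    mul_le_mul_of_nonneg_left h3 (by positivity)
  have h5 : 2 * γ * (‖g‖ * ‖x - p‖) - ‖x - p‖ ^ 2 ≤ min (γ ^ 2 * ‖g‖ ^ 2) (2 * γ * D * ‖g‖) := by
    refine le_min ?_ ?_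
    · nlinarith [sq_nonneg (γ * ‖g‖ - ‖x - p‖)]
    · have : 2 * γ * (‖g‖ * ‖x - p‖) ≤ 2 * γ * (‖g‖ * D) := by gcongr
      nlinarith [sq_nonneg ‖x - p‖]
  linarith

namespace Run

variable {n : ℕ} {R : Run.{u, w} n} {L₀ : ℝ}

lemma norm_sub_le_DX {x y : E n} (hx : x ∈ R.X) (hy : y ∈ R.X) : ‖x - y‖ ≤ R.DX := by
  rw [← dist_eq_norm]
  exact Metric.dist_le_diam_of_mem R.bounded_X hx hy

lemma DX_nonneg (R : Run.{u, w} n) : 0 ≤ R.DX := Metric.diam_nonneg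

lemma sumγ_pos {K : ℕ} (hK : 1 ≤ K) : 0 < R.sumγ K :=
  Finset.sum_pos (fun k _ => R.γ_pos k) ⟨0, by simp; omega⟩

lemma cK_pos {K : ℕ} (hK : 1 ≤ K) : 0 < R.cK K :=
  Finset.sum_pos (fun k _ => pow_pos (R.γ_pos k) 2) ⟨0, by simp; omega⟩

lemma cn_pos (hn : 1 ≤ n) (hL₀ : 0 < L₀) : 0 < cn n L₀ := by
  have : (0 : ℝ) < n := by exact_mod_cast hn
  unfold cn; positivity

lemma bias_nonneg (R : Run.{u, w} n) (hL₀ : 0 ≤ L₀) (K : ℕ) : 0 ≤ R.bias L₀ K :=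
  Finset.sum_nonneg fun k _ => by
    have := R.γ_pos k
    have := R.η_pos k
    positivity

/-- The martingale part of the error of iteration `k`. -/
def errA (R : Run.{u, w} n) (k : ℕ) (x : E n) (s : ℝ × E n × R.Θ) : ℝ :=
  2 * R.γ k * inner ℝ (meanGrad R.G R.Q (R.η k) x - R.grad k x s) (x - R.xstar)

/-- The squared step of iteration `k`. -/
def errB (R : Run.{u, w} n) (k : ℕ) (x : E n) (s : ℝ × E n × R.Θ) : ℝ :=
  R.γ k ^ 2 * ‖R.grad k x s‖ ^ 2

/-- The squared step of iteration `k`, truncated in view of the boundedness of `X`. -/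
def errC (R : Run.{u, w} n) (k : ℕ) (x : E n) (s : ℝ × E n × R.Θ) : ℝ :=
  min (R.γ k ^ 2 * ‖R.grad k x s‖ ^ 2) (2 * R.γ k * R.DX * ‖R.grad k x s‖)

lemma avg_eq_centerMass (K : ℕ) (ω : R.Ω) :
    R.avg K ω = (Finset.range K).centerMass R.γ (fun k => R.x k ω) := rfl

lemma avg_mem {K : ℕ} (hK : 1 ≤ K) (ω : R.Ω) : R.avg K ω ∈ R.X := by
  rw [avg_eq_centerMass]
  exact R.convex_X.centerMass_mem (fun k _ => (R.γ_pos k).le) (sumγ_pos hK) fun k _ => R.x_mem k ω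

lemma errA_eq (k : ℕ) (x : E n) (s : ℝ × E n × R.Θ) :
    R.errA k x s = 2 * R.γ k * (inner ℝ (meanGrad R.G R.Q (R.η k) x) (x - R.xstar) -
      inner ℝ (R.grad k x s) (x - R.xstar)) := by
  rw [errA, inner_sub_left]

section WithOracle

variable (O : ConvexOracle L₀ R.Q R.G R.f)

include O

/-- Jensen's inequality passes from the average to the iterates; at each of them the mean estimator
is an approximate subgradient, and replacing it by the realized one costs `errA`. The squared
distances to `xstar` telescope. The smoothing error `√n` is relaxed to `√(n+1)`. -/
lemma two_sumγ_mul_gap_le (hL₀ : 0 ≤ L₀) {K : ℕ} (hK : 1 ≤ K) (ω : R.Ω) :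
    2 * R.sumγ K * (R.f (R.avg K ω) - R.f R.xstar) ≤
      R.DX ^ 2 + R.bias L₀ K + R.psum R.errA K ω + R.psum R.errC K ω := by
  have hpos := sumγ_pos (R := R) hK
  have hJ : R.sumγ K * R.f (R.avg K ω) ≤ ∑ k ∈ Finset.range K, R.γ k * R.f (R.x k ω) := by
    have := O.convex.map_centerMass_le (t := Finset.range K) (w := R.γ) (p := fun k => R.x k ω)
      (fun k _ => (R.γ_pos k).le) hpos fun k _ => mem_univ _
    rw [← avg_eq_centerMass, Finset.centerMass, smul_eq_mul] at this
    calc R.sumγ K * R.f (R.avg K ω) ≤ R.sumγ K * ((R.sumγ K)⁻¹ * _) :=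
          mul_le_mul_of_nonneg_left this hpos.le
      _ = _ := by
        rw [mul_inv_cancel_left₀ hpos.ne']
        rfl
  have hstep : ∀ k, 2 * R.γ k * (R.f (R.x k ω) - R.f R.xstar) ≤
      (‖R.x k ω - R.xstar‖ ^ 2 - ‖R.x (k + 1) ω - R.xstar‖ ^ 2) +
        2 * L₀ * √((n : ℝ) + 1) * R.γ k * R.η k +
        (R.errA k (R.x k ω) (R.noise k ω) + R.errC k (R.x k ω) (R.noise k ω)) := by
    intro k
    have hγ := R.γ_pos k
    have hη := R.η_pos k
    have h1 := (R.step k ω).sq_dist_le R.convex_X hγ.le R.xstar_mem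
      (norm_sub_le_DX (R.x_mem k ω) (R.x_mem (k + 1) ω))
    have h2 := O.meanGrad_subgradient hL₀ hη (R.x k ω) R.xstar
    have h3 : √(n : ℝ) ≤ √((n : ℝ) + 1) := Real.sqrt_le_sqrt (by linarith)
    have h4 : L₀ * (R.η k * √(n : ℝ)) ≤ L₀ * (R.η k * √((n : ℝ) + 1)) := by gcongr
    have h5 : R.errA k (R.x k ω) (R.noise k ω) =
        2 * R.γ k * inner ℝ (meanGrad R.G R.Q (R.η k) (R.x k ω)) (R.x k ω - R.xstar) -
        2 * R.γ k * inner ℝ (R.grad k (R.x k ω) (R.noise k ω)) (R.x k ω - R.xstar) := by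
      rw [errA, inner_sub_left]; ring
    rw [h5]
    have h6 : 2 * R.γ k * (R.f (R.x k ω) - R.f R.xstar - L₀ * (R.η k * √((n : ℝ) + 1))) ≤
        2 * R.γ k * inner ℝ (meanGrad R.G R.Q (R.η k) (R.x k ω)) (R.x k ω - R.xstar) := by
      refine mul_le_mul_of_nonneg_left ?_ (by positivity)
      linarith
    simp only [errC, grad, noise]
    linarith
  have hsum := Finset.sum_le_sum fun k (_ : k ∈ Finset.range K) => hstep k
  rw [Finset.sum_add_distrib, Finset.sum_add_distrib, Finset.sum_add_distrib,
    Finset.sum_range_sub' (fun k => ‖R.x k ω - R.xstar‖ ^ 2)] at hsum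
  have h0 : ‖R.x 0 ω - R.xstar‖ ^ 2 ≤ R.DX ^ 2 :=
    pow_le_pow_left₀ (norm_nonneg _) (norm_sub_le_DX (R.x_mem 0 ω) R.xstar_mem) 2
  have hl : ∑ k ∈ Finset.range K, 2 * R.γ k * (R.f (R.x k ω) - R.f R.xstar) =
      2 * ∑ k ∈ Finset.range K, R.γ k * R.f (R.x k ω) - 2 * R.sumγ K * R.f R.xstar := by
    rw [sumγ, Finset.mul_sum, Finset.mul_sum, Finset.sum_mul, ← Finset.sum_sub_distrib]
    exact Finset.sum_congr rfl fun k _ => by ring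
  rw [hl] at hsum
  unfold psum bias
  nlinarith [sq_nonneg ‖R.x K ω - R.xstar‖]

/-- The gap is at most `L₀ D_X`, so that larger values have probability zero. -/
lemma tail_eq_zero (hL₀ : 0 ≤ L₀) {K : ℕ} (hK : 1 ≤ K) {t : ℝ} (ht : L₀ * R.DX < t) :
    R.tail K t = 0 := by
  have : {ω | t ≤ R.f (R.avg K ω) - R.f R.xstar} = ∅ := by
    refine eq_empty_of_forall_notMem fun ω hω => ?_
    have h1 := (abs_le.1 (O.lipschitz_objective hL₀ (R.avg K ω) R.xstar)).2
    have h2 := mul_le_mul_of_nonneg_left (norm_sub_le_DX (avg_mem hK ω) R.xstar_mem) hL₀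
    have : t ≤ R.f (R.avg K ω) - R.f R.xstar := hω
    linarith
  rw [tail, this, measureReal_empty]

lemma tail_le_sum (hL₀ : 0 ≤ L₀) {K : ℕ} (hK : 1 ≤ K) {a t : ℝ}
    (ht : R.DX ^ 2 + R.bias L₀ K + a ≤ t * (2 * R.sumγ K)) :
    R.tail K t ≤ R.P.real {ω | a ≤ R.psum R.errA K ω + R.psum R.errC K ω} := by
  refine measureReal_mono fun ω hω => ?_
  have h1 := two_sumγ_mul_gap_le O hL₀ hK ω
  have h2 : t ≤ R.f (R.avg K ω) - R.f R.xstar := hω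
  have h3 := mul_le_mul_of_nonneg_left h2 (mul_pos two_pos (sumγ_pos (R := R) hK)).le
  simp only [mem_ofPred_eq]
  nlinarith

lemma tail_le_add (hL₀ : 0 ≤ L₀) {K : ℕ} (hK : 1 ≤ K) {a b t : ℝ}
    (ht : R.DX ^ 2 + R.bias L₀ K + (a + b) ≤ t * (2 * R.sumγ K)) :
    R.tail K t ≤ R.P.real {ω | a ≤ R.psum R.errA K ω} + R.P.real {ω | b ≤ R.psum R.errB K ω} := by
  refine (tail_le_sum O hL₀ hK ht).trans ?_
  refine (measureReal_mono fun ω hω => ?_).trans (measureReal_union_le _ _)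
  have h1 : a + b ≤ R.psum R.errA K ω + R.psum R.errC K ω := hω
  have h2 : R.psum R.errC K ω ≤ R.psum R.errB K ω :=
    Finset.sum_le_sum fun k _ => min_le_left _ _
  by_contra h
  simp only [mem_union, mem_ofPred_eq, not_or, not_le] at h
  linarith [h.1, h.2]

/-! ### Moments of the error terms and the Markov-Chebyshev bound -/

lemma measurable_meanGrad (k : ℕ) : Measurable (meanGrad R.G R.Q (R.η k)) :=
  ((R.measurable_grad O.measurable k).stronglyMeasurable.integral_prod_right
    (ν := R.noiseLaw k)).measurable

lemma measurable_errA (k : ℕ) :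
    Measurable (fun p : E n × (ℝ × E n × R.Θ) => R.errA k p.1 p.2) := by
  have h1 := measurable_meanGrad O k
  have h2 := R.measurable_grad O.measurable k
  unfold errA
  fun_prop

lemma measurable_errB (k : ℕ) :
    Measurable (fun p : E n × (ℝ × E n × R.Θ) => R.errB k p.1 p.2) := by
  have h2 := R.measurable_grad O.measurable k
  unfold errB
  fun_prop

lemma measurable_errC (k : ℕ) :
    Measurable (fun p : E n × (ℝ × E n × R.Θ) => R.errC k p.1 p.2) := by
  have h2 := R.measurable_grad O.measurable k
  unfold errC
  fun_prop

lemma memLp_grad (hL₀ : 0 ≤ L₀) (k : ℕ) (x : E n) : MemLp (R.grad k x) 2 (R.noiseLaw k) :=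
  O.memLp_gradEst hL₀ (R.η_pos k) x

lemma memLp_inner_grad (hL₀ : 0 ≤ L₀) (k : ℕ) (x : E n) :
    MemLp (fun s => inner ℝ (R.grad k x s) (x - R.xstar)) 2 (R.noiseLaw k) := by
  have h := memLp_grad O hL₀ k x
  refine h.norm.of_le_mul (c := ‖x - R.xstar‖) ?_ (ae_of_all _ fun s => ?_)
  · exact h.aestronglyMeasurable.inner aestronglyMeasurable_const
  · rw [norm_norm, mul_comm]
    exact norm_inner_le_norm _ _

lemma integral_inner_grad (hL₀ : 0 ≤ L₀) (k : ℕ) (x : E n) :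
    ∫ s, inner ℝ (R.grad k x s) (x - R.xstar) ∂(R.noiseLaw k) =
      inner ℝ (meanGrad R.G R.Q (R.η k) x) (x - R.xstar) := by
  have h := (memLp_grad O hL₀ k x).integrable (by norm_num)
  rw [← real_inner_comm (meanGrad R.G R.Q (R.η k) x)]
  simp_rw [fun s => real_inner_comm (x - R.xstar) (R.grad k x s)]
  exact integral_inner h (x - R.xstar)

lemma memLp_errA (hL₀ : 0 ≤ L₀) (k : ℕ) (x : E n) : MemLp (R.errA k x) 2 (R.noiseLaw k) := by
  have h := ((memLp_const (inner ℝ (meanGrad R.G R.Q (R.η k) x) (x - R.xstar))).sub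
    (memLp_inner_grad O hL₀ k x)).const_mul (2 * R.γ k)
  rw [funext (errA_eq k x)]
  exact h

lemma integral_errA (hL₀ : 0 ≤ L₀) (k : ℕ) (x : E n) :
    ∫ s, R.errA k x s ∂(R.noiseLaw k) = 0 := by
  simp_rw [errA_eq k x]
  rw [integral_const_mul, integral_sub (integrable_const _)
    ((memLp_inner_grad O hL₀ k x).integrable (by norm_num)), integral_inner_grad O hL₀]
  simp

lemma integral_errA_sq_le (hL₀ : 0 ≤ L₀) (k : ℕ) {x : E n} (hx : x ∈ R.X) :
    ∫ s, R.errA k x s ^ 2 ∂(R.noiseLaw k) ≤ 4 * R.DX ^ 2 * cn n L₀ * R.γ k ^ 2 := by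
  set c := inner ℝ (meanGrad R.G R.Q (R.η k) x) (x - R.xstar) with hc
  set h : ℝ × E n × R.Θ → ℝ := fun s => inner ℝ (R.grad k x s) (x - R.xstar) with hh
  have hLp : MemLp h 2 (R.noiseLaw k) := memLp_inner_grad O hL₀ k x
  have i1 := hLp.integrable (by norm_num : (1 : ℝ≥0∞) ≤ 2)
  have i2 := hLp.integrable_sq
  have i3 : Integrable (fun s => c ^ 2 - 2 * c * h s) (R.noiseLaw k) :=
    (integrable_const _).sub (i1.const_mul _)
  have e : ∀ s, R.errA k x s ^ 2 = 4 * R.γ k ^ 2 * ((c ^ 2 - 2 * c * h s) + h s ^ 2) := fun s => by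
    rw [errA_eq]; ring
  simp_rw [e]
  rw [integral_const_mul, integral_add i3 i2, integral_sub (integrable_const _) (i1.const_mul _),
    integral_const_mul, integral_inner_grad O hL₀, integral_const, probReal_univ, one_smul]
  have h3 : ∫ s, h s ^ 2 ∂(R.noiseLaw k) ≤ R.DX ^ 2 * cn n L₀ := by
    calc ∫ s, h s ^ 2 ∂(R.noiseLaw k)
        ≤ ∫ s, R.DX ^ 2 * ‖R.grad k x s‖ ^ 2 ∂(R.noiseLaw k) := by
          refine integral_mono i2
            ((memLp_grad O hL₀ k x).norm.integrable_sq.const_mul _) fun s => ?_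
          simp only
          rw [← sq_abs, ← mul_pow]
          refine pow_le_pow_left₀ (abs_nonneg _) ?_ 2
          refine (abs_real_inner_le_norm _ _).trans ?_
          rw [mul_comm]
          gcongr
          exact norm_sub_le_DX hx R.xstar_mem
      _ = R.DX ^ 2 * ∫ s, ‖R.grad k x s‖ ^ 2 ∂(R.noiseLaw k) := integral_const_mul _ _
      _ ≤ _ := by
          gcongr
          exact O.integral_norm_sq_gradEst_le hL₀ (R.η_pos k) x
  -- A variance is at most the second moment.
  have h4 : c ^ 2 - 2 * c * c + ∫ s, h s ^ 2 ∂(R.noiseLaw k) ≤ R.DX ^ 2 * cn n L₀ := by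
    nlinarith [sq_nonneg c]
  calc _ ≤ 4 * R.γ k ^ 2 * (R.DX ^ 2 * cn n L₀) := by gcongr
    _ = _ := by ring

lemma lintegral_errB_le (hL₀ : 0 ≤ L₀) (k : ℕ) (x : E n) :
    ∫⁻ s, ENNReal.ofReal (R.errB k x s) ∂(R.noiseLaw k) ≤
      ENNReal.ofReal (cn n L₀ * R.γ k ^ 2) := by
  simp_rw [errB, ENNReal.ofReal_mul (sq_nonneg _)]
  rw [lintegral_const_mul' _ _ ENNReal.ofReal_ne_top, mul_comm (cn n L₀),
    ENNReal.ofReal_mul (sq_nonneg _)]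
  gcongr
  exact O.lintegral_norm_sq_gradEst_le hL₀ (R.η_pos k) x

/-- The Markov-Chebyshev tail bound. -/
lemma tail_le_markov (hn : 1 ≤ n) (hL₀ : 0 < L₀) {K : ℕ} (hK : 1 ≤ K) {l : ℝ} (hl : 0 < l) :
    R.tail K ((R.DX ^ 2 + R.bias L₀ K + l * (R.IA L₀ K + R.IB L₀ K)) / (2 * R.sumγ K)) ≤
      1 / l + 1 / l ^ 2 := by
  have hs := sumγ_pos (R := R) hK
  have hc := cK_pos (R := R) hK
  have hcn := cn_pos hn hL₀
  have hb := R.bias_nonneg hL₀.le K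
  have hIB : R.IB L₀ K = cn n L₀ * R.cK K := rfl
  have hIBpos : 0 < R.IB L₀ K := by rw [hIB]; positivity
  have hIA0 : 0 ≤ R.IA L₀ K := Real.sqrt_nonneg _
  -- If `X` is a single point, then `IA = 0` and Chebyshev's inequality has no positive level to
  -- use, but the gap vanishes.
  rcases R.DX_nonneg.eq_or_lt with hD | hD
  · rw [tail_eq_zero O hL₀.le hK]
    · positivity
    · rw [← hD]
      have : 0 < l * (R.IA L₀ K + R.IB L₀ K) := by positivity
      simp only [mul_zero]
      positivity
  have hIA2 : R.IA L₀ K ^ 2 = 8 * (1 + 4 * (n : ℝ) / Real.pi) * R.DX ^ 2 * L₀ ^ 2 * R.cK K := by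
    rw [IA, Real.sq_sqrt]
    · rfl
    · exact mul_nonneg (by positivity) hc.le
  have hIApos : 0 < R.IA L₀ K := by
    have : 0 < R.IA L₀ K ^ 2 := by rw [hIA2]; positivity
    nlinarith
  refine (tail_le_add O hL₀.le hK (a := l * R.IA L₀ K) (b := l * R.IB L₀ K) ?_).trans ?_
  · rw [div_mul_cancel₀ _ (by positivity)]
    linarith
  rw [add_comm]
  refine add_le_add ?_ ?_
  · refine (real_psum_ge_le_of_nonneg O.measurable (measurable_errB O)
      (c := fun k => cn n L₀ * R.γ k ^ 2) (fun k => by positivity)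
      (fun k x _ => lintegral_errB_le O hL₀.le k x) K (by positivity)).trans (le_of_eq ?_)
    rw [← Finset.mul_sum, hIB, cK]
    rw [cK] at hc
    field_simp
  · refine (real_psum_ge_le_of_centered O.measurable (measurable_errA O)
      (c := fun k => 4 * R.DX ^ 2 * cn n L₀ * R.γ k ^ 2) (fun k x _ => memLp_errA O hL₀.le k x)
      (fun k x _ => integral_errA O hL₀.le k x)
      (fun k x hx => integral_errA_sq_le O hL₀.le k hx) K (by positivity)).trans ?_
    rw [← Finset.mul_sum, mul_pow, div_le_div_iff₀ (by positivity) (by positivity), hIA2]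
    change 4 * R.DX ^ 2 * cn n L₀ * R.cK K * l ^ 2 ≤ _
    have h1 : 0 ≤ R.DX ^ 2 * R.cK K * l ^ 2 := by positivity
    -- The variance is `4 D_X² c_n c_K` at most, so `IA²` is more than needed.
    have h2 : 4 * cn n L₀ ≤ 8 * (1 + 4 * (n : ℝ) / Real.pi) * L₀ ^ 2 := by
      have h3 : 8 * (1 + 4 * (n : ℝ) / Real.pi) * L₀ ^ 2 - 4 * cn n L₀ =
          8 * L₀ ^ 2 + 16 * n * L₀ ^ 2 / Real.pi := by
        unfold cn; ring
      have : 0 ≤ 8 * L₀ ^ 2 + 16 * n * L₀ ^ 2 / Real.pi := by positivity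
      linarith
    nlinarith [mul_le_mul_of_nonneg_left h2 h1]

end WithOracle

end Run

/-! ### Exponential moments -/

/-- The linear term integrates to zero for a centered variable, so the exponential moment is
controlled by that of the square. For `|x| ≤ 1` it follows from `exp x ≤ 1 + x + x²`. -/
lemma exp_le_add_exp_sq (x : ℝ) : Real.exp x ≤ x + Real.exp (x ^ 2) := by
  have h2 := Real.add_one_le_exp (x ^ 2)
  rcases le_total |x| 1 with h | h
  · have := Real.abs_exp_sub_one_sub_id_le h
    have := (abs_le.1 this).2
    linarith
  · rcases le_abs'.1 h with h' | h'
    · have h3 : Real.exp x ≤ 1 := Real.exp_le_one_iff.2 (by linarith)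
      nlinarith
    · have : Real.exp x ≤ Real.exp (x ^ 2) := Real.exp_le_exp.2 (by nlinarith)
      linarith

lemma one_div_one_sub_le_exp {t : ℝ} (h0 : 0 ≤ t) (h1 : t ≤ 1 / 2) :
    1 / (1 - t) ≤ Real.exp (2 * t) := by
  rw [div_le_iff₀ (by linarith)]
  have := Real.add_one_le_exp (2 * t)
  nlinarith

section Moments

variable {α : Type*} [MeasurableSpace α] {μ : Measure α} {X : α → ℝ}

lemma lintegral_exp_le_of_centered (hX : Integrable X μ) (h0 : ∫ a, X a ∂μ = 0) :
    ∫⁻ a, ENNReal.ofReal (Real.exp (X a)) ∂μ ≤ ∫⁻ a, ENNReal.ofReal (Real.exp (X a ^ 2)) ∂μ := by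
  by_cases hfin : ∫⁻ a, ENNReal.ofReal (Real.exp (X a ^ 2)) ∂μ = ∞
  · rw [hfin]; exact le_top
  have hi : Integrable (fun a => Real.exp (X a ^ 2)) μ := by
    refine ⟨Real.continuous_exp.comp_aestronglyMeasurable (hX.aestronglyMeasurable.pow 2), ?_⟩
    rw [hasFiniteIntegral_iff_ofReal (ae_of_all _ fun _ => (Real.exp_pos _).le)]
    exact lt_top_iff_ne_top.2 hfin
  have hXi : Integrable (fun a => X a + Real.exp (X a ^ 2)) μ := hX.add hi
  calc ∫⁻ a, ENNReal.ofReal (Real.exp (X a)) ∂μ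
      ≤ ∫⁻ a, ENNReal.ofReal (X a + Real.exp (X a ^ 2)) ∂μ :=
        lintegral_mono fun a => ENNReal.ofReal_le_ofReal (exp_le_add_exp_sq _)
    _ = ∫⁻ a, ENNReal.ofReal (Real.exp (X a ^ 2)) ∂μ := by
        rw [← ofReal_integral_eq_lintegral_ofReal hXi
          (ae_of_all _ fun a => (Real.exp_pos _).le.trans (exp_le_add_exp_sq _)),
          integral_add hX hi, h0, zero_add,
          ofReal_integral_eq_lintegral_ofReal hi (ae_of_all _ fun a => (Real.exp_pos _).le)]

/-- A centered variable dominated by `β (1 + √V)`, where `V` has the exponential moments of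
`Exp(1)`, is sub-Gaussian. -/
lemma lintegral_exp_le_of_abs_le {V : α → ℝ} {β : ℝ} (hβ : 0 ≤ β) (hX : Integrable X μ)
    (h0 : ∫ a, X a ∂μ = 0) (hV : ∀ᵐ a ∂μ, 0 ≤ V a)
    (hVexp : ∀ c < 1, ∫⁻ a, ENNReal.ofReal (Real.exp (c * V a)) ∂μ ≤ ENNReal.ofReal (1 / (1 - c)))
    (hXV : ∀ᵐ a ∂μ, |X a| ≤ β * (1 + √(V a))) :
    ∫⁻ a, ENNReal.ofReal (Real.exp (X a)) ∂μ ≤ ENNReal.ofReal (Real.exp (6 * β ^ 2)) := by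
  -- For small `β`, centering is used and `X² ≤ 2β²(1 + V)`; the moment of `V` at `2β² ≤ 1/2` costs
  -- `4β²`, in total `6β²`.
  rcases le_total (β ^ 2) (1 / 4) with hb | hb
  · calc ∫⁻ a, ENNReal.ofReal (Real.exp (X a)) ∂μ
        ≤ ∫⁻ a, ENNReal.ofReal (Real.exp (X a ^ 2)) ∂μ := lintegral_exp_le_of_centered hX h0
      _ ≤ ∫⁻ a, ENNReal.ofReal (Real.exp (2 * β ^ 2)) *
            ENNReal.ofReal (Real.exp (2 * β ^ 2 * V a)) ∂μ := by
          refine lintegral_mono_ae ?_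
          filter_upwards [hV, hXV] with a hVa hXa
          rw [← ENNReal.ofReal_mul (Real.exp_pos _).le, ← Real.exp_add]
          refine ENNReal.ofReal_le_ofReal (Real.exp_le_exp.2 ?_)
          have h1 : X a ^ 2 ≤ (β * (1 + √(V a))) ^ 2 := by
            rw [← sq_abs]; exact pow_le_pow_left₀ (abs_nonneg _) hXa 2
          have h2 : (1 + √(V a)) ^ 2 ≤ 2 * (1 + V a) := by
            nlinarith [Real.sq_sqrt hVa, sq_nonneg (1 - √(V a))]
          calc X a ^ 2 ≤ β ^ 2 * (1 + √(V a)) ^ 2 := by rw [← mul_pow]; exact h1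
            _ ≤ β ^ 2 * (2 * (1 + V a)) := by gcongr
            _ = _ := by ring
      _ ≤ ENNReal.ofReal (Real.exp (2 * β ^ 2)) * ENNReal.ofReal (Real.exp (2 * (2 * β ^ 2))) := by
          rw [lintegral_const_mul' _ _ ENNReal.ofReal_ne_top]
          gcongr
          exact (hVexp _ (by linarith)).trans (ENNReal.ofReal_le_ofReal
            (one_div_one_sub_le_exp (by positivity) (by linarith)))
      _ = ENNReal.ofReal (Real.exp (6 * β ^ 2)) := by
          rw [← ENNReal.ofReal_mul (Real.exp_pos _).le, ← Real.exp_add]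
          congr 2
          ring
  -- For large `β` centering is not needed: `X ≤ β + β²/2 + V/2`, the moment of `V` at `1/2` is at
  -- most `2`, and `β + β²/2 + log 2 ≤ 6β²` once `β ≥ 1/2`.
  · calc ∫⁻ a, ENNReal.ofReal (Real.exp (X a)) ∂μ
        ≤ ∫⁻ a, ENNReal.ofReal (Real.exp (β + β ^ 2 / 2)) *
            ENNReal.ofReal (Real.exp (1 / 2 * V a)) ∂μ := by
          refine lintegral_mono_ae ?_
          filter_upwards [hV, hXV] with a hVa hXa
          rw [← ENNReal.ofReal_mul (Real.exp_pos _).le, ← Real.exp_add]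
          refine ENNReal.ofReal_le_ofReal (Real.exp_le_exp.2 ?_)
          have := le_abs_self (X a)
          nlinarith [Real.sq_sqrt hVa, sq_nonneg (β - √(V a))]
      _ ≤ ENNReal.ofReal (Real.exp (β + β ^ 2 / 2)) * ENNReal.ofReal (Real.exp (Real.log 2)) := by
          rw [lintegral_const_mul' _ _ ENNReal.ofReal_ne_top]
          gcongr
          refine (hVexp _ (by norm_num)).trans (ENNReal.ofReal_le_ofReal ?_)
          rw [Real.exp_log two_pos]
          norm_num
      _ ≤ ENNReal.ofReal (Real.exp (6 * β ^ 2)) := by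
          rw [← ENNReal.ofReal_mul (Real.exp_pos _).le, ← Real.exp_add]
          refine ENNReal.ofReal_le_ofReal (Real.exp_le_exp.2 ?_)
          have h1 := Real.log_two_lt_d9
          have h2 : 1 / 2 ≤ β := by nlinarith
          nlinarith

end Moments

section SubGaussian

variable {n : ℕ} {Θ : Type u} [MeasurableSpace Θ] {L₀ : ℝ} {Q : Measure Θ} {G : E n → Θ → ℝ}
  {f : E n → ℝ}

/-- Jensen's inequality for the power `τ ≤ 1`, in the form of the pointwise convexity bound `exp(τ(t
- a)) ≤ 1 - τ + τ exp(t - a)`. -/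
lemma SubGaussianIncrements.lintegral_exp_mul_le [IsProbabilityMeasure Q]
    (h : SubGaussianIncrements L₀ Q G) {τ : ℝ} (h0 : 0 ≤ τ) (h1 : τ ≤ 1) (x y : E n) :
    ∫⁻ θ, ENNReal.ofReal (Real.exp (τ * (G x θ - G y θ) ^ 2)) ∂Q ≤
      ENNReal.ofReal (Real.exp (τ * (L₀ ^ 2 * ‖x - y‖ ^ 2))) := by
  set a := L₀ ^ 2 * ‖x - y‖ ^ 2
  have key : ∀ t : ℝ, Real.exp (τ * t) ≤
      Real.exp (τ * a) * (1 - τ) + Real.exp (τ * a) * τ * Real.exp (-a) * Real.exp t := by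
    intro t
    have hc := convexOn_exp.2 (mem_univ 0) (mem_univ (t - a)) (by linarith : 0 ≤ 1 - τ) h0 (by ring)
    simp only [smul_eq_mul, mul_zero, zero_add, Real.exp_zero, mul_one] at hc
    calc Real.exp (τ * t) = Real.exp (τ * a) * Real.exp (τ * (t - a)) := by
          rw [← Real.exp_add]; congr 1; ring
      _ ≤ Real.exp (τ * a) * (1 - τ + τ * Real.exp (t - a)) := by gcongr
      _ = _ := by rw [sub_eq_add_neg t a, Real.exp_add]; ring
  have hp1 : 0 ≤ Real.exp (τ * a) * (1 - τ) := mul_nonneg (Real.exp_pos _).le (by linarith)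
  have hp2 : 0 ≤ Real.exp (τ * a) * τ * Real.exp (-a) := by positivity
  calc ∫⁻ θ, ENNReal.ofReal (Real.exp (τ * (G x θ - G y θ) ^ 2)) ∂Q
      ≤ ∫⁻ θ, (ENNReal.ofReal (Real.exp (τ * a) * (1 - τ)) +
          ENNReal.ofReal (Real.exp (τ * a) * τ * Real.exp (-a)) *
            ENNReal.ofReal (Real.exp ((G x θ - G y θ) ^ 2))) ∂Q := by
        refine lintegral_mono fun θ => ?_
        rw [← ENNReal.ofReal_mul hp2, ← ENNReal.ofReal_add hp1
          (mul_nonneg hp2 (Real.exp_pos _).le)]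
        exact ENNReal.ofReal_le_ofReal (key _)
    _ ≤ ENNReal.ofReal (Real.exp (τ * a) * (1 - τ)) +
          ENNReal.ofReal (Real.exp (τ * a) * τ * Real.exp (-a)) *
            ENNReal.ofReal (Real.exp a) := by
        rw [lintegral_add_left measurable_const, lintegral_const, measure_univ, mul_one,
          lintegral_const_mul' _ _ ENNReal.ofReal_ne_top]
        gcongr
        exact h x y
    _ = ENNReal.ofReal (Real.exp (τ * a)) := by
        rw [← ENNReal.ofReal_mul hp2, ← ENNReal.ofReal_add hp1
          (mul_nonneg hp2 (Real.exp_pos _).le)]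
        congr 1
        have : Real.exp (-a) * Real.exp a = 1 := by rw [← Real.exp_add]; simp
        linear_combination Real.exp (τ * a) * τ * this

/-- Exponential moments of the squared gradient estimator in the sub-Gaussian case. -/
lemma ConvexOracle.lintegral_exp_norm_sq_gradEst_le [IsProbabilityMeasure Q]
    (O : ConvexOracle L₀ Q G f) (h : SubGaussianIncrements L₀ Q G) (hn : 1 ≤ n) {η σ : ℝ}
    (hη : 0 < η) (hσ : 0 ≤ σ) (h1 : σ * n ≤ 2 * Real.pi) (h2 : σ * cn n L₀ * η ^ 2 ≤ 1 / 2)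
    (x : E n) :
    ∫⁻ s, ENNReal.ofReal (Real.exp (σ * (η ^ 2 * ‖gradEst G η x s.1 s.2.1 s.2.2‖ ^ 2)))
      ∂(sampleLaw n η Q) ≤ ENNReal.ofReal (Real.exp (2 * (σ * cn n L₀ * η ^ 2))) := by
  have hm : Measurable (fun s : ℝ × E n × Θ => gradEst G η x s.1 s.2.1 s.2.2) :=
    (measurable_gradEst O.measurable η).comp (measurable_const.prodMk measurable_id)
  have hn0 : (0 : ℝ) < n := by exact_mod_cast hn
  have hcn : 0 ≤ cn n L₀ := by unfold cn; positivity
  -- Chosen so that `σ η² ‖g‖²` is the average over the coordinates of `τ` times the squared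
  -- increments. Convexity of `exp` then separates the coordinates, whose joint law is not
  -- controlled.
  set τ := σ * n / (2 * Real.pi) with hτ
  have hτ0 : 0 ≤ τ := by positivity
  have hτ1 : τ ≤ 1 := by rw [hτ, div_le_one (by positivity)]; exact h1
  refine (lintegral_sampleLaw_le η
    (h := fun v => ENNReal.ofReal (Real.exp (σ * cn n L₀ * η ^ 2 * v)))
    (by fun_prop) fun v hv z => ?_).trans ?_
  · set Δ : Fin n → Θ → ℝ := fun i θ => G (shift x i (η * √(2 * v)) z) θ -
        G (shift x i (-(η * √(2 * v))) z) θ with hΔ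
    have hΔm : ∀ i, Measurable (Δ i) := fun i => (O.measurable_apply _).sub (O.measurable_apply _)
    have hjensen : ∀ θ, Real.exp (σ * (η ^ 2 * ‖gradEst G η x v z θ‖ ^ 2)) ≤
        ∑ i, (n : ℝ)⁻¹ * Real.exp (τ * Δ i θ ^ 2) := by
      intro θ
      have := convexOn_exp.map_sum_le (t := Finset.univ) (w := fun _ : Fin n => (n : ℝ)⁻¹)
        (p := fun i => τ * Δ i θ ^ 2) (fun _ _ => by positivity)
        (by simp [hn0.ne']) fun _ _ => mem_univ _
      simp only [smul_eq_mul] at this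
      refine le_trans (le_of_eq ?_) this
      congr 1
      rw [norm_sq_gradEst, Finset.mul_sum, Finset.mul_sum]
      refine Finset.sum_congr rfl fun i _ => ?_
      rw [hτ, hΔ]
      field_simp
    calc ∫⁻ θ, ENNReal.ofReal (Real.exp (σ * (η ^ 2 * ‖gradEst G η x v z θ‖ ^ 2))) ∂Q
        ≤ ∫⁻ θ, ∑ i, ENNReal.ofReal (n : ℝ)⁻¹ * ENNReal.ofReal (Real.exp (τ * Δ i θ ^ 2)) ∂Q := by
          refine lintegral_mono fun θ => ?_
          refine (ENNReal.ofReal_le_ofReal (hjensen θ)).trans (le_of_eq ?_)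
          rw [ENNReal.ofReal_sum_of_nonneg fun i _ => by positivity]
          exact Finset.sum_congr rfl fun i _ => ENNReal.ofReal_mul (by positivity)
      _ = ∑ i, ENNReal.ofReal (n : ℝ)⁻¹ * ∫⁻ θ, ENNReal.ofReal (Real.exp (τ * Δ i θ ^ 2)) ∂Q := by
          rw [lintegral_finsetSum _ fun i _ => by fun_prop]
          exact Finset.sum_congr rfl fun i _ => lintegral_const_mul' _ _ ENNReal.ofReal_ne_top
      _ ≤ ∑ i : Fin n, ENNReal.ofReal (n : ℝ)⁻¹ *
            ENNReal.ofReal (Real.exp (σ * cn n L₀ * η ^ 2 * v)) := by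
          refine Finset.sum_le_sum fun i _ => ?_
          gcongr
          refine (h.lintegral_exp_mul_le hτ0 hτ1 _ _).trans (le_of_eq ?_)
          rw [norm_shift_sub, mul_pow, sq_abs, mul_pow, Real.sq_sqrt (by positivity), hτ, cn]
          congr 2
          field_simp
          ring
      _ = _ := by
          rw [Finset.sum_const, Finset.card_univ, Fintype.card_fin, nsmul_eq_mul, ← mul_assoc,
            ← ENNReal.ofReal_natCast, ← ENNReal.ofReal_mul (by positivity),
            mul_inv_cancel₀ hn0.ne', ENNReal.ofReal_one, one_mul]
  · rw [lintegral_exp_mul_exp_one (by linarith)]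
    exact ENNReal.ofReal_le_ofReal (one_div_one_sub_le_exp (by positivity) h2)

/-! In the standard setting the sub-Gaussian property, which holds at all scales, forces the
integrand to be almost surely Lipschitz. -/

lemma StandardSetting.ae_sub_le [IsProbabilityMeasure Q] (S : StandardSetting L₀ Q G f)
    (h : SubGaussianIncrements L₀ Q G) (hL₀ : 0 ≤ L₀) (x y : E n) :
    ∀ᵐ θ ∂Q, G y θ - G x θ ≤ L₀ * ‖x - y‖ := by
  have hm : ∀ x, Measurable (G x) := fun x =>
    S.measurable.comp (measurable_const.prodMk measurable_id)
  set d := ‖x - y‖ with hd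
  have hzero : ∀ c, L₀ * d < c → Q {θ | c ≤ G y θ - G x θ} = 0 := by
    intro c hc
    have hc0 : 0 < c := lt_of_le_of_lt (by positivity) hc
    set δ := c ^ 2 - (L₀ * d) ^ 2 with hδ
    have hδ0 : 0 < δ := by
      have : (L₀ * d) ^ 2 < c ^ 2 := pow_lt_pow_left₀ hc (by positivity) two_ne_zero
      linarith
    have hN : ∀ N : ℕ, Q.real {θ | c ≤ G y θ - G x θ} ≤ Real.exp (-δ) ^ N := by
      intro N
      rcases Nat.eq_zero_or_pos N with rfl | hN
      · simp
      have hN1 : (1 : ℝ) ≤ N := by exact_mod_cast hN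
      have hN0 : (0 : ℝ) < N := by linarith
      -- Along the ray, convexity multiplies an increment of size `c` by at least `N`, while the
      -- hypothesis at distance `N d` allows only `exp(L₀² N² d²)`. Markov's inequality gives
      -- `exp(-N² δ)`, which vanishes as `N → ∞`.
      set xN : E n := x + (N : ℝ) • (y - x) with hxN
      have hnorm : ‖xN - x‖ = N * d := by
        rw [hxN, add_sub_cancel_left, norm_smul, norm_sub_rev, Real.norm_eq_abs, abs_of_pos hN0]
      have hsub : {θ | c ≤ G y θ - G x θ} ⊆
          {θ | Real.exp ((N * c) ^ 2) ≤ Real.exp ((G xN θ - G x θ) ^ 2)} := by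
        intro θ hθ
        have hθ : c ≤ G y θ - G x θ := hθ
        have hcv := (S.convex θ).2 (mem_univ x) (mem_univ xN)
          (by have := inv_le_one_of_one_le₀ hN1; linarith : 0 ≤ 1 - (N : ℝ)⁻¹)
          (by positivity : 0 ≤ (N : ℝ)⁻¹) (by ring)
        have he : (1 - (N : ℝ)⁻¹) • x + (N : ℝ)⁻¹ • xN = y := by
          rw [hxN, smul_add, smul_smul, inv_mul_cancel₀ hN0.ne', one_smul]
          module
        rw [he] at hcv
        simp only [smul_eq_mul] at hcv
        have h3 : N * (G y θ - G x θ) ≤ G xN θ - G x θ := by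
          have := mul_le_mul_of_nonneg_left hcv hN0.le
          field_simp at this
          linarith
        refine Real.exp_le_exp.2 (pow_le_pow_left₀ (by positivity) (le_trans ?_ h3) 2)
        gcongr
      refine (measureReal_mono hsub).trans ?_
      refine (real_markov (P := Q) (C := Real.exp (L₀ ^ 2 * ‖xN - x‖ ^ 2))
        (by have := hm xN; have := hm x; fun_prop) (Real.exp_pos _).le (Real.exp_pos _)
        (h xN x)).trans ?_
      rw [← Real.exp_sub, ← Real.exp_nat_mul, hnorm]
      refine Real.exp_le_exp.2 ?_
      have : L₀ ^ 2 * (N * d) ^ 2 - (N * c) ^ 2 = -(N : ℝ) * (N * δ) := by rw [hδ]; ring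
      rw [this]
      have : (N : ℝ) * δ ≤ N * (N * δ) := by
        gcongr
        nlinarith
      linarith
    have hlim := tendsto_pow_atTop_nhds_zero_of_lt_one (Real.exp_pos (-δ)).le
      (Real.exp_lt_one_iff.2 (by linarith : -δ < 0))
    have := ge_of_tendsto' hlim hN
    exact (measureReal_eq_zero_iff).1 (le_antisymm this measureReal_nonneg)
  -- Countably many levels decreasing to `L₀ d` keep the exceptional set null.
  have hall : ∀ᵐ θ ∂Q, ∀ m : ℕ, ¬ (L₀ * d + 1 / ((m : ℝ) + 1) ≤ G y θ - G x θ) := by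
    rw [ae_all_iff]
    intro m
    rw [ae_iff]
    simp only [not_not]
    exact hzero _ (by have : (0 : ℝ) < 1 / ((m : ℝ) + 1) := by positivity
                      linarith)
  filter_upwards [hall] with θ hθ
  refine le_of_forall_pos_le_add fun ε hε => ?_
  obtain ⟨m, hm⟩ := exists_nat_one_div_lt hε
  have := not_le.1 (hθ m)
  linarith

lemma StandardSetting.ae_abs_sub_le [IsProbabilityMeasure Q] (S : StandardSetting L₀ Q G f)
    (h : SubGaussianIncrements L₀ Q G) (hL₀ : 0 ≤ L₀) (x y : E n) :
    ∀ᵐ θ ∂Q, |G x θ - G y θ| ≤ L₀ * ‖x - y‖ := by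
  filter_upwards [S.ae_sub_le h hL₀ x y, S.ae_sub_le h hL₀ y x] with θ h1 h2
  rw [norm_sub_rev] at h2
  rw [abs_le]
  constructor <;> linarith

/-- The almost sure Lipschitz bound is applied to the `n` pairs of query points at distance `2 η
√(2v)`. Its null set depends on `(v, z)`, so the bad set is shown to be null by integrating its
fibres. -/
lemma StandardSetting.ae_norm_sq_gradEst_le [IsProbabilityMeasure Q]
    (S : StandardSetting L₀ Q G f) (h : SubGaussianIncrements L₀ Q G) (hL₀ : 0 ≤ L₀) {η : ℝ}
    (hη : 0 < η) (x : E n) :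
    ∀ᵐ s ∂(sampleLaw n η Q), ‖gradEst G η x s.1 s.2.1 s.2.2‖ ^ 2 ≤ cn n L₀ * s.1 := by
  have hm : Measurable (fun s : ℝ × E n × Θ => gradEst G η x s.1 s.2.1 s.2.2) :=
    (measurable_gradEst S.measurable η).comp (measurable_const.prodMk measurable_id)
  have hle : MeasurableSet {s : ℝ × E n × Θ |
      ‖gradEst G η x s.1 s.2.1 s.2.2‖ ^ 2 ≤ cn n L₀ * s.1} :=
    measurableSet_le (by fun_prop) (by fun_prop)
  have hms : MeasurableSet {s : ℝ × E n × Θ |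
      ¬ ‖gradEst G η x s.1 s.2.1 s.2.2‖ ^ 2 ≤ cn n L₀ * s.1} := hle.compl
  rw [ae_iff, ← lintegral_indicator_one hms]
  refine le_antisymm ((lintegral_sampleLaw_le η (h := fun _ => 0)
    (measurable_one.indicator hms) fun v hv z => ?_).trans (by simp)) zero_le
  have hmi : Measurable fun θ : Θ => {s : ℝ × E n × Θ |
      ¬ ‖gradEst G η x s.1 s.2.1 s.2.2‖ ^ 2 ≤ cn n L₀ * s.1}.indicator
        (1 : ℝ × E n × Θ → ℝ≥0∞) (v, z, θ) :=
    (measurable_one.indicator hms).comp (by fun_prop : Measurable fun θ : Θ => (v, z, θ))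
  rw [nonpos_iff_eq_zero, lintegral_eq_zero_iff hmi]
  have hae : ∀ᵐ θ ∂Q, ∀ i : Fin n, |G (shift x i (η * √(2 * v)) z) θ -
      G (shift x i (-(η * √(2 * v))) z) θ| ≤ L₀ * (2 * |η * √(2 * v)|) := by
    rw [ae_all_iff]
    intro i
    rw [← norm_shift_sub x i _ z]
    exact S.ae_abs_sub_le h hL₀ _ _
  filter_upwards [hae] with θ hθ
  rw [Pi.zero_apply]
  refine indicator_of_notMem ?_ _
  simp only [mem_ofPred_eq, not_not]
  rw [norm_sq_gradEst]
  have hi : ∀ i ∈ Finset.univ, (G (shift x i (η * √(2 * v)) z) θ -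
      G (shift x i (-(η * √(2 * v))) z) θ) ^ 2 / (2 * Real.pi * η ^ 2) ≤
      4 * L₀ ^ 2 / Real.pi * v := by
    intro i _
    have h1 : (G (shift x i (η * √(2 * v)) z) θ -
        G (shift x i (-(η * √(2 * v))) z) θ) ^ 2 ≤ (L₀ * (2 * |η * √(2 * v)|)) ^ 2 := by
      rw [← sq_abs]
      exact pow_le_pow_left₀ (abs_nonneg _) (hθ i) 2
    rw [mul_pow, mul_pow, sq_abs, mul_pow, Real.sq_sqrt (by positivity)] at h1
    rw [div_le_iff₀ (by positivity)]
    refine h1.trans (le_of_eq ?_)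
    field_simp
    ring
  refine (Finset.sum_le_sum hi).trans (le_of_eq ?_)
  rw [Finset.sum_const, Finset.card_univ, Fintype.card_fin, nsmul_eq_mul]
  unfold cn
  ring

end SubGaussian

/-! ### The three settings -/

section Settings

variable {n : ℕ} {Θ : Type u} [MeasurableSpace Θ] {L₀ : ℝ} {Q : Measure Θ} {G : E n → Θ → ℝ}
  {f : E n → ℝ}

lemma StandardSetting.convexOracle (S : StandardSetting L₀ Q G f) : ConvexOracle L₀ Q G f where
  measurable := S.measurable
  integrable := S.integrable
  objective := S.objective
  lipschitz := S.lipschitz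
  convex := by
    refine ⟨convex_univ, fun x _ y _ a b ha hb hab => ?_⟩
    rw [S.objective, S.objective x, S.objective y, smul_eq_mul, smul_eq_mul,
      ← integral_const_mul, ← integral_const_mul,
      ← integral_add ((S.integrable x).const_mul a) ((S.integrable y).const_mul b)]
    exact integral_mono (S.integrable _)
      (((S.integrable x).const_mul a).add ((S.integrable y).const_mul b))
      fun θ => (S.convex θ).2 (mem_univ x) (mem_univ y) ha hb hab

lemma RandomFieldSetting.convexOracle (S : RandomFieldSetting.{u, v} L₀ Q G f) :
    ConvexOracle L₀ Q G f := by
  obtain ⟨Ξ, _, D, ξ, Fhat, hξ, hD, hF, hint, hG, hm, hf, hL, hc⟩ := S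
  have hGx : ∀ x, G x = fun θ => Fhat x (ξ x θ) := fun x => funext (hG x)
  refine ⟨hm, fun x => ?_, fun x => ?_, fun x y => ?_, hc⟩
  · have := hint x
    rw [← hD x, integrable_map_measure (hF x).aestronglyMeasurable (hξ x).aemeasurable] at this
    rw [hGx]
    exact this
  · rw [hf x, ← hD x, integral_map (hξ x).aemeasurable (hF x).aestronglyMeasurable, hGx]
  · simp_rw [hG]
    exact hL x y

/-- The point `y` carries weight `1 / (N + 1)` of a far point on the ray from `x`; boundedness makes
its contribution vanish as `N → ∞`. -/
lemma le_of_convexOn_of_abs_le (hf : ConvexOn ℝ univ f) {M : ℝ} (hM : ∀ x, |f x| ≤ M)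
    (x y : E n) : f y ≤ f x := by
  have hN : ∀ N : ℕ, f y - f x ≤ (1 / ((N : ℝ) + 1)) * (2 * M) := by
    intro N
    set t : ℝ := 1 / ((N : ℝ) + 1) with ht
    have hN0 : (0 : ℝ) < (N : ℝ) + 1 := by positivity
    have ht0 : 0 ≤ t := by positivity
    have ht1 : t ≤ 1 := by rw [ht, div_le_one hN0]; linarith [Nat.cast_nonneg (α := ℝ) N]
    have h := hf.2 (mem_univ x) (mem_univ (x + ((N : ℝ) + 1) • (y - x)))
      (by linarith : 0 ≤ 1 - t) ht0 (by ring)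
    have he : (1 - t) • x + t • (x + ((N : ℝ) + 1) • (y - x)) = y := by
      have : t * ((N : ℝ) + 1) = 1 := by rw [ht]; field_simp
      rw [smul_add, smul_smul, this, one_smul]
      module
    rw [he] at h
    simp only [smul_eq_mul] at h
    have h1 := (abs_le.1 (hM (x + ((N : ℝ) + 1) • (y - x)))).2
    have h2 := (abs_le.1 (hM x)).1
    nlinarith
  have hlim := (tendsto_one_div_add_atTop_nhds_zero_nat (𝕜 := ℝ)).mul_const (2 * M)
  rw [zero_mul] at hlim
  have := ge_of_tendsto' hlim hN
  linarith

/-- With known densities and a uniformly bounded integrand the objective is bounded, hence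
constant, being convex on `ℝⁿ`. -/
lemma KnownDensitySetting.objective_eq (S : KnownDensitySetting L₀ Q G f) (x y : E n) :
    f x = f y := by
  obtain ⟨ν, Fhat, p, pt, supp, M, Mf, Lf, Lξ, _, hK, -, -, -, hf, hc⟩ := S
  have hp0 : ∀ x ξ, 0 ≤ p x ξ := by
    intro x ξ
    by_cases h : ξ ∈ supp x
    · exact (hK.p_pos x ξ h).le
    · exact (hK.p_zero x ξ h).ge
  have hb : ∀ x, |f x| ≤ Mf := by
    intro x
    have hpm : Measurable (p x) := hK.measurable_p.comp (measurable_const.prodMk measurable_id)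
    have h1 : ∫⁻ ξ, ENNReal.ofReal (p x ξ) ∂ν = 1 := by
      have := (hK.p_prob x).measure_univ
      rwa [withDensity_apply _ MeasurableSet.univ, setLIntegral_univ] at this
    have hpi : Integrable (p x) ν := by
      refine ⟨hpm.aestronglyMeasurable, ?_⟩
      rw [hasFiniteIntegral_iff_ofReal (ae_of_all _ (hp0 x)), h1]
      exact ENNReal.one_lt_top
    have h2 : ∫ ξ, p x ξ ∂ν = 1 := by
      rw [integral_eq_lintegral_of_nonneg_ae (ae_of_all _ (hp0 x)) hpm.aestronglyMeasurable, h1]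
      rfl
    rw [hf x]
    calc |∫ ξ in supp x, Fhat x ξ * p x ξ ∂ν|
        ≤ ∫ ξ in supp x, Mf * p x ξ ∂ν := by
          rw [← Real.norm_eq_abs]
          refine norm_integral_le_of_norm_le (hpi.integrableOn.const_mul Mf) ?_
          filter_upwards [hK.bounded x] with ξ hξ
          rw [Real.norm_eq_abs, abs_mul, abs_of_nonneg (hp0 x ξ)]
          exact mul_le_mul_of_nonneg_right hξ (hp0 x ξ)
      _ = Mf * ∫ ξ in supp x, p x ξ ∂ν := integral_const_mul _ _
      _ ≤ Mf * ∫ ξ, p x ξ ∂ν :=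
          mul_le_mul_of_nonneg_left (setIntegral_le_integral hpi (ae_of_all _ (hp0 x)))
            hK.const_nonneg.2.1
      _ = Mf := by rw [h2, mul_one]
  exact le_antisymm (le_of_convexOn_of_abs_le hc hb y x) (le_of_convexOn_of_abs_le hc hb x y)

end Settings

namespace Run

variable {n : ℕ} {R : Run.{u, w} n} {L₀ : ℝ}

lemma KnownDensity.tail_eq_zero (S : R.KnownDensity L₀) (K : ℕ) {t : ℝ} (ht : 0 < t) :
    R.tail K t = 0 := by
  have : {ω | t ≤ R.f (R.avg K ω) - R.f R.xstar} = ∅ := by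
    refine eq_empty_of_forall_notMem fun ω hω => ?_
    have h1 : t ≤ R.f (R.avg K ω) - R.f R.xstar := hω
    rw [KnownDensitySetting.objective_eq S (R.avg K ω) R.xstar] at h1
    linarith
  rw [tail, this, measureReal_empty]

lemma Admissible.cases (h : Admissible.{u, v, w} R L₀) :
    ConvexOracle L₀ R.Q R.G R.f ∨ R.KnownDensity L₀ := by
  rcases h with h | h | h
  · exact Or.inl (StandardSetting.convexOracle h)
  · exact Or.inr h
  · exact Or.inl (RandomFieldSetting.convexOracle h)

/-! ### The exponential tail bound in the standard setting -/

/-- The centered error of iteration `k`. -/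
def errD (R : Run.{u, w} n) (k : ℕ) (x : E n) (s : ℝ × E n × R.Θ) : ℝ :=
  R.errA k x s + R.errC k x s - ∫ s', R.errC k x s' ∂(R.noiseLaw k)

section Standard

variable (S : R.Standard L₀)

include S

lemma integrable_errC (hL₀ : 0 ≤ L₀) (k : ℕ) (x : E n) : Integrable (R.errC k x) (R.noiseLaw k) := by
  have O := StandardSetting.convexOracle S
  have hg := (memLp_grad O hL₀ k x).norm
  refine Integrable.mono' (hg.integrable_sq.const_mul (R.γ k ^ 2)) ?_ (ae_of_all _ fun s => ?_)
  · exact ((measurable_errC O k).comp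
      (measurable_const.prodMk measurable_id : Measurable fun s => (x, s))).aestronglyMeasurable
  · have := R.γ_pos k
    have := R.DX_nonneg
    rw [Real.norm_eq_abs, abs_of_nonneg (le_min (by positivity) (by positivity))]
    exact min_le_left _ _

/-- The first bound is the cost of centering `errC`, which `ε ≥ c_n c_K` absorbs in the end. The
second matches the linear growth needed for `abs_errD_le`. -/
lemma integral_errC_le (hL₀ : 0 ≤ L₀) (k : ℕ) (x : E n) :
    ∫ s, R.errC k x s ∂(R.noiseLaw k) ≤ cn n L₀ * R.γ k ^ 2 ∧
    ∫ s, R.errC k x s ∂(R.noiseLaw k) ≤ 2 * R.γ k * R.DX * √(cn n L₀) := by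
  have O := StandardSetting.convexOracle S
  have hg := (memLp_grad O hL₀ k x).norm
  have hγ := R.γ_pos k
  have hD := R.DX_nonneg
  constructor
  · calc ∫ s, R.errC k x s ∂(R.noiseLaw k)
        ≤ ∫ s, R.γ k ^ 2 * ‖R.grad k x s‖ ^ 2 ∂(R.noiseLaw k) :=
          integral_mono (integrable_errC S hL₀ k x) (hg.integrable_sq.const_mul _)
            fun s => min_le_left _ _
      _ = R.γ k ^ 2 * ∫ s, ‖R.grad k x s‖ ^ 2 ∂(R.noiseLaw k) := integral_const_mul _ _
      _ ≤ R.γ k ^ 2 * cn n L₀ := by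
          gcongr
          exact O.integral_norm_sq_gradEst_le hL₀ (R.η_pos k) x
      _ = _ := mul_comm _ _
  · calc ∫ s, R.errC k x s ∂(R.noiseLaw k)
        ≤ ∫ s, 2 * R.γ k * R.DX * ‖R.grad k x s‖ ∂(R.noiseLaw k) :=
          integral_mono (integrable_errC S hL₀ k x)
            ((hg.integrable (by norm_num)).const_mul _) fun s => min_le_right _ _
      _ = 2 * R.γ k * R.DX * ∫ s, ‖R.grad k x s‖ ∂(R.noiseLaw k) := integral_const_mul _ _
      _ ≤ _ := by
          gcongr
          exact O.integral_norm_gradEst_le hL₀ (R.η_pos k) x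

lemma measurable_errD (k : ℕ) :
    Measurable (fun p : E n × (ℝ × E n × R.Θ) => R.errD k p.1 p.2) := by
  have O := StandardSetting.convexOracle S
  have h1 := measurable_errA O k
  have h2 := measurable_errC O k
  have h3 : Measurable fun x : E n => ∫ s', R.errC k x s' ∂(R.noiseLaw k) :=
    (h2.stronglyMeasurable.integral_prod_right (ν := R.noiseLaw k)).measurable
  exact (h1.add h2).sub (h3.comp measurable_fst)

lemma integrable_errD (hL₀ : 0 ≤ L₀) (k : ℕ) (x : E n) :
    Integrable (R.errD k x) (R.noiseLaw k) ∧ ∫ s, R.errD k x s ∂(R.noiseLaw k) = 0 := by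
  have O := StandardSetting.convexOracle S
  have h1 := (memLp_errA O hL₀ k x).integrable (by norm_num : (1 : ℝ≥0∞) ≤ 2)
  have h2 := integrable_errC S hL₀ k x
  have h12 : Integrable (fun s => R.errA k x s + R.errC k x s) (R.noiseLaw k) := h1.add h2
  refine ⟨h12.sub (integrable_const _), ?_⟩
  unfold errD
  rw [integral_sub h12 (integrable_const _), integral_add h1 h2, integral_errA O hL₀]
  simp

/-- This is where the truncation of the squared step pays off: linear growth in the norm of the
estimator means growth like `√V`, hence sub-Gaussian rather than merely exponential tails. -/
lemma abs_errD_le (hL₀ : 0 ≤ L₀) (k : ℕ) {x : E n} (hx : x ∈ R.X) (s : ℝ × E n × R.Θ) :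
    |R.errD k x s| ≤ 4 * R.γ k * R.DX * (√(cn n L₀) + ‖R.grad k x s‖) := by
  have O := StandardSetting.convexOracle S
  have hγ := R.γ_pos k
  have hD := R.DX_nonneg
  have h1 : |R.errA k x s| ≤ 2 * R.γ k * R.DX * (√(cn n L₀) + ‖R.grad k x s‖) := by
    rw [errA, abs_mul, abs_of_pos (by positivity : 0 < 2 * R.γ k), mul_assoc (2 * R.γ k)]
    refine mul_le_mul_of_nonneg_left ?_ (by positivity)
    refine (abs_real_inner_le_norm _ _).trans ?_
    rw [mul_comm]
    have h2 := O.norm_meanGrad_le hL₀ (R.η_pos k) x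
    have h3 := norm_sub_le (meanGrad R.G R.Q (R.η k) x) (R.grad k x s)
    exact mul_le_mul (norm_sub_le_DX hx R.xstar_mem) (by linarith) (norm_nonneg _) hD
  have h2 := (integral_errC_le S hL₀ k x).2
  have h0 : ∀ s, 0 ≤ R.errC k x s := fun s => le_min (by positivity) (by positivity)
  have h3 : 0 ≤ ∫ s, R.errC k x s ∂(R.noiseLaw k) := integral_nonneg h0
  have h4 : R.errC k x s ≤ 2 * R.γ k * R.DX * ‖R.grad k x s‖ := min_le_right _ _
  have h5 := h0 s
  have h6 := abs_le.1 h1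
  unfold errD
  rw [abs_le]
  constructor <;> nlinarith [h6.1, h6.2]

/-- Almost surely the error, scaled by `r`, is at most `β (1 + √V)` with `β = 4 r γ_k D_X √c_n`, and
`96 = 6 · 4²`. -/
lemma lintegral_exp_errD_le (h : R.SubGaussian L₀) (hL₀ : 0 ≤ L₀) {r : ℝ} (hr : 0 ≤ r) (k : ℕ)
    {x : E n} (hx : x ∈ R.X) :
    ∫⁻ s, ENNReal.ofReal (Real.exp (r * R.errD k x s)) ∂(R.noiseLaw k) ≤
      ENNReal.ofReal (Real.exp (96 * r ^ 2 * R.DX ^ 2 * cn n L₀ * R.γ k ^ 2)) := by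
  have hγ := R.γ_pos k
  have hD := R.DX_nonneg
  have hcn : 0 ≤ cn n L₀ := by unfold cn; positivity
  obtain ⟨hi, h0⟩ := integrable_errD S hL₀ k x
  have hpos : ∀ᵐ s ∂(R.noiseLaw k), 0 ≤ s.1 :=
    Measure.quasiMeasurePreserving_fst.ae (ae_exp_one_pos.mono fun _ hv => hv.le)
  have key := lintegral_exp_le_of_abs_le (μ := R.noiseLaw k) (X := fun s => r * R.errD k x s)
    (V := fun s => s.1) (β := r * (4 * R.γ k * R.DX * √(cn n L₀))) (by positivity)
    (hi.const_mul r) (by rw [integral_const_mul, h0, mul_zero]) hpos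
    (fun c hc => (lintegral_sampleLaw_le (R.η k)
      (h := fun v => ENNReal.ofReal (Real.exp (c * v))) (by fun_prop)
      fun v _ z => by simp).trans (lintegral_exp_mul_exp_one hc).le) ?_
  · refine key.trans (le_of_eq ?_)
    congr 2
    rw [mul_pow, mul_pow, mul_pow, mul_pow, Real.sq_sqrt hcn]
    ring
  · filter_upwards [StandardSetting.ae_norm_sq_gradEst_le S h hL₀ (R.η_pos k) x, hpos] with s hs hs0
    have h1 : ‖R.grad k x s‖ ≤ √(cn n L₀) * √s.1 := by
      rw [← Real.sqrt_mul hcn]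
      exact Real.le_sqrt_of_sq_le hs
    rw [abs_mul, abs_of_nonneg hr]
    calc r * |R.errD k x s| ≤ r * (4 * R.γ k * R.DX * (√(cn n L₀) + √(cn n L₀) * √s.1)) := by
          refine mul_le_mul_of_nonneg_left ((abs_errD_le S hL₀ k hx s).trans ?_) hr
          gcongr
      _ = _ := by ring

lemma tail_le_exp (h : R.SubGaussian L₀) (hn : 1 ≤ n) (hL₀ : 0 < L₀) {K : ℕ} (hK : 1 ≤ K) {ε : ℝ}
    (hε : 0 < ε) (hεc : cn n L₀ * R.cK K ≤ ε) :
    R.tail K ((R.cD L₀ (1 / 16) K + ε + √(2 * n * R.cL L₀ * R.cK K / (1 / 16) * ε)) /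
      (2 * R.sumγ K)) ≤ Real.exp (-ε / 3) := by
  have O := StandardSetting.convexOracle S
  have hs := sumγ_pos (R := R) hK
  have hc := cK_pos (R := R) hK
  have hcn := cn_pos hn hL₀
  have hb := R.bias_nonneg hL₀.le K
  have hn0 : (0 : ℝ) < n := by exact_mod_cast hn
  set τ := √(2 * n * R.cL L₀ * R.cK K / (1 / 16) * ε) with hτ
  have hcD0 : 0 ≤ R.cD L₀ (1 / 16) K := by unfold cD; positivity
  rcases R.DX_nonneg.eq_or_lt with hD | hD
  · rw [tail_eq_zero O hL₀.le hK]
    · positivity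
    · rw [← hD, mul_zero]
      positivity
  have hcL : 0 < R.cL L₀ := by unfold cL; positivity
  have hτ0 : 0 < τ := Real.sqrt_pos.2 (by positivity)
  have hτ2 : τ ^ 2 = 2 * n * R.cL L₀ * R.cK K / (1 / 16) * ε := Real.sq_sqrt (by positivity)
  -- The summand `ε` of the threshold pays for the mean of `errC`; only `τ` is left for the centered
  -- sum.
  refine (tail_le_sum O hL₀.le hK (a := cn n L₀ * R.cK K + τ) ?_).trans ?_
  · rw [div_mul_cancel₀ _ (by positivity), cD]
    have := Real.sqrt_nonneg (2 * (n : ℝ) * R.cL L₀ * R.cK K / (1 / 16))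
    linarith
  have hsub : {ω | cn n L₀ * R.cK K + τ ≤ R.psum R.errA K ω + R.psum R.errC K ω} ⊆
      {ω | τ ≤ R.psum R.errD K ω} := by
    intro ω hω
    have h1 : cn n L₀ * R.cK K + τ ≤ R.psum R.errA K ω + R.psum R.errC K ω := hω
    have h2 : R.psum R.errA K ω + R.psum R.errC K ω ≤ R.psum R.errD K ω + cn n L₀ * R.cK K := by
      unfold psum cK
      rw [Finset.mul_sum, ← Finset.sum_add_distrib, ← Finset.sum_add_distrib]
      refine Finset.sum_le_sum fun k _ => ?_
      have := (integral_errC_le S hL₀.le k (R.x k ω)).1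
      unfold errD
      linarith
    simp only [mem_ofPred_eq]
    linarith
  refine (measureReal_mono hsub).trans ?_
  set b := 96 * R.DX ^ 2 * cn n L₀ * R.cK K with hbdef
  have hb0 : 0 < b := by positivity
  -- The minimizer of `b r² - r τ`.
  refine (real_psum_ge_le_of_exp O.measurable (measurable_errD S) (r := τ / (2 * b))
    (by positivity) (fun k x hx => lintegral_exp_errD_le S h hL₀.le (by positivity) k hx)
    K τ).trans (Real.exp_le_exp.2 ?_)
  rw [← Finset.mul_sum]
  change 96 * (τ / (2 * b)) ^ 2 * R.DX ^ 2 * cn n L₀ * R.cK K - τ / (2 * b) * τ ≤ -ε / 3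
  have e1 : 96 * (τ / (2 * b)) ^ 2 * R.DX ^ 2 * cn n L₀ * R.cK K - τ / (2 * b) * τ =
      -(τ ^ 2 / (4 * b)) := by
    have : 96 * (τ / (2 * b)) ^ 2 * R.DX ^ 2 * cn n L₀ * R.cK K = (τ / (2 * b)) ^ 2 * b := by
      rw [hbdef]; ring
    rw [this]
    field_simp
    ring
  -- This fixes `α = 1/16`: the exponent is `-π ε / 6`, and `π ≥ 2` yields `-ε / 3`.
  have e2 : τ ^ 2 / (4 * b) = Real.pi * ε / 6 := by
    rw [hτ2, hbdef, cL, cn]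
    have := hD.ne'
    have := hc.ne'
    field_simp
    ring
  rw [e1, e2]
  nlinarith [Real.two_le_pi]

end Standard

end Run

namespace Run

variable {n : ℕ} {R : Run.{u, w} n} {L₀ : ℝ}

/-! ### The step lengths `1 / √(k + 1)` -/

/-- Step lengths and smoothing parameters `γ_k = η_k = 1 / √(k + 1)`. -/
def SqrtSteps (R : Run.{u, w} n) : Prop :=
  ∀ k : ℕ, R.γ k = 1 / √((k : ℝ) + 1) ∧ R.η k = 1 / √((k : ℝ) + 1)

section SqrtSteps

variable (hstep : R.SqrtSteps)

include hstep

lemma γ_sq (k : ℕ) : R.γ k ^ 2 = 1 / ((k : ℝ) + 1) := by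
  rw [(hstep k).1, div_pow, Real.sq_sqrt (by positivity), one_pow]

lemma η_eq_γ (k : ℕ) : R.η k = R.γ k := by rw [(hstep k).1, (hstep k).2]

lemma γ_sq_le_one (k : ℕ) : R.γ k ^ 2 ≤ 1 := by
  rw [γ_sq hstep, div_le_one (by positivity)]
  linarith [Nat.cast_nonneg (α := ℝ) k]

lemma cK_le (K : ℕ) : R.cK K ≤ 1 + Real.log K := by
  have h := harmonic_le_one_add_log K
  refine le_trans (le_of_eq ?_) h
  rw [cK, harmonic]
  push_cast
  exact Finset.sum_congr rfl fun k _ => by rw [γ_sq hstep, one_div]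

lemma one_le_cK {K : ℕ} (hK : 1 ≤ K) : 1 ≤ R.cK K := by
  have h0 : R.γ 0 ^ 2 = 1 := by rw [γ_sq hstep]; simp
  rw [← h0]
  exact Finset.single_le_sum (f := fun k => R.γ k ^ 2) (fun k _ => sq_nonneg _)
    (Finset.mem_range.2 hK)

lemma sqrt_le_sumγ {K : ℕ} (hK : 1 ≤ K) : √(K : ℝ) ≤ R.sumγ K := by
  have hK0 : (0 : ℝ) < K := by exact_mod_cast hK
  have h : ∑ _k ∈ Finset.range K, 1 / √(K : ℝ) ≤ R.sumγ K := by
    refine Finset.sum_le_sum fun k hk => ?_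
    rw [(hstep k).1]
    have : (k : ℝ) + 1 ≤ K := by exact_mod_cast Finset.mem_range.1 hk
    gcongr
  refine le_trans (le_of_eq ?_) h
  rw [Finset.sum_const, Finset.card_range, nsmul_eq_mul, mul_one_div, Real.div_sqrt]

lemma bias_eq (K : ℕ) : R.bias L₀ K = 2 * L₀ * √((n : ℝ) + 1) * R.cK K := by
  rw [bias, cK, Finset.mul_sum]
  exact Finset.sum_congr rfl fun k _ => by rw [η_eq_γ hstep]; ring

/-- For the value `ε = 2 c_n c_K` the threshold exceeds the range of the objective. -/
lemma tail_eq_zero_of_cK (O : ConvexOracle L₀ R.Q R.G R.f) (hn : 1 ≤ n) (hL₀ : 0 < L₀) {K : ℕ}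
    (hK : 1 ≤ K) {ε α : ℝ} (hε : 0 < ε) (hα : 0 < α) (hα1 : α < 1)
    (hcK : R.cK K = ε / (2 * cn n L₀)) :
    R.tail K (ε / (4 * cn n L₀) * (R.DX ^ 2 + √(R.cL L₀ * n * ε / (α * cn n L₀)) +
      ε * (2 * L₀ * √((n : ℝ) + 1) + 1 + √(2 * n * R.cL L₀ / (2 * α * cn n L₀))))) = 0 := by
  have hcn := cn_pos hn hL₀
  have hD := R.DX_nonneg
  have hn1 : (1 : ℝ) ≤ n := by exact_mod_cast hn
  have h1 := one_le_cK hstep hK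
  have hεc : ε = 2 * cn n L₀ * R.cK K := by rw [hcK]; field_simp
  -- With `ε = 2 c_n c_K` the radicand is `16 D_X² L₀² n c_K / α`, where `n`, `c_K` and `1/α` are at
  -- least `1`. The outer factor is `c_K / 2 ≥ 1/2`, so the threshold strictly exceeds `L₀ D_X`.
  have hlow : 4 * L₀ * R.DX ≤ √(R.cL L₀ * n * ε / (α * cn n L₀)) := by
    refine Real.le_sqrt_of_sq_le ?_
    rw [le_div_iff₀ (by positivity), hεc, cL]
    have h2 : α ≤ n * R.cK K := by nlinarith
    have h3 : 0 ≤ 16 * R.DX ^ 2 * L₀ ^ 2 * cn n L₀ := by positivity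
    nlinarith [mul_le_mul_of_nonneg_left h2 h3]
  refine tail_eq_zero O hL₀.le hK ?_
  have hfac : ε / (4 * cn n L₀) = R.cK K / 2 := by rw [hcK]; field_simp; norm_num
  have hrest : 0 < ε * (2 * L₀ * √((n : ℝ) + 1) + 1 + √(2 * n * R.cL L₀ / (2 * α * cn n L₀))) := by
    positivity
  rw [hfac]
  have hLD : 0 ≤ L₀ * R.DX := by positivity
  nlinarith [sq_nonneg R.DX]

/-- Since `γ_k = η_k`, the squared step is `η_k² ‖g‖²`, whose exponential moments at scale `σ` are
known; each is at most `exp(γ_k²)`. -/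
lemma real_errB_le (O : ConvexOracle L₀ R.Q R.G R.f) (h : R.SubGaussian L₀) (hn : 1 ≤ n)
    {σ : ℝ} (hσ : 0 < σ) (h1 : σ * n ≤ 2 * Real.pi) (h2 : σ * cn n L₀ ≤ 1 / 2) (K : ℕ) (b : ℝ) :
    R.P.real {ω | b ≤ R.psum R.errB K ω} ≤ Real.exp (R.cK K - σ * b) := by
  have hcn : 0 ≤ cn n L₀ := by unfold cn; positivity
  refine real_psum_ge_le_of_exp O.measurable (measurable_errB O) (c := fun k => R.γ k ^ 2) hσ
    (fun k x _ => ?_) K b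
  have hle : σ * cn n L₀ * R.η k ^ 2 ≤ 1 / 2 * R.γ k ^ 2 := by
    rw [η_eq_γ hstep]; gcongr
  have := O.lintegral_exp_norm_sq_gradEst_le h hn (R.η_pos k) hσ.le h1
    (by linarith [γ_sq_le_one hstep k]) x
  rw [η_eq_γ hstep] at this hle
  unfold errB grad noiseLaw
  rw [η_eq_γ hstep]
  exact this.trans (ENNReal.ofReal_le_ofReal (Real.exp_le_exp.2 (by linarith)))

/-- Centering passes to the square, which is at most `σ γ_k² (c_n + ‖g‖²)` with `σ = 8 D_X² r²`. The
deterministic part contributes `γ_k² / 2` to the exponent and the random part `γ_k²`. -/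
lemma real_errA_le (O : ConvexOracle L₀ R.Q R.G R.f) (h : R.SubGaussian L₀) (hn : 1 ≤ n)
    (hL₀ : 0 < L₀) {r : ℝ} (hr : 0 < r) (h1 : 8 * R.DX ^ 2 * r ^ 2 * n ≤ 2 * Real.pi)
    (h2 : 8 * R.DX ^ 2 * r ^ 2 * cn n L₀ ≤ 1 / 2) (K : ℕ) (a : ℝ) :
    R.P.real {ω | a ≤ R.psum R.errA K ω} ≤ Real.exp (3 / 2 * R.cK K - r * a) := by
  have hcn := cn_pos hn hL₀
  set σ := 8 * R.DX ^ 2 * r ^ 2 with hσ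
  have hσ0 : 0 ≤ σ := by positivity
  rw [cK, Finset.mul_sum]
  refine real_psum_ge_le_of_exp O.measurable (measurable_errA O) (c := fun k => 3 / 2 * R.γ k ^ 2)
    hr (fun k x hx => ?_) K a
  have hle : σ * cn n L₀ * R.η k ^ 2 ≤ 1 / 2 * R.γ k ^ 2 := by
    rw [η_eq_γ hstep]; gcongr
  have hB := O.lintegral_exp_norm_sq_gradEst_le h hn (R.η_pos k) hσ0 h1
    (by linarith [γ_sq_le_one hstep k]) x
  have hi := ((memLp_errA O hL₀.le k x).integrable (by norm_num : (1 : ℝ≥0∞) ≤ 2)).const_mul r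
  have hbound : ∀ s, (r * R.errA k x s) ^ 2 ≤
      σ * cn n L₀ * R.η k ^ 2 + σ * (R.η k ^ 2 * ‖R.grad k x s‖ ^ 2) := by
    intro s
    have e1 : |R.errA k x s| ≤ 2 * R.γ k *
        ((√(cn n L₀) + ‖R.grad k x s‖) * R.DX) := by
      have hγ := R.γ_pos k
      rw [errA, abs_mul, abs_of_pos (by positivity : 0 < 2 * R.γ k)]
      refine mul_le_mul_of_nonneg_left ?_ (by positivity)
      refine (abs_real_inner_le_norm _ _).trans ?_
      have h2 := O.norm_meanGrad_le hL₀.le (R.η_pos k) x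
      have h3 := norm_sub_le (meanGrad R.G R.Q (R.η k) x) (R.grad k x s)
      exact mul_le_mul (by linarith) (norm_sub_le_DX hx R.xstar_mem) (norm_nonneg _)
        (by positivity)
    have e2 : R.errA k x s ^ 2 ≤ (2 * R.γ k * ((√(cn n L₀) + ‖R.grad k x s‖) * R.DX)) ^ 2 := by
      rw [← sq_abs]
      exact pow_le_pow_left₀ (abs_nonneg _) e1 2
    have e3 : (√(cn n L₀) + ‖R.grad k x s‖) ^ 2 ≤ 2 * (cn n L₀ + ‖R.grad k x s‖ ^ 2) := by
      nlinarith [Real.sq_sqrt hcn.le, sq_nonneg (√(cn n L₀) - ‖R.grad k x s‖)]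
    rw [η_eq_γ hstep]
    calc (r * R.errA k x s) ^ 2 = r ^ 2 * R.errA k x s ^ 2 := by ring
      _ ≤ r ^ 2 * (2 * R.γ k * ((√(cn n L₀) + ‖R.grad k x s‖) * R.DX)) ^ 2 := by gcongr
      _ = 4 * r ^ 2 * R.DX ^ 2 * R.γ k ^ 2 * (√(cn n L₀) + ‖R.grad k x s‖) ^ 2 := by ring
      _ ≤ 4 * r ^ 2 * R.DX ^ 2 * R.γ k ^ 2 * (2 * (cn n L₀ + ‖R.grad k x s‖ ^ 2)) := by gcongr
      _ = _ := by rw [hσ]; ring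
  calc ∫⁻ s, ENNReal.ofReal (Real.exp (r * R.errA k x s)) ∂(R.noiseLaw k)
      ≤ ∫⁻ s, ENNReal.ofReal (Real.exp ((r * R.errA k x s) ^ 2)) ∂(R.noiseLaw k) :=
        lintegral_exp_le_of_centered hi (by rw [integral_const_mul, integral_errA O hL₀.le, mul_zero])
    _ ≤ ∫⁻ s, ENNReal.ofReal (Real.exp (σ * cn n L₀ * R.η k ^ 2)) *
          ENNReal.ofReal (Real.exp (σ * (R.η k ^ 2 * ‖R.grad k x s‖ ^ 2))) ∂(R.noiseLaw k) := by
        refine lintegral_mono fun s => ?_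
        simp only
        rw [← ENNReal.ofReal_mul (Real.exp_pos _).le, ← Real.exp_add]
        exact ENNReal.ofReal_le_ofReal (Real.exp_le_exp.2 (hbound s))
    _ ≤ ENNReal.ofReal (Real.exp (σ * cn n L₀ * R.η k ^ 2)) *
          ENNReal.ofReal (Real.exp (2 * (σ * cn n L₀ * R.η k ^ 2))) := by
        rw [lintegral_const_mul' _ _ ENNReal.ofReal_ne_top]
        gcongr
        exact hB
    _ ≤ ENNReal.ofReal (Real.exp (3 / 2 * R.γ k ^ 2)) := by
        rw [← ENNReal.ofReal_mul (Real.exp_pos _).le, ← Real.exp_add]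
        exact ENNReal.ofReal_le_ofReal (Real.exp_le_exp.2 (by linarith))

end SqrtSteps

/-- The scale of the exponential moments of the squared increments. -/
def rateScale (L₀ : ℝ) : ℝ := min (2 * Real.pi) (Real.pi / (8 * L₀ ^ 2))

/-- The constant of the rate of convergence. -/
def rateConst (L₀ D : ℝ) : ℝ :=
  (2 * D ^ 2 + 12 * L₀ + 6 * (|D| * √(8 / rateScale L₀)) + 5 / rateScale L₀) / 2

lemma rateScale_pos (hL₀ : 0 < L₀) : 0 < rateScale L₀ := by
  unfold rateScale
  positivity

lemma rateConst_pos (hL₀ : 0 < L₀) (D : ℝ) : 0 < rateConst L₀ D := by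
  have := rateScale_pos hL₀
  unfold rateConst
  positivity

/-- The factor `n` of `cn` cancels, so the scale itself is dimension-free. The two entries of the
minimum in `rateScale` are the two conditions on `σ = rateScale L₀ / n` in the exponential moment
bounds. -/
lemma rateScale_div_mul_cn_le (hn : 1 ≤ n) (hL₀ : 0 < L₀) :
    rateScale L₀ / n * cn n L₀ ≤ 1 / 2 := by
  have hn0 : (0 : ℝ) < n := by exact_mod_cast hn
  calc rateScale L₀ / n * cn n L₀ ≤ Real.pi / (8 * L₀ ^ 2) / n * cn n L₀ := by
        have := (cn_pos hn hL₀).le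
        gcongr
        exact min_le_right _ _
    _ = 1 / 2 := by
        unfold cn
        field_simp
        norm_num

lemma log_nat_ge {K : ℕ} (hK : 2 ≤ K) : 1 ≤ 2 * Real.log K := by
  have h1 : Real.log 2 ≤ Real.log K := Real.log_le_log two_pos (by exact_mod_cast hK)
  have := Real.log_two_gt_d9
  linarith

/-- Chernoff's inequality for both error sums, with `c_K ≤ 1 + log K ≤ 3 log K` for `K ≥ 2` and `∑
γ_k ≥ √K`. All parts of the threshold are then at most a constant times `n log K`. -/
lemma tail_le_rate (hstep : R.SqrtSteps) (O : ConvexOracle L₀ R.Q R.G R.f)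
    (h : R.SubGaussian L₀) (hn : 1 ≤ n) (hL₀ : 0 < L₀) {K : ℕ} (hK : 2 ≤ K) :
    R.tail K (rateConst L₀ R.DX * n * Real.log K / √(K : ℝ)) ≤
      (K : ℝ) ^ (-(4 / 3) : ℝ) + (K : ℝ) ^ (Real.log 4 - 3) := by
  have hK1 : 1 ≤ K := by omega
  have hK0 : (0 : ℝ) < K := by exact_mod_cast hK1
  have hn1 : (1 : ℝ) ≤ n := by exact_mod_cast hn
  have hn0 : (0 : ℝ) < n := by linarith
  have hlog := log_nat_ge hK
  have hlog0 : 0 < Real.log K := by linarith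
  have hC := rateConst_pos hL₀ R.DX
  rcases R.DX_nonneg.eq_or_lt with hD | hD
  · rw [tail_eq_zero O hL₀.le hK1]
    · positivity
    · rw [← hD] at hC ⊢
      rw [mul_zero]
      positivity
  set κ := rateScale L₀ with hκdef
  have hκ : 0 < κ := rateScale_pos hL₀
  have hκ2 : κ ≤ 2 * Real.pi := min_le_left _ _
  have hκc : κ / n * cn n L₀ ≤ 1 / 2 := rateScale_div_mul_cn_le hn hL₀
  have hκn : κ / n * n ≤ 2 * Real.pi := by rw [div_mul_cancel₀ _ hn0.ne']; exact hκ2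
  have hcK : R.cK K ≤ 3 * Real.log K := by linarith [cK_le hstep K]
  have hcK0 : 0 ≤ R.cK K := (cK_pos hK1).le
  -- the scale `1 / r` for the martingale part
  set q := R.DX * √(8 * n / κ) with hq
  have hq0 : 0 < q := by positivity
  have hq2 : q ^ 2 = R.DX ^ 2 * (8 * n / κ) := by
    rw [hq, mul_pow, Real.sq_sqrt (by positivity)]
  -- With `r = 1 / q`, the scale for the martingale part equals the scale `κ / n` for the squared
  -- steps.
  have hr : 8 * R.DX ^ 2 * (1 / q) ^ 2 = κ / n := by
    rw [div_pow, hq2]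
    field_simp
  have hqle : q ≤ R.DX * √(8 / κ) * n := by
    rw [hq, mul_assoc]
    gcongr
    have : 8 * (n : ℝ) / κ = 8 / κ * n := by ring
    rw [this, Real.sqrt_mul (by positivity)]
    gcongr
    rw [Real.sqrt_le_left (by linarith)]
    nlinarith
  -- The exponents become `(9/2 - 6) log K ≤ -(4/3) log K` for the martingale part and, with `b`,
  -- `(3 - 5) log K ≤ (log 4 - 3) log K` for the squared steps, as `log 4 ≥ 1`.
  set a := 6 * q * Real.log K with ha
  set b := 5 * n / κ * Real.log K with hb
  refine (tail_le_add O hL₀.le hK1 (a := a) (b := b) ?_).trans (add_le_add ?_ ?_)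
  · have hsum := sqrt_le_sumγ hstep hK1
    have h1 : R.DX ^ 2 ≤ 2 * R.DX ^ 2 * n * Real.log K := by
      have : 1 ≤ n * (2 * Real.log K) := by nlinarith
      nlinarith [sq_nonneg R.DX]
    have h2 : R.bias L₀ K ≤ 12 * L₀ * n * Real.log K := by
      rw [bias_eq hstep]
      have h3 : √((n : ℝ) + 1) ≤ 2 * n := by
        rw [Real.sqrt_le_left (by linarith)]
        nlinarith
      calc 2 * L₀ * √((n : ℝ) + 1) * R.cK K ≤ 2 * L₀ * (2 * n) * (3 * Real.log K) := by gcongr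
        _ = _ := by ring
    have h3 : a ≤ 6 * (R.DX * √(8 / κ)) * n * Real.log K := by
      rw [ha]
      calc 6 * q * Real.log K ≤ 6 * (R.DX * √(8 / κ) * n) * Real.log K := by gcongr
        _ = _ := by ring
    have h4 : rateConst L₀ R.DX * n * Real.log K * 2 ≤
        rateConst L₀ R.DX * n * Real.log K / √(K : ℝ) * (2 * R.sumγ K) := by
      have hs : 0 < √(K : ℝ) := Real.sqrt_pos.2 hK0
      rw [div_mul_eq_mul_div, le_div_iff₀ hs]
      have : 0 ≤ rateConst L₀ R.DX * n * Real.log K := by positivity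
      nlinarith [mul_le_mul_of_nonneg_left hsum this]
    refine le_trans ?_ h4
    have h5 : rateConst L₀ R.DX * n * Real.log K * 2 = 2 * R.DX ^ 2 * n * Real.log K +
        12 * L₀ * n * Real.log K + (6 * (R.DX * √(8 / κ)) * n * Real.log K + b) := by
      rw [rateConst, abs_of_pos hD, hb, ← hκdef]
      ring
    rw [h5]
    linarith
  · refine (real_errA_le hstep O h hn hL₀ (r := 1 / q) (by positivity) (by rw [hr]; exact hκn)
      (by rw [hr]; exact hκc) K a).trans ?_
    rw [Real.rpow_def_of_pos hK0]
    refine Real.exp_le_exp.2 ?_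
    have : 1 / q * a = 6 * Real.log K := by rw [ha]; field_simp
    rw [this]
    linarith
  · refine (real_errB_le hstep O h hn (σ := κ / n) (by positivity) hκn hκc K b).trans ?_
    rw [Real.rpow_def_of_pos hK0]
    refine Real.exp_le_exp.2 ?_
    have : κ / n * b = 5 * Real.log K := by rw [hb]; field_simp
    rw [this]
    have h4 : 1 ≤ Real.log 4 := by
      have : Real.log 4 = 2 * Real.log 2 := by
        rw [show (4 : ℝ) = 2 ^ 2 by norm_num, Real.log_pow]; norm_num
      have := Real.log_two_gt_d9
      linarith
    nlinarith

end Run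

end EsGs

end

/-! ### Assembly of the four bounds -/

theorem proposition4p7 :
    -- (i) Markov/Chebyshev-type tail bound
    (∀ (n : ℕ) (_ : 1 ≤ n) (L₀ : ℝ) (_ : 0 < L₀) (R : EsGs.Run.{u, w} n)
      (_ : EsGs.Run.Admissible.{u, v, w} R L₀) (K : ℕ) (_ : 1 ≤ K) (l : ℝ) (_ : 0 < l),
      R.tail K ((R.DX ^ 2 + R.bias L₀ K + l * (R.IA L₀ K + R.IB L₀ K)) / (2 * R.sumγ K)) ≤
        1 / l + 1 / l ^ 2) ∧
    -- (ii) and (iv), with a constant `α` that depends only on `n`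
    (∀ (n : ℕ) (_ : 1 ≤ n), ∃ α : ℝ, 0 < α ∧ α < 1 ∧
      ∀ (L₀ : ℝ) (_ : 0 < L₀) (R : EsGs.Run.{u, w} n) (_ : R.SubGaussian L₀)
        (K : ℕ) (_ : 1 ≤ K) (ε : ℝ) (_ : 0 < ε),
        -- (ii) exponential tail bound for arbitrary step lengths and smoothing parameters
        (R.Standard L₀ ∨ R.KnownDensity L₀ → EsGs.cn n L₀ * R.cK K ≤ ε →
          R.tail K ((R.cD L₀ α K + ε + √(2 * n * R.cL L₀ * R.cK K / α * ε)) / (2 * R.sumγ K)) ≤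
            Real.exp (-ε / 3) +
              (ε / (EsGs.cn n L₀ * R.cK K)) ^ R.cK K *
                Real.exp (R.cK K - ε / EsGs.cn n L₀)) ∧
        -- (iv) the step lengths `1 / √(k + 1)` and `c_K = ε / (2 c_n)`
        (EsGs.Run.Admissible.{u, v, w} R L₀ →
          (∀ k : ℕ, R.γ k = 1 / √((k : ℝ) + 1) ∧ R.η k = 1 / √((k : ℝ) + 1)) →
          R.cK K = ε / (2 * EsGs.cn n L₀) →
          R.tail K (ε / (4 * EsGs.cn n L₀) *
              (R.DX ^ 2 + √(R.cL L₀ * n * ε / (α * EsGs.cn n L₀)) +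
                ε * (2 * L₀ * √((n : ℝ) + 1) + 1 +
                  √(2 * n * R.cL L₀ / (2 * α * EsGs.cn n L₀))))) ≤
            Real.exp (-ε / 3) + (Real.exp 1 / 2) ^ (-(ε / (2 * EsGs.cn n L₀))))) ∧
    -- (iii) the rate, with a constant `C` that depends on neither `n` nor `K`
    (∀ (L₀ D : ℝ) (_ : 0 < L₀), ∃ C : ℝ, 0 < C ∧
      ∀ (n : ℕ) (_ : 1 ≤ n) (R : EsGs.Run.{u, w} n)
        (_ : EsGs.Run.Admissible.{u, v, w} R L₀) (_ : R.SubGaussian L₀) (_ : R.DX = D)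
        (_ : ∀ k : ℕ, R.γ k = 1 / √((k : ℝ) + 1) ∧ R.η k = 1 / √((k : ℝ) + 1))
        (K : ℕ) (_ : 1 ≤ K),
        R.tail K (C * n * Real.log K / √(K : ℝ)) ≤
          (K : ℝ) ^ (-(4 / 3) : ℝ) + (K : ℝ) ^ (Real.log 4 - 3)) := by
  refine ⟨?_, ?_, ?_⟩
  · intro n hn L₀ hL₀ R hR K hK l hl
    rcases hR.cases with O | S
    · exact EsGs.Run.tail_le_markov O hn hL₀ hK hl
    · have hs := EsGs.Run.sumγ_pos (R := R) hK
      have hb := R.bias_nonneg hL₀.le K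
      have hB : 0 < R.IB L₀ K := mul_pos (EsGs.Run.cn_pos hn hL₀) (EsGs.Run.cK_pos (R := R) hK)
      have hA : 0 ≤ R.IA L₀ K := Real.sqrt_nonneg _
      rw [S.tail_eq_zero K (by positivity)]
      positivity
  · intro n hn
    -- This value is dictated by (ii); (iv) holds for every `α` in `(0, 1)`.
    refine ⟨1 / 16, by norm_num, by norm_num, fun L₀ hL₀ R hsub K hK ε hε => ⟨?_, ?_⟩⟩
    · intro hR hεc
      have hs := EsGs.Run.sumγ_pos (R := R) hK
      have hb := R.bias_nonneg hL₀.le K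
      have hc := EsGs.Run.cK_pos (R := R) hK
      have hcn := EsGs.Run.cn_pos hn hL₀
      have hpos : 0 ≤ (ε / (EsGs.cn n L₀ * R.cK K)) ^ R.cK K *
          Real.exp (R.cK K - ε / EsGs.cn n L₀) := by positivity
      rcases hR with S | S
      · exact (EsGs.Run.tail_le_exp S hsub hn hL₀ hK hε hεc).trans (by linarith)
      · have hcD : 0 ≤ R.cD L₀ (1 / 16) K := by unfold EsGs.Run.cD; positivity
        rw [S.tail_eq_zero K (by positivity)]
        positivity
    · intro hR hstep hcK
      have hcn := EsGs.Run.cn_pos hn hL₀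
      rcases hR.cases with O | S
      · rw [EsGs.Run.tail_eq_zero_of_cK hstep O hn hL₀ hK hε (by norm_num) (by norm_num) hcK]
        positivity
      · rw [S.tail_eq_zero K (by positivity)]
        positivity
  · intro L₀ D hL₀
    -- `D` ranges over all real numbers here, hence the absolute value in `rateConst` that keeps the
    -- constant positive.
    refine ⟨EsGs.Run.rateConst L₀ D, EsGs.Run.rateConst_pos hL₀ D, ?_⟩
    intro n hn R hR hsub hD hstep K hK
    -- For `K = 1` the threshold is `0`, but the right-hand side is `2`.
    rcases hK.eq_or_lt with rfl | hK2
    · simp only [Nat.cast_one, Real.one_rpow]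
      exact measureReal_le_one.trans (by norm_num)
    · rcases hR.cases with O | S
      · subst hD
        exact EsGs.Run.tail_le_rate hstep O hsub hn hL₀ hK2
      · have hC := EsGs.Run.rateConst_pos hL₀ D
        have hlog := EsGs.Run.log_nat_ge hK2
        have hlog0 : 0 < Real.log K := by linarith
        have hn0 : (0 : ℝ) < n := by exact_mod_cast hn
        have hK0 : (0 : ℝ) < K := by exact_mod_cast hK
        rw [S.tail_eq_zero K (by positivity)]
        positivity
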